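/- Let $\theta>-1$, $-1\le\sigma\le\frac12$, $R>0$, and put $\alpha=1+\theta$, $b=\frac{\sigma}{2(1-\sigma)}$, $\gamma=-\theta b+\sqrt{\theta^2b^2+1+\theta}$. Equip the cylinder $0<r<R$ (cylindrical coordinates $r,\varphi,z$) with the elastic-gauge metric of a wedge dislocation $$dl^2=\left(\frac rR\right)^{2\gamma-2}\left(dr^2+\frac{\alpha^2r^2}{\gamma^2}d\varphi^2\right)+dz^2 ,$$ and let $\tilde\triangle\Psi=\frac1{\sqrt g}\partial_\mu(\sqrt g\,g^{\mu\nu}\partial_\nu\Psi)$ be its Laplace--Beltrami operator. Let $\hbar>0$, $M\ne0$, and let either $Z(z)=\frac1{\sqrt{2\pi}}e^{ikz}$, $k\in\mathbb R$, $z\in\mathbb R$, or $Z(z)=\sqrt{2/z_0}\,\sin(kz)$, $k=\pi l/z_0$, $l=1,2,\dots$, $0<z<z_0$. For $m\in\mathbb Z$ put $\nu=|m|/\alpha$, and let $J_\nu(z)=(z/2)^\nu\sum_{j\ge0}\frac{(-1)^j(z/2)^{2j}}{j!\,\Gamma(\nu+j+1)}$ be the Bessel function. 1. (Separation of variables.)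 Let $\chi(r,\varphi)$ be $C^2$ for $0<r<R$ and $2\pi$-periodic in $\varphi$, with Fourier components $\psi_m(r)=\frac1{2\pi}\int_0^{2\pi}\chi(r,\varphi)e^{-im\varphi}d\varphi$. Then $\chi=\sum_m\psi_m(r)e^{im\varphi}$, and for $E\in\mathbb C$ the function $\Psi=Z(z)\chi(r,\varphi)$ solves $-\frac{\hbar^2}{2M}\tilde\triangle\Psi=E\Psi$ if and only if every $\psi_m$ is a $C^2$ solution on $(0,R)$ of $$\frac{R^{2\gamma-2}}{r^{2\gamma-1}}\partial_r(r\partial_r\psi_m)+\left(\frac{2ME}{\hbar^2}-\frac{\gamma^2}{\alpha^2}\frac{R^{2\gamma-2}}{r^{2\gamma}}m^2-k^2\right)\psi_m=0 .$$ 2. (Bessel equation.) The map $\rho=\frac{r^\gamma}{\gamma R^{\gamma-1}}$ is a bijection from $(0,R)$ onto $(0,R/\gamma)$ and sends $R$ to $R/\gamma$. A function $f(\rho(r))$ is a $C^2$ solution of the radial equation if and only if $f$ is a $C^2$ solution on $(0,R/\gamma)$ of $\frac1\rho\partial_\rho(\rho\partial_\rho f)+\left(\beta^2-\frac{\nu^2}{\rho^2}\right)f=0$,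 where $\beta^2=\frac{2ME}{\hbar^2}-k^2$. 3. (Roots.) For each $m$ the equation $J_\nu(\beta R/\gamma)=0$ has only real roots $\beta$; its positive roots are simple and form an infinite increasing sequence $\beta_1<\beta_2<\cdots$ (with $\beta_n=\beta_n(m)$), and $$\lim_{n\to\infty}\left(\beta_n-\frac{\gamma\pi}R\left(n+\frac{|m|}{2\alpha}-\frac14\right)\right)=0 .$$ 4. (Spectrum.) For each $m$, the numbers $E\in\mathbb C$ for which the radial equation has a $C^2$ solution $\psi_m$ on $(0,R)$, bounded there, extending continuously to $r=R$ with $\psi_m(R)=0$, and with $\int_0^R r|\psi_m|^2dr=1$, are exactly $$E_n=\frac{\hbar^2}{2M}(k^2+\beta_n^2),\qquad n=1,2,\dots,$$ and the corresponding functions are exactly $\psi_m=c\,J_\nu(\beta_n\rho)$ with $c\in\mathbb C$ such that $\int_0^R r|\psi_m|^2dr=1$. The numbers $E\in\mathbb C$ for which the Schrödinger equation has a nonzero solution $\Psi=Z(z)\chi(r,\varphi)$, with $\chi$ as in 1, bounded, extending continuously to $r=R$ and vanishing there, are exactly the numbers $E_n=E_n(m)$ with $m\in\mathbb Z$, $n\ge1$.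 -/

import Mathlib

open Real Set Filter Topology

noncomputable section

namespace WedgeDislocation

/-- `α = 1 + θ`, where `2πθ` is the deficit angle. -/
def alpha (θ : ℝ) : ℝ := 1 + θ

/-- The exponent `γ = -θ b + √(θ² b² + 1 + θ)`, `b = σ / (2 (1 - σ))`, `σ` the Poisson ratio. -/
def gam (θ σ : ℝ) : ℝ :=
  -θ * (σ / (2 * (1 - σ))) + √(θ ^ 2 * (σ / (2 * (1 - σ))) ^ 2 + 1 + θ)

/-- The metric `(r/R)^(2γ-2) (dr² + (α²/γ²) r² dφ²) + dz²` of a wedge dislocation in the elastic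
gauge, in cylindrical coordinates `x = (r, φ, z)`. -/
def metric (α γ R : ℝ) (x : Fin 3 → ℝ) : Matrix (Fin 3) (Fin 3) ℝ :=
  Matrix.diagonal ![(x 0 / R) ^ (2 * γ - 2),
    (x 0 / R) ^ (2 * γ - 2) * (α ^ 2 * x 0 ^ 2 / γ ^ 2), 1]

/-- The partial derivative `∂_μ f`. -/
def pderiv {n : ℕ} (μ : Fin n) (f : (Fin n → ℝ) → ℂ) (x : Fin n → ℝ) : ℂ :=
  deriv (fun t : ℝ => f (Function.update x μ t)) (x μ)

/-- The Laplace–Beltrami operator `(1/√g) ∂_μ (√g g^{μν} ∂_ν Ψ)` of a metric in coordinates. -/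
def laplaceBeltrami {n : ℕ} (g : (Fin n → ℝ) → Matrix (Fin n) (Fin n) ℝ)
    (Ψ : (Fin n → ℝ) → ℂ) (x : Fin n → ℝ) : ℂ :=
  ((1 / √(g x).det : ℝ) : ℂ) *
    ∑ μ, pderiv μ (fun y => ∑ ν, ((√(g y).det * (g y)⁻¹ μ ν : ℝ) : ℂ) * pderiv ν Ψ y) x

/-- The stationary Schrödinger equation `-(ħ²/2M) Δ Ψ = E Ψ` for the wedge metric, on the part
`0 < r < R`, `z ∈ I` of the cylinder. -/
def SolvesSchrodinger (α γ R ħ M : ℝ) (I : Set ℝ) (E : ℂ) (Ψ : (Fin 3 → ℝ) → ℂ) : Prop :=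
  ∀ x : Fin 3 → ℝ, x 0 ∈ Ioo 0 R → x 2 ∈ I →
    -((ħ ^ 2 / (2 * M) : ℝ) : ℂ) * laplaceBeltrami (metric α γ R) Ψ x = E * Ψ x

/-- The factor `Z(z)` on the interval `I`: either a free motion with momentum `ħk` along the whole
axis, or a motion restricted by the planes `z = 0` and `z = z₀`, where `k = πl/z₀`. -/
def IsAxialFactor (k : ℝ) (I : Set ℝ) (Z : ℝ → ℂ) : Prop :=
  (I = univ ∧ Z = fun z : ℝ => ((1 / √(2 * π) : ℝ) : ℂ) * Complex.exp (Complex.I * k * z)) ∨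
  ∃ (z₀ : ℝ) (l : ℕ), 0 < z₀ ∧ 1 ≤ l ∧ k = π * l / z₀ ∧ I = Ioo 0 z₀ ∧
    Z = fun z : ℝ => ((√(2 / z₀) * Real.sin (k * z) : ℝ) : ℂ)

/-- The wave function `Ψ(r, φ, z) = Z(z) χ(r, φ)`. -/
def waveFunction (Z : ℝ → ℂ) (χ : ℝ × ℝ → ℂ) (x : Fin 3 → ℝ) : ℂ := Z (x 2) * χ (x 0, x 1)

/-- A planar factor on `0 < r < R`: twice continuously differentiable and `2π`-periodic in `φ`. -/
def IsPlanarFactor (R : ℝ) (χ : ℝ × ℝ → ℂ) : Prop :=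
  ContDiffOn ℝ 2 χ (Ioo 0 R ×ˢ univ) ∧ ∀ r φ, χ (r, φ + 2 * π) = χ (r, φ)

/-- The `m`-th angular component `ψ_m(r)` of `χ(r, φ) = ∑ₘ ψ_m(r) e^{imφ}`. -/
def angularComponent (χ : ℝ × ℝ → ℂ) (m : ℤ) (r : ℝ) : ℂ :=
  ((1 / (2 * π) : ℝ) : ℂ) * ∫ φ in (0 : ℝ)..(2 * π), χ (r, φ) * Complex.exp (-(Complex.I * m * φ))

/-- `ψ` is a `C²` solution on `(0, R)` of the radial equation
`R^(2γ-2) / r^(2γ-1) (r ψ')' + (2ME/ħ² - (γ²/α²) (R^(2γ-2) / r^(2γ)) m² - k²) ψ = 0`. -/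
def SolvesRadial (α γ R ħ M k : ℝ) (m : ℤ) (E : ℂ) (ψ : ℝ → ℂ) : Prop :=
  ContDiffOn ℝ 2 ψ (Ioo 0 R) ∧ ∀ r ∈ Ioo 0 R,
    ((R ^ (2 * γ - 2) / r ^ (2 * γ - 1) : ℝ) : ℂ) * deriv (fun s : ℝ => (s : ℂ) * deriv ψ s) r
      + (((2 * M / ħ ^ 2 : ℝ) : ℂ) * E
          - ((γ ^ 2 / α ^ 2 * (R ^ (2 * γ - 2) / r ^ (2 * γ)) * (m : ℝ) ^ 2 + k ^ 2 : ℝ) : ℂ))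
        * ψ r = 0

/-- `f` is a `C²` solution on `(0, a)` of `(1/ρ) (ρ f')' + (w - ν²/ρ²) f = 0`, the Bessel equation
of order `ν` with `w = β²`. -/
def SolvesBessel (ν a : ℝ) (w : ℂ) (f : ℝ → ℂ) : Prop :=
  ContDiffOn ℝ 2 f (Ioo 0 a) ∧ ∀ ρ ∈ Ioo 0 a,
    ((1 / ρ : ℝ) : ℂ) * deriv (fun s : ℝ => (s : ℂ) * deriv f s) ρ
      + (w - ((ν ^ 2 / ρ ^ 2 : ℝ) : ℂ)) * f ρ = 0

/-- The new radial coordinate `ρ = r^γ / (γ R^(γ-1))`. -/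
def rho (γ R r : ℝ) : ℝ := r ^ γ / (γ * R ^ (γ - 1))

/-- The Bessel function of the first kind
`J_ν(z) = (z/2)^ν ∑ⱼ (-1)^j (z/2)^(2j) / (j! Γ(ν+j+1))` (principal branch of the power). -/
def besselJ (ν : ℝ) (z : ℂ) : ℂ :=
  (z / 2) ^ (ν : ℂ) *
    ∑' j : ℕ, (-1) ^ j * (z / 2) ^ (2 * j) / ((j.factorial * Real.Gamma (ν + j + 1) : ℝ) : ℂ)

/-- A normalized radial bound state of energy `E`: a solution of the radial equation that is bounded
near the axis, vanishes at the boundary `r = R` and has `∫₀ᴿ r |ψ|² dr = 1`. -/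
def IsRadialBoundState (α γ R ħ M k : ℝ) (m : ℤ) (E : ℂ) (ψ : ℝ → ℂ) : Prop :=
  SolvesRadial α γ R ħ M k m E ψ ∧ ContinuousOn ψ (Ioc 0 R) ∧ ψ R = 0 ∧
    (∃ C : ℝ, ∀ r ∈ Ioo 0 R, ‖ψ r‖ ≤ C) ∧ ∫ r in (0 : ℝ)..R, r * ‖ψ r‖ ^ 2 = 1

/-- `E` is an energy of a bound state `Ψ = Z(z) χ(r, φ)` in the cylinder: `Ψ` is a nonzero solution
of the Schrödinger equation that is bounded near the axis and vanishes on the wall `r = R`. -/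
def IsBoundStateEnergy (α γ R ħ M : ℝ) (I : Set ℝ) (Z : ℝ → ℂ) (E : ℂ) : Prop :=
  ∃ χ : ℝ × ℝ → ℂ, IsPlanarFactor R χ ∧
    SolvesSchrodinger α γ R ħ M I E (waveFunction Z χ) ∧
    ContinuousOn χ (Ioc 0 R ×ˢ univ) ∧ (∀ φ, χ (R, φ) = 0) ∧
    (∃ C : ℝ, ∀ r ∈ Ioo 0 R, ∀ φ, ‖χ (r, φ)‖ ≤ C) ∧ ∃ r ∈ Ioo 0 R, ∃ φ, χ (r, φ) ≠ 0

/-- `E = (ħ²/2M) (k² + β²)`. -/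
def energy (ħ M k β : ℝ) : ℂ := ((ħ ^ 2 / (2 * M) * (k ^ 2 + β ^ 2) : ℝ) : ℂ)

/-- `β 1 < β 2 < …` are the positive roots of `J_ν(β a) = 0`, in increasing order. -/
def EnumeratesRoots (ν a : ℝ) (β : ℕ → ℝ) : Prop :=
  StrictMonoOn β (Ici 1) ∧ β '' Ici 1 = {b : ℝ | 0 < b ∧ besselJ ν ((b * a : ℝ) : ℂ) = 0}

end WedgeDislocation

end

/-! The metric is conformally flat in (r, φ), so the conformal factor cancels from √g g^{rr} and √g
g^{φφ} and the Laplacian separates. The Fourier coefficients in φ of the resulting planar operator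
are the radial operators, and a continuous periodic function with vanishing coefficients is zero;
hence `solvesSchrodinger_iff`. All ordinary equations are written as x (x f')' = q f, a first-order
system for (f, x f') called `IsSol`. The power substitution ρ only multiplies q by γ², which turns
the radial equation into Bessel's.

For the spectrum, a solution with nonzero Wronskian against the regular solution is too large at the
origin, so a bounded solution is a multiple of the regular one (`IsSol.eq_const_mul_regularSol`).
The condition at r = R then puts a zero of the entire function `besselSeries` at a multiple of β²,
and `exists_pos_of_besselSeries_eq_zero` shows that such zeros are positive reals. Thus E is real
and β can be taken positive.

The remaining work is the asymptotics of the zeros with the correct numbering. A Laplace integral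
gives a complex Hankel-type solution. Its imaginary part is small enough at the origin to be a
multiple of J_ν, and at infinity it is a sine divided by √x (`besselG_asymptotic`). This locates
large zeros only modulo π. The integer is fixed by comparison: Rolle's theorem and Sturm comparison
interlace the zeros for different orders (`IsZeroSeq.lt_succ_of_add_one`, `IsZeroSeq.lt_of_lt`), the
order 1/2 is explicit because its solution is a sine, and `IsZeroSeq.tendsto_sub` carries the
numbering from there to every order by unit steps. -/

namespace WedgeDislocation

/-! ### The power series of the Bessel functions. -/

section Series

variable {𝕜 : Type*} [RCLike 𝕜]

/-- The entire function `∑ⱼ (-1)^j w^j / (j! Γ(ν+j+1))`, so that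
`J_ν(z) = (z/2)^ν besselSeries ν ((z/2)²)`. -/
noncomputable def besselSeries (ν : ℝ) (w : 𝕜) : 𝕜 :=
  ∑' j : ℕ, (-1) ^ j * w ^ j / ((j.factorial * Real.Gamma (ν + j + 1) : ℝ) : 𝕜)

/-- Each step multiplies by ν + j + 1, which is at least 1 when ν ≥ 0. -/
theorem Gamma_le_Gamma_add_nat {ν : ℝ} (hν : 0 ≤ ν) (j : ℕ) :
    Real.Gamma (ν + 1) ≤ Real.Gamma (ν + j + 1) := by
  induction j with
  | zero => simp
  | succ j ih =>
    have h : 0 < ν + j + 1 := by positivity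
    have h2 := Real.Gamma_pos_of_pos h
    have h1 : Real.Gamma (ν + (j + 1 : ℕ) + 1) = (ν + j + 1) * Real.Gamma (ν + j + 1) := by
      rw [← Real.Gamma_add_one h.ne']; push_cast; ring_nf
    rw [h1]
    have hj : (0 : ℝ) ≤ j := j.cast_nonneg
    nlinarith

/-- The free factor x lets one bound serve the terms (x = w^j) and their derivatives (x = j
w^(j-1)). -/
theorem norm_besselSeries_term_le {ν : ℝ} (hν : 0 ≤ ν) (j : ℕ) (x : 𝕜) :
    ‖(-1) ^ j * x / ((j.factorial * Real.Gamma (ν + j + 1) : ℝ) : 𝕜)‖ ≤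
      ‖x‖ / j.factorial * (Real.Gamma (ν + 1))⁻¹ := by
  have h1 : 0 < Real.Gamma (ν + 1) := Real.Gamma_pos_of_pos (by positivity)
  have h2 : 0 < Real.Gamma (ν + j + 1) := Real.Gamma_pos_of_pos (by positivity)
  have h3 : (0 : ℝ) < j.factorial := by positivity
  rw [norm_div, norm_mul, norm_pow, norm_neg, norm_one, one_pow, one_mul, RCLike.norm_ofReal,
    abs_of_pos (mul_pos h3 h2), ← div_div, ← div_eq_mul_inv]
  exact div_le_div_of_nonneg_left (by positivity) h1 (Gamma_le_Gamma_add_nat hν j)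

theorem summable_besselSeries {ν : ℝ} (hν : 0 ≤ ν) (w : 𝕜) :
    Summable fun j : ℕ => (-1) ^ j * w ^ j / ((j.factorial * Real.Gamma (ν + j + 1) : ℝ) : 𝕜) := by
  refine .of_norm_bounded ((Real.summable_pow_div_factorial ‖w‖).mul_right
    (Real.Gamma (ν + 1))⁻¹) fun j => ?_
  simpa using norm_besselSeries_term_le hν j (w ^ j)

/-- Termwise differentiation on the ball of radius ‖w‖ + 1: the derivative of term j + 1 is minus
term j of the series of order ν + 1. -/
theorem hasDerivAt_besselSeries {ν : ℝ} (hν : 0 ≤ ν) (w : 𝕜) :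
    HasDerivAt (besselSeries ν : 𝕜 → 𝕜) (-besselSeries (ν + 1) w) w := by
  set r := ‖w‖ + 1 with hr
  have hr0 : 0 ≤ r := by positivity
  have hu : Summable fun j : ℕ => j * r ^ (j - 1) / j.factorial * (Real.Gamma (ν + 1))⁻¹ := by
    refine Summable.mul_right _ ?_
    rw [← summable_nat_add_iff 1]
    refine (Real.summable_pow_div_factorial r).congr fun j => ?_
    rw [Nat.factorial_succ]
    push_cast
    have : (j : ℝ) + 1 ≠ 0 := by positivity
    field_simp
  have hw : w ∈ Metric.ball (0 : 𝕜) r := by simp [hr]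
  have key := hasDerivAt_tsum_of_isPreconnected
    (g := fun (j : ℕ) (w : 𝕜) => (-1) ^ j * w ^ j / ((j.factorial * Real.Gamma (ν + j + 1) : ℝ) : 𝕜))
    (g' := fun (j : ℕ) (w : 𝕜) =>
      (-1) ^ j * (j * w ^ (j - 1)) / ((j.factorial * Real.Gamma (ν + j + 1) : ℝ) : 𝕜)) hu
    Metric.isOpen_ball (convex_ball (0 : 𝕜) r).isPreconnected
    (fun j y _ => ((hasDerivAt_pow j y).const_mul _).div_const _)
    (fun j y hy => ?_) hw (summable_besselSeries hν w) hw
  · have hs : Summable fun j : ℕ => (-1) ^ j * (j * w ^ (j - 1)) /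
        ((j.factorial * Real.Gamma (ν + j + 1) : ℝ) : 𝕜) := by
      refine .of_norm_bounded hu fun j => (norm_besselSeries_term_le hν j _).trans ?_
      rw [norm_mul, norm_pow, RCLike.norm_natCast]
      have : 0 < Real.Gamma (ν + 1) := Real.Gamma_pos_of_pos (by positivity)
      gcongr
      rw [hr]; linarith
    refine key.congr_deriv ?_
    rw [hs.tsum_eq_zero_add, besselSeries, ← tsum_neg]
    simp only [Nat.cast_zero, zero_mul, mul_zero, zero_div, zero_add]
    refine tsum_congr fun j => ?_
    have h2 : Real.Gamma (ν + j + 1 + 1) ≠ 0 := (Real.Gamma_pos_of_pos (by positivity)).ne'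
    have e1 : ν + 1 + (j : ℝ) + 1 = ν + j + 1 + 1 := by ring
    have e2 : ν + ((j + 1 : ℕ) : ℝ) + 1 = ν + j + 1 + 1 := by push_cast; ring
    rw [e1, e2, Nat.factorial_succ]
    have h3 : (j : 𝕜) + 1 ≠ 0 := by exact_mod_cast Nat.succ_ne_zero j
    have h4 : ((j.factorial : ℕ) : 𝕜) ≠ 0 := by exact_mod_cast j.factorial_ne_zero
    have h5 : ((Real.Gamma (ν + j + 1 + 1) : ℝ) : 𝕜) ≠ 0 := by exact_mod_cast h2
    push_cast
    field_simp
    simp only [pow_succ]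
    ring
  · refine (norm_besselSeries_term_le hν j _).trans ?_
    rw [norm_mul, norm_pow, RCLike.norm_natCast]
    have : 0 < Real.Gamma (ν + 1) := Real.Gamma_pos_of_pos (by positivity)
    have hy' : ‖y‖ ≤ r := by simpa using (mem_ball_zero_iff.1 hy).le
    gcongr

theorem continuous_besselSeries {ν : ℝ} (hν : 0 ≤ ν) : Continuous (besselSeries ν : 𝕜 → 𝕜) :=
  continuous_iff_continuousAt.2 fun w => (hasDerivAt_besselSeries hν w).continuousAt

/-- The three-term recurrence of the Bessel functions. -/
theorem besselSeries_recurrence {ν : ℝ} (hν : 0 ≤ ν) (w : 𝕜) :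
    w * besselSeries (ν + 2) w = ((ν + 1 : ℝ) : 𝕜) * besselSeries (ν + 1) w - besselSeries ν w := by
  have h0 := summable_besselSeries hν w
  have h1 := summable_besselSeries (𝕜 := 𝕜) (ν := ν + 1) (by positivity) w
  have h2 := summable_besselSeries (𝕜 := 𝕜) (ν := ν + 2) (by positivity) w
  simp only [besselSeries]
  rw [← tsum_mul_left, ← tsum_mul_left, ← (h1.mul_left _).tsum_sub h0,
    ((h1.mul_left _).sub h0).tsum_eq_zero_add]
  -- The constant terms cancel because Γ(ν+2) = (ν+1) Γ(ν+1); the other terms match after a shift of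
  -- j by one.
  have hz : ((ν + 1 : ℝ) : 𝕜) * ((-1) ^ 0 * w ^ 0 /
      (((Nat.factorial 0 : ℕ) * Real.Gamma (ν + 1 + (0 : ℕ) + 1) : ℝ) : 𝕜)) -
      (-1) ^ 0 * w ^ 0 / (((Nat.factorial 0 : ℕ) * Real.Gamma (ν + (0 : ℕ) + 1) : ℝ) : 𝕜) = 0 := by
    have h : 0 < ν + 1 := by positivity
    have hG : ((Real.Gamma (ν + 1) : ℝ) : 𝕜) ≠ 0 := by
      exact_mod_cast (Real.Gamma_pos_of_pos h).ne'
    have h' : ((ν + 1 : ℝ) : 𝕜) ≠ 0 := by exact_mod_cast h.ne'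
    simp only [Nat.cast_zero, add_zero, Nat.factorial_zero, Nat.cast_one, one_mul, pow_zero]
    rw [Real.Gamma_add_one h.ne', RCLike.ofReal_mul]
    field_simp
    simp
  rw [hz, zero_add]
  refine tsum_congr fun j => ?_
  have hp : 0 < ν + j + 2 := by positivity
  have hG : ((Real.Gamma (ν + j + 2) : ℝ) : 𝕜) ≠ 0 := by
    exact_mod_cast (Real.Gamma_pos_of_pos hp).ne'
  have h' : ((ν + j + 2 : ℝ) : 𝕜) ≠ 0 := by exact_mod_cast hp.ne'
  have e1 : ν + 2 + (j : ℝ) + 1 = ν + j + 2 + 1 := by ring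
  have e2 : ν + 1 + ((j + 1 : ℕ) : ℝ) + 1 = ν + j + 2 + 1 := by push_cast; ring
  have e3 : ν + ((j + 1 : ℕ) : ℝ) + 1 = ν + j + 2 := by push_cast; ring
  have h3 : (j : 𝕜) + 1 ≠ 0 := by exact_mod_cast Nat.succ_ne_zero j
  have h4 : ((j.factorial : ℕ) : 𝕜) ≠ 0 := by exact_mod_cast j.factorial_ne_zero
  rw [e1, e2, e3, Real.Gamma_add_one hp.ne', Nat.factorial_succ]
  push_cast at h' ⊢
  field_simp
  ring

theorem besselSeries_zero (ν : ℝ) : besselSeries ν (0 : 𝕜) = ((Real.Gamma (ν + 1))⁻¹ : ℝ) := by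
  rw [besselSeries, tsum_eq_single 0 (fun j hj => by simp [hj])]
  simp

end Series

theorem besselSeries_ofReal (ν w : ℝ) :
    besselSeries ν (w : ℂ) = ((besselSeries ν w : ℝ) : ℂ) := by
  simp only [besselSeries]
  rw [Complex.ofReal_tsum]
  refine tsum_congr fun j => ?_
  simp

/-- For w ≤ 0 one has (-1)^j w^j = |w|^j, so the series dominates termwise its value 1/Γ(ν+1) at 0.
-/
theorem besselSeries_pos_of_nonpos {ν w : ℝ} (hν : 0 ≤ ν) (hw : w ≤ 0) :
    0 < besselSeries ν w := by
  have h0 : 0 < (besselSeries ν (0 : ℝ) : ℝ) := by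
    rw [besselSeries_zero]
    exact inv_pos.2 (Real.Gamma_pos_of_pos (by positivity))
  refine h0.trans_le ?_
  refine (summable_besselSeries hν (0 : ℝ)).tsum_le_tsum (fun j => ?_) (summable_besselSeries hν w)
  have h2 : 0 < Real.Gamma (ν + j + 1) := Real.Gamma_pos_of_pos (by positivity)
  have h3 : ((-1) * 0 : ℝ) ^ j ≤ (-1 * w) ^ j := pow_le_pow_left₀ (by simp) (by linarith) j
  rw [← mul_pow, ← mul_pow]
  exact div_le_div_of_nonneg_right h3 (by positivity)

theorem besselJ_eq (ν : ℝ) (z : ℂ) :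
    besselJ ν z = (z / 2) ^ (ν : ℂ) * besselSeries ν ((z / 2) ^ 2) := by
  rw [besselJ, besselSeries]
  simp only [pow_mul]
  rfl

/-- The regular solution `x^ν ∑ⱼ (-1)^j (w x²/4)^j / (j! Γ(ν+j+1))` of the Bessel equation
`x (x f')' = (ν² - w x²) f`. -/
noncomputable def regularSol (ν : ℝ) (w : ℂ) (x : ℝ) : ℂ :=
  ((x ^ ν : ℝ) : ℂ) * besselSeries ν (w * ((x / 2) ^ 2 : ℝ))

theorem besselJ_ofReal_eq_regularSol (ν : ℝ) {b x : ℝ} (hb : 0 < b) (hx : 0 ≤ x) :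
    besselJ ν ((b * x : ℝ) : ℂ) = (((b / 2) ^ ν : ℝ) : ℂ) * regularSol ν ((b ^ 2 : ℝ) : ℂ) x := by
  have h : (((b * x : ℝ) : ℂ) / 2) = (((b / 2) * x : ℝ) : ℂ) := by push_cast; ring
  rw [besselJ_eq, regularSol, h, ← Complex.ofReal_cpow (by positivity),
    Real.mul_rpow (by positivity) hx, Complex.ofReal_mul, mul_assoc]
  congr 3
  push_cast; ring

theorem besselJ_ofReal_eq_zero_iff (ν : ℝ) {x : ℝ} (hx : 0 < x) :
    besselJ ν (x : ℂ) = 0 ↔ besselSeries ν ((x / 2) ^ 2) = 0 := by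
  have h : ((x : ℂ) / 2) = ((x / 2 : ℝ) : ℂ) := by push_cast; ring
  rw [besselJ_eq, h, ← Complex.ofReal_cpow (by positivity), ← Complex.ofReal_pow,
    besselSeries_ofReal]
  norm_cast
  simp [(Real.rpow_pos_of_pos (half_pos hx) ν).ne']

/-! ### The equation x (x f')' = q f as a first-order system: uniqueness and Wronskians. -/

/-- `f` solves `x (x f')' = q f` on `(0, a)`, and `g = x f'`. -/
def IsSol (q : ℝ → ℂ) (a : ℝ) (f g : ℝ → ℂ) : Prop :=
  ∀ x ∈ Ioo 0 a, HasDerivAt f (g x / x) x ∧ HasDerivAt g (q x * f x / x) x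

/-- The system supplies its own regularity: g is C¹ because q is continuous, and then f' = g/x is
C¹. -/
theorem exists_isSol_iff {q : ℝ → ℂ} {a : ℝ} (hq : ContinuousOn q (Ioo 0 a)) (f : ℝ → ℂ) :
    (ContDiffOn ℝ 2 f (Ioo 0 a) ∧ ∀ x ∈ Ioo 0 a,
      deriv (fun s : ℝ => (s : ℂ) * deriv f s) x = q x * f x / x) ↔ ∃ g, IsSol q a f g := by
  have hx0 : ∀ x ∈ Ioo 0 a, (x : ℂ) ≠ 0 := fun x hx => by exact_mod_cast hx.1.ne'
  constructor
  · rintro ⟨hf, h⟩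
    have h2 : (2 : WithTop ℕ∞) = 1 + 1 := by norm_num
    rw [h2, contDiffOn_succ_iff_deriv_of_isOpen isOpen_Ioo] at hf
    refine ⟨fun s : ℝ => (s : ℂ) * deriv f s, fun x hx => ⟨?_, ?_⟩⟩
    · have := (hf.1.differentiableAt (isOpen_Ioo.mem_nhds hx)).hasDerivAt
      rwa [mul_div_cancel_left₀ _ (hx0 x hx)]
    · rw [← h x hx]
      have h1 := (hf.2.2.differentiableOn one_ne_zero).differentiableAt (isOpen_Ioo.mem_nhds hx)
      have h3 : DifferentiableAt ℝ (fun s : ℝ => (s : ℂ)) x :=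
        Complex.ofRealCLM.differentiableAt
      exact (h3.mul h1).hasDerivAt
  · rintro ⟨g, h⟩
    have hfd : DifferentiableOn ℝ f (Ioo 0 a) := fun x hx =>
      (h x hx).1.differentiableAt.differentiableWithinAt
    have hgd : DifferentiableOn ℝ g (Ioo 0 a) := fun x hx =>
      (h x hx).2.differentiableAt.differentiableWithinAt
    have hcoe : ContDiffOn ℝ 1 (fun s : ℝ => (s : ℂ)) (Ioo 0 a) :=
      Complex.ofRealCLM.contDiff.contDiffOn
    have hg1 : ContDiffOn ℝ 1 g (Ioo 0 a) := by
      rw [show (1 : WithTop ℕ∞) = 0 + 1 by norm_num, contDiffOn_succ_iff_deriv_of_isOpen isOpen_Ioo]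
      refine ⟨hgd, by simp, contDiffOn_zero.2 ?_⟩
      refine ContinuousOn.congr ((hq.mul hfd.continuousOn).div hcoe.continuousOn hx0)
        fun x hx => (h x hx).2.deriv
    refine ⟨?_, fun x hx => ?_⟩
    · rw [show (2 : WithTop ℕ∞) = 1 + 1 by norm_num, contDiffOn_succ_iff_deriv_of_isOpen isOpen_Ioo]
      refine ⟨hfd, by simp, ?_⟩
      exact (hg1.mul (hcoe.inv hx0)).congr fun x hx => by
        simp [(h x hx).1.deriv, div_eq_mul_inv]
    · have : (fun s : ℝ => (s : ℂ) * deriv f s) =ᶠ[𝓝 x] g := by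
        filter_upwards [isOpen_Ioo.mem_nhds hx] with s hs
        rw [(h s hs).1.deriv, mul_div_cancel₀ _ (hx0 s hs)]
      rw [this.deriv_eq, (h x hx).2.deriv]

namespace IsSol

variable {q : ℝ → ℂ} {a : ℝ} {f g F G : ℝ → ℂ}

theorem sub_const_mul (h : IsSol q a f g) (H : IsSol q a F G) (c : ℂ) :
    IsSol q a (fun x => f x - c * F x) (fun x => g x - c * G x) := fun x hx => by
  refine ⟨((h x hx).1.sub ((H x hx).1.const_mul c)).congr_deriv ?_,
    ((h x hx).2.sub ((H x hx).2.const_mul c)).congr_deriv ?_⟩ <;> ring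

/-- Uniqueness for Lipschitz systems, used on a compact subinterval [c, d] around both points so
that the singularity at 0 is avoided. -/
theorem eq_zero (hq : ContinuousOn q (Ioo 0 a)) (h : IsSol q a f g) {x₀ : ℝ} (hx₀ : x₀ ∈ Ioo 0 a)
    (hf : f x₀ = 0) (hg : g x₀ = 0) : ∀ x ∈ Ioo 0 a, f x = 0 ∧ g x = 0 := by
  intro x hx
  obtain ⟨c, hc0, hc⟩ := exists_between (lt_min hx.1 hx₀.1)
  obtain ⟨d, hd, hda⟩ := exists_between (max_lt hx.2 hx₀.2)
  rw [lt_min_iff] at hc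
  rw [max_lt_iff] at hd
  have hsub : Icc c d ⊆ Ioo 0 a := fun t ht => ⟨hc0.trans_le ht.1, ht.2.trans_lt hda⟩
  obtain ⟨B, hB⟩ := isCompact_Icc.exists_bound_of_continuousOn (hq.mono hsub)
  -- A Lipschitz constant for (f, g) ↦ (g/t, q f/t) in the sup metric when t ≥ c and ‖q‖ ≤ B; the
  -- maximum with 1 serves the first component.
  set K : NNReal := Real.toNNReal (max 1 B / c)
  have hK : (K : ℝ) = max 1 B / c := Real.coe_toNNReal _ (by positivity)
  let v : ℝ → ℂ × ℂ → ℂ × ℂ := fun t p => (p.2 / t, q t * p.1 / t)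
  have hv : ∀ t ∈ Ioo c d, LipschitzOnWith K (v t) univ := fun t ht => by
    have ht0 : 0 < t := hc0.trans ht.1
    refine (LipschitzWith.of_dist_le_mul fun p p' => ?_).lipschitzOnWith
    have ht' : ‖(t : ℂ)‖ = t := by simp [abs_of_pos ht0]
    have hm : (0 : ℝ) ≤ max 1 B := zero_le_one.trans (le_max_left _ _)
    have e1 : dist (p.2 / (t : ℂ)) (p'.2 / t) ≤ max 1 B / c * dist p p' := by
      rw [dist_eq_norm, ← sub_div, norm_div, ht', ← dist_eq_norm, div_mul_eq_mul_div]
      refine div_le_div₀ (by positivity) ?_ hc0 ht.1.le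
      calc dist p.2 p'.2 ≤ dist p p' := le_max_right _ _
        _ = 1 * dist p p' := (one_mul _).symm
        _ ≤ _ := by gcongr; exact le_max_left _ _
    have e2 : dist (q t * p.1 / (t : ℂ)) (q t * p'.1 / t) ≤ max 1 B / c * dist p p' := by
      rw [dist_eq_norm, ← sub_div, ← mul_sub, norm_div, ht', norm_mul, ← dist_eq_norm,
        div_mul_eq_mul_div]
      refine div_le_div₀ (by positivity) ?_ hc0 ht.1.le
      exact mul_le_mul ((hB t ⟨ht.1.le, ht.2.le⟩).trans (le_max_right _ _)) (le_max_left _ _)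
        dist_nonneg hm
    rw [hK, Prod.dist_eq]
    exact max_le e1 e2
  have key := ODE_solution_unique_of_mem_Ioo (v := v) (s := fun _ => univ) (K := K)
    (f := fun t => (f t, g t)) (g := fun _ => (0, 0)) (t₀ := x₀) hv ⟨hc.2, hd.2⟩
    (fun t ht => ⟨(h t (hsub ⟨ht.1.le, ht.2.le⟩)).1.prodMk (h t (hsub ⟨ht.1.le, ht.2.le⟩)).2,
      mem_univ _⟩)
    (fun t ht => ⟨
      (hasDerivAt_const t ((0, 0) : ℂ × ℂ)).congr_deriv (by ext <;> simp [v]), mem_univ _⟩)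
    (by simp [hf, hg])
  simpa using key ⟨hc.1, hd.1⟩

theorem wronskian_hasDerivAt (h : IsSol q a f g) (H : IsSol q a F G) {x : ℝ} (hx : x ∈ Ioo 0 a) :
    HasDerivAt (fun x => F x * g x - f x * G x) 0 x := by
  refine (((H x hx).1.mul (h x hx).2).sub ((h x hx).1.mul (H x hx).2)).congr_deriv ?_
  ring

theorem wronskian_eq (h : IsSol q a f g) (H : IsSol q a F G) {x y : ℝ} (hx : x ∈ Ioo 0 a)
    (hy : y ∈ Ioo 0 a) : F x * g x - f x * G x = F y * g y - f y * G y := by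
  refine isOpen_Ioo.is_const_of_deriv_eq_zero isPreconnected_Ioo
    (f := fun x => F x * g x - f x * G x) (fun z hz => ?_) (fun z hz => ?_) hx hy
  · exact (h.wronskian_hasDerivAt H hz).differentiableAt.differentiableWithinAt
  · exact (h.wronskian_hasDerivAt H hz).deriv

/-- Subtracting (f x₀ / F x₀) F kills f at x₀, and the vanishing Wronskian then kills g at x₀ as
well. -/
theorem eq_const_mul_of_wronskian_eq_zero (hq : ContinuousOn q (Ioo 0 a)) (h : IsSol q a f g)
    (H : IsSol q a F G) {x₀ : ℝ} (hx₀ : x₀ ∈ Ioo 0 a) (hF : F x₀ ≠ 0)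
    (hW : F x₀ * g x₀ - f x₀ * G x₀ = 0) : ∃ c : ℂ, ∀ x ∈ Ioo 0 a, f x = c * F x := by
  refine ⟨f x₀ / F x₀, fun x hx => sub_eq_zero.1 ?_⟩
  refine ((h.sub_const_mul H (f x₀ / F x₀)).eq_zero hq hx₀ ?_ ?_ x hx).1
  · field_simp; simp
  · field_simp; linear_combination hW

end IsSol

/-! ### The Bessel equation near the origin and its regular solution. -/

/-- The coefficient of the Bessel equation in the form `x (x f')' = (ν² - w x²) f`. -/
def besselCoeff (ν : ℝ) (w : ℂ) (x : ℝ) : ℂ := (ν : ℂ) ^ 2 - w * (x : ℂ) ^ 2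

theorem continuous_besselCoeff (ν : ℝ) (w : ℂ) : Continuous (besselCoeff ν w) := by
  unfold besselCoeff; fun_prop

/-- `x f'` for the regular solution `f` of the Bessel equation. -/
noncomputable def regularSolDeriv (ν : ℝ) (w : ℂ) (x : ℝ) : ℂ :=
  ν * regularSol ν w x - w / 2 * (((x ^ (ν + 2) : ℝ) : ℂ) * besselSeries (ν + 1) (w * ((x / 2) ^ 2 : ℝ)))

theorem hasDerivAt_besselSeries_comp {ν : ℝ} (hν : 0 ≤ ν) (w : ℂ) (x : ℝ) :
    HasDerivAt (fun x : ℝ => besselSeries ν (w * ((x / 2) ^ 2 : ℝ)))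
      (-besselSeries (ν + 1) (w * ((x / 2) ^ 2 : ℝ)) * (w * x / 2)) x := by
  have h1 : HasDerivAt (fun x : ℝ => w * (((x / 2) ^ 2 : ℝ) : ℂ)) (w * x / 2) x := by
    have h := ((((hasDerivAt_id x).div_const 2).pow 2).ofReal_comp).const_mul w
    refine h.congr_deriv ?_
    simp; ring
  exact (hasDerivAt_besselSeries hν _).comp x h1

/-- Differentiating x f' produces `besselSeries (ν + 2)`, which the three-term recurrence expresses
through the two series already present. -/
theorem isSol_regularSol {ν : ℝ} (hν : 0 ≤ ν) (w : ℂ) (a : ℝ) :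
    IsSol (besselCoeff ν w) a (regularSol ν w) (regularSolDeriv ν w) := by
  intro x hx
  have hx0 := hx.1
  have hxc : (x : ℂ) ≠ 0 := by exact_mod_cast hx0.ne'
  have hp : ∀ s : ℝ, HasDerivAt (fun x : ℝ => ((x ^ s : ℝ) : ℂ)) (s * ((x ^ s : ℝ) : ℂ) / x) x := by
    intro s
    refine (Real.hasDerivAt_rpow_const (p := s) (Or.inl hx0.ne')).ofReal_comp.congr_deriv ?_
    rw [Real.rpow_sub_one hx0.ne']
    push_cast; ring
  have hF : HasDerivAt (regularSol ν w) (regularSolDeriv ν w x / x) x := by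
    refine ((hp ν).mul (hasDerivAt_besselSeries_comp hν w x)).congr_deriv ?_
    rw [regularSolDeriv, regularSol, Real.rpow_add hx0]
    rw [eq_div_iff hxc, Real.rpow_two]
    push_cast
    have : (x : ℂ) * (x : ℂ)⁻¹ = 1 := mul_inv_cancel₀ hxc
    linear_combination (ν * ((x ^ ν : ℝ) : ℂ) * besselSeries ν (w * (x / 2 : ℂ) ^ 2)) * this
  refine ⟨hF, ((hF.const_mul (ν : ℂ)).sub (((hp (ν + 2)).mul
    (hasDerivAt_besselSeries_comp (ν := ν + 1) (by positivity) w x)).const_mul (w / 2))).congr_deriv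
      ?_⟩
  have hrec := besselSeries_recurrence hν (w * ((x / 2) ^ 2 : ℝ))
  rw [show ν + 1 + 1 = ν + 2 by ring, regularSolDeriv, regularSol, Real.rpow_add hx0, besselCoeff]
  simp only [RCLike.ofReal_eq_complex_ofReal] at hrec
  have : (x : ℂ) * (x : ℂ)⁻¹ = 1 := mul_inv_cancel₀ hxc
  rw [Real.rpow_two]
  push_cast at hrec ⊢
  rw [eq_div_iff hxc]
  set P := ((x ^ ν : ℝ) : ℂ)
  set A := besselSeries ν (w * (x / 2 : ℂ) ^ 2)
  set B := besselSeries (ν + 1) (w * (x / 2 : ℂ) ^ 2)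
  set C := besselSeries (ν + 2) (w * (x / 2 : ℂ) ^ 2)
  linear_combination (P * w * x ^ 2) * hrec + (ν ^ 2 * P * A - w * P * x ^ 2 * B * (ν + 1)) * this

theorem tendsto_besselSeries_comp {ν : ℝ} (hν : 0 ≤ ν) (w : ℂ) :
    Tendsto (fun x : ℝ => besselSeries ν (w * ((x / 2) ^ 2 : ℝ))) (𝓝[>] 0)
      (𝓝 (((Real.Gamma (ν + 1))⁻¹ : ℝ) : ℂ)) := by
  have h : Continuous (fun x : ℝ => besselSeries ν (w * ((x / 2) ^ 2 : ℝ))) :=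
    (continuous_besselSeries hν).comp (by fun_prop)
  have h0 := h.tendsto 0
  simp only [zero_div, ne_eq, OfNat.ofNat_ne_zero, not_false_eq_true, zero_pow, Complex.ofReal_zero,
    mul_zero, besselSeries_zero] at h0
  exact h0.mono_left nhdsWithin_le_nhds

/-- Near the origin the quotient of a solution with a nonzero Wronskian by the regular solution
grows at least as fast as a primitive of `x^(-1-2ν)`. -/
theorem IsSol.exists_re_le {ν : ℝ} (hν : 0 ≤ ν) {w : ℂ} {a : ℝ} {f g : ℝ → ℂ} (ha : 0 < a)
    (h : IsSol (besselCoeff ν w) a f g) {K : ℂ} (hK : K ≠ 0)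
    (hW : ∀ x ∈ Ioo 0 a, regularSol ν w x * g x - f x * regularSolDeriv ν w x = K)
    {P : ℝ → ℝ} (hP : ∀ x, 0 < x → HasDerivAt P (x ^ (-1 - 2 * ν)) x) :
    ∃ B c : ℝ, 0 < c ∧ ∀ᶠ x in 𝓝[>] (0 : ℝ),
      ((starRingEnd ℂ) K * (f x / regularSol ν w x)).re ≤ B + c * P x := by
  set S : ℝ → ℂ := fun x => besselSeries ν (w * ((x / 2) ^ 2 : ℝ))
  have hS : Tendsto S (𝓝[>] 0) (𝓝 (((Real.Gamma (ν + 1))⁻¹ : ℝ) : ℂ)) :=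
    tendsto_besselSeries_comp hν w
  have hG : 0 < (Real.Gamma (ν + 1))⁻¹ := inv_pos.2 (Real.Gamma_pos_of_pos (by positivity))
  set γ₀ := (Real.Gamma (ν + 1))⁻¹
  have hS2 : Tendsto (fun x => ((S x ^ 2)⁻¹).re) (𝓝[>] 0) (𝓝 ((γ₀ ^ 2)⁻¹)) := by
    have h1 : Tendsto (fun x => (S x ^ 2)⁻¹) (𝓝[>] 0) (𝓝 ((γ₀ : ℂ) ^ 2)⁻¹) :=
      (hS.pow 2).inv₀ (by exact_mod_cast (pow_pos hG 2).ne')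
    have h2 := (Complex.continuous_re.tendsto _).comp h1
    have e : ((γ₀ : ℂ) ^ 2)⁻¹.re = (γ₀ ^ 2)⁻¹ := by norm_cast
    rwa [e] at h2
  -- Half the limit of Re S⁻², hence a positive lower bound for it near the origin.
  set c₀ := (γ₀ ^ 2)⁻¹ / 2
  have hc₀ : 0 < c₀ := by positivity
  have hev : ∀ᶠ x in 𝓝[>] (0 : ℝ), c₀ < ((S x ^ 2)⁻¹).re ∧ x < a := by
    refine (hS2.eventually_const_lt (half_lt_self (by positivity))).and ?_
    exact nhdsWithin_le_nhds (eventually_lt_nhds ha)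
  obtain ⟨δ, hδ : 0 < δ, hsub⟩ := mem_nhdsGT_iff_exists_Ioo_subset.1 hev
  have hS0 : ∀ x ∈ Ioo 0 δ, S x ≠ 0 := fun x hx h0 => by
    have := (hsub hx).1
    simp only [h0] at this
    simp at this
    linarith
  have hF0 : ∀ x ∈ Ioo 0 δ, regularSol ν w x ≠ 0 := fun x hx =>
    mul_ne_zero (by exact_mod_cast (Real.rpow_pos_of_pos hx.1 ν).ne') (hS0 x hx)
  have hK2 : 0 < ‖K‖ ^ 2 := by positivity
  -- With F = x^ν S the regular solution, (f/F)' = K/(x F²), so the derivative of Re(K̄ f/F) is ‖K‖²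
  -- x^(-1-2ν) Re S⁻². Subtracting c₀ ‖K‖² P leaves a nondecreasing function, which is bounded above
  -- near 0 by its value at δ/2.
  set t : ℝ → ℝ := fun x =>
    ((starRingEnd ℂ) K * (f x / regularSol ν w x)).re - ‖K‖ ^ 2 * c₀ * P x
  have hd : ∀ x ∈ Ioo 0 δ, HasDerivAt t
      (‖K‖ ^ 2 * x ^ (-1 - 2 * ν) * (((S x ^ 2)⁻¹).re - c₀)) x := fun x hx => by
    have hxa : x ∈ Ioo 0 a := ⟨hx.1, (hsub hx).2⟩
    have hxc : (x : ℂ) ≠ 0 := by exact_mod_cast hx.1.ne'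
    have h1 := ((h x hxa).1.div (isSol_regularSol hν w a x hxa).1 (hF0 x hx)).const_mul
      ((starRingEnd ℂ) K)
    have h2 := (Complex.reCLM.hasFDerivAt.comp_hasDerivAt x h1).sub
      ((hP x hx.1).const_mul (‖K‖ ^ 2 * c₀))
    refine h2.congr_deriv ?_
    have e : (starRingEnd ℂ) K * ((g x / x * regularSol ν w x - f x * (regularSolDeriv ν w x / x)) /
        regularSol ν w x ^ 2) = ((‖K‖ ^ 2 * x ^ (-1 - 2 * ν) : ℝ) : ℂ) * (S x ^ 2)⁻¹ := by
      have e1 : g x / x * regularSol ν w x - f x * (regularSolDeriv ν w x / x) = K / x := by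
        rw [← hW x hxa]; field_simp
      have e2 : x ^ (-1 - 2 * ν) = x⁻¹ * ((x ^ ν) ^ 2)⁻¹ := by
        rw [Real.rpow_sub hx.1, Real.rpow_neg_one, mul_comm 2 ν, Real.rpow_mul hx.1.le,
          Real.rpow_two]
        rfl
      have e3 := Complex.conj_mul' K
      have hxν : ((x ^ ν : ℝ) : ℂ) ≠ 0 := by exact_mod_cast (Real.rpow_pos_of_pos hx.1 ν).ne'
      have hSx := hS0 x hx
      rw [e1, e2, show regularSol ν w x = ((x ^ ν : ℝ) : ℂ) * S x from rfl]
      push_cast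
      rw [← e3]
      field_simp
    rw [e]
    simp only [Complex.reCLM_apply, Complex.re_ofReal_mul]
    ring
  have hmono : MonotoneOn t (Ioo 0 δ) := by
    refine monotoneOn_of_deriv_nonneg (convex_Ioo 0 δ)
      (fun x hx => (hd x hx).continuousAt.continuousWithinAt) ?_ ?_ <;> rw [interior_Ioo]
    · exact fun x hx => (hd x hx).differentiableAt.differentiableWithinAt
    · intro x hx
      rw [(hd x hx).deriv]
      have := (hsub hx).1
      have := Real.rpow_pos_of_pos hx.1 (-1 - 2 * ν)
      exact mul_nonneg (by positivity) (by linarith)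
  refine ⟨t (δ / 2), ‖K‖ ^ 2 * c₀, by positivity, ?_⟩
  filter_upwards [Ioo_mem_nhdsGT (half_pos hδ)] with x hx
  have := hmono ⟨hx.1, hx.2.trans (half_lt_self hδ)⟩ ⟨half_pos hδ, half_lt_self hδ⟩ hx.2.le
  simp only [t] at this ⊢
  linarith

theorem exists_regularSol_ne_zero {ν : ℝ} (hν : 0 ≤ ν) (w : ℂ) {a : ℝ} (ha : 0 < a) :
    ∃ x ∈ Ioo 0 a, regularSol ν w x ≠ 0 := by
  have hG : (((Real.Gamma (ν + 1))⁻¹ : ℝ) : ℂ) ≠ 0 := by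
    exact_mod_cast (inv_pos.2 (Real.Gamma_pos_of_pos (by positivity))).ne'
  obtain ⟨x, hx, hxa⟩ := (((tendsto_besselSeries_comp hν w).eventually_ne hG).and
    (Ioo_mem_nhdsGT ha)).exists
  exact ⟨x, hxa, mul_ne_zero (by exact_mod_cast (Real.rpow_pos_of_pos hxa.1 ν).ne') hx⟩

/-- A solution of the Bessel equation that is `o(x^(-ν))`, or bounded if `ν = 0`, at the origin is
a multiple of the regular solution. -/
theorem IsSol.eq_const_mul_regularSol {ν : ℝ} (hν : 0 ≤ ν) {w : ℂ} {a : ℝ} {f g : ℝ → ℂ}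
    (ha : 0 < a) (h : IsSol (besselCoeff ν w) a f g)
    (hb : (∃ C : ℝ, ∀ᶠ x in 𝓝[>] (0 : ℝ), ‖f x‖ ≤ C) ∨
      0 < ν ∧ Tendsto (fun x : ℝ => ((x ^ ν : ℝ) : ℂ) * f x) (𝓝[>] 0) (𝓝 0)) :
    ∃ c : ℂ, ∀ x ∈ Ioo 0 a, f x = c * regularSol ν w x := by
  have H := isSol_regularSol hν w a
  obtain ⟨x₀, hx₀, hF⟩ := exists_regularSol_ne_zero hν w ha
  refine h.eq_const_mul_of_wronskian_eq_zero (continuous_besselCoeff ν w).continuousOn H hx₀ hF ?_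
  by_contra hK
  have hW := fun x hx => h.wronskian_eq H (x := x) (y := x₀) hx hx₀
  set K := regularSol ν w x₀ * g x₀ - f x₀ * regularSolDeriv ν w x₀
  have hS := tendsto_besselSeries_comp hν w
  have hG : 0 < (Real.Gamma (ν + 1))⁻¹ := inv_pos.2 (Real.Gamma_pos_of_pos (by positivity))
  have hGc : (((Real.Gamma (ν + 1))⁻¹ : ℝ) : ℂ) ≠ 0 := by exact_mod_cast hG.ne'
  rcases hν.eq_or_lt with hν0 | hν0
  -- For ν = 0 the primitive is the logarithm, so the upper bound tends to -∞, while f/F is bounded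
  -- because F has a nonzero limit.
  · obtain ⟨C, hC⟩ : ∃ C : ℝ, ∀ᶠ x in 𝓝[>] (0 : ℝ), ‖f x‖ ≤ C := by
      rcases hb with hb | hb
      · exact hb
      · exact absurd hb.1 (hν0 ▸ lt_irrefl _)
    obtain ⟨B, c, hc, hle⟩ := h.exists_re_le hν ha hK hW (P := Real.log) fun x hx => by
      rw [← hν0]; simpa [Real.rpow_neg_one] using Real.hasDerivAt_log hx.ne'
    have hlim : Tendsto (fun x => B + c * Real.log x) (𝓝[>] 0) atBot :=
      tendsto_atBot_add_const_left _ _ (Real.tendsto_log_nhdsGT_zero.const_mul_atBot hc)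
    have hSi := (hS.inv₀ hGc).norm
    have hbd := hSi.eventually_lt_const (lt_add_one _)
    set D := ‖((((Real.Gamma (ν + 1))⁻¹ : ℝ) : ℂ))⁻¹‖ + 1
    obtain ⟨x, hx1, hx2, hx3, hx4, hx5⟩ := (hle.and (hC.and (hbd.and
      ((hlim.eventually_lt_atBot (-(‖K‖ * (C * D)))).and self_mem_nhdsWithin)))).exists
    have e : ‖(starRingEnd ℂ) K * (f x / regularSol ν w x)‖ ≤ ‖K‖ * (C * D) := by
      rw [norm_mul, RCLike.norm_conj, regularSol, ← hν0, Real.rpow_zero, Complex.ofReal_one, one_mul,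
        div_eq_mul_inv, norm_mul]
      rw [← hν0] at hx3
      gcongr
      exact (norm_nonneg _).trans hx2
    have := (abs_le.1 ((Complex.abs_re_le_norm _).trans e)).1
    linarith
  -- For ν > 0 boundedness also implies x^ν f → 0, so a single hypothesis remains.
  · have ht : Tendsto (fun x : ℝ => ((x ^ ν : ℝ) : ℂ) * f x) (𝓝[>] 0) (𝓝 0) := by
      rcases hb with ⟨C, hC⟩ | hb
      · have h0 : Tendsto (fun x : ℝ => x ^ ν) (𝓝[>] 0) (𝓝 0) := by
          have := (Real.continuousAt_rpow_const 0 ν (Or.inr hν)).tendsto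
          rw [Real.zero_rpow hν0.ne'] at this
          exact this.mono_left nhdsWithin_le_nhds
        refine squeeze_zero_norm' ?_ (by simpa using h0.mul_const C)
        filter_upwards [hC, self_mem_nhdsWithin] with x hx hx0
        rw [norm_mul, Complex.norm_real, Real.norm_of_nonneg (Real.rpow_nonneg (le_of_lt hx0) _)]
        exact mul_le_mul_of_nonneg_left hx (Real.rpow_nonneg (le_of_lt hx0) _)
      · exact hb.2
    obtain ⟨B, c, hc, hle⟩ := h.exists_re_le hν ha hK hW
      (P := fun x => -(2 * ν)⁻¹ * x ^ (-(2 * ν))) fun x hx => by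
      refine ((Real.hasDerivAt_rpow_const (Or.inl hx.ne')).const_mul _).congr_deriv ?_
      rw [show -(2 * ν) - 1 = -1 - 2 * ν by ring]
      field_simp
    have h0 : Tendsto (fun x : ℝ => x ^ (2 * ν)) (𝓝[>] 0) (𝓝 0) := by
      have := (Real.continuousAt_rpow_const 0 (2 * ν) (Or.inr (by positivity))).tendsto
      rw [Real.zero_rpow (by positivity)] at this
      exact this.mono_left nhdsWithin_le_nhds
    have hl : Tendsto (fun x : ℝ => ((starRingEnd ℂ) K * (((x ^ ν : ℝ) : ℂ) * f x *
        (besselSeries ν (w * ((x / 2) ^ 2 : ℝ)))⁻¹)).re) (𝓝[>] 0) (𝓝 0) := by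
      have := (Complex.continuous_re.tendsto _).comp
        ((ht.mul (hS.inv₀ hGc)).const_mul ((starRingEnd ℂ) K))
      simp only [zero_mul, mul_zero, Complex.zero_re] at this
      exact this
    have hr : Tendsto (fun x : ℝ => B * x ^ (2 * ν) - c * (2 * ν)⁻¹) (𝓝[>] 0)
        (𝓝 (-(c * (2 * ν)⁻¹))) := by
      simpa using (h0.const_mul B).sub_const (c * (2 * ν)⁻¹)
    -- Multiply the bound by x^(2ν): the left side x^ν K̄ f/S tends to 0, the right side to -c/(2ν)
    -- < 0.
    have := le_of_tendsto_of_tendsto hl hr (by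
      filter_upwards [hle, self_mem_nhdsWithin] with x hx hx0
      have hx0 : 0 < x := hx0
      have hp : 0 < x ^ (2 * ν) := Real.rpow_pos_of_pos hx0 _
      have hpν : 0 < x ^ ν := Real.rpow_pos_of_pos hx0 _
      have hpνc : ((x ^ ν : ℝ) : ℂ) ≠ 0 := by exact_mod_cast hpν.ne'
      have e2 : x ^ (2 * ν) = (x ^ ν) ^ 2 := by
        rw [mul_comm, Real.rpow_mul hx0.le, Real.rpow_two]
      have e1 : (starRingEnd ℂ) K * (((x ^ ν : ℝ) : ℂ) * f x *
          (besselSeries ν (w * ((x / 2) ^ 2 : ℝ)))⁻¹) =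
          ((x ^ (2 * ν) : ℝ) : ℂ) * ((starRingEnd ℂ) K * (f x / regularSol ν w x)) := by
        rw [regularSol, e2, Complex.ofReal_pow (x ^ ν) 2, div_eq_mul_inv (f x), mul_inv]
        field_simp
      rw [e1, Complex.re_ofReal_mul]
      have := mul_le_mul_of_nonneg_left hx hp.le
      refine this.trans (le_of_eq ?_)
      rw [Real.rpow_neg hx0.le]
      field_simp
      ring)
    have : 0 < c * (2 * ν)⁻¹ := by positivity
    linarith

/-! ### Reality and simplicity of the zeros. -/

/-- The zeros of the entire function `besselSeries ν` are real and positive. -/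
theorem exists_pos_of_besselSeries_eq_zero {ν : ℝ} (hν : 0 ≤ ν) {w : ℂ}
    (hw : besselSeries ν w = 0) : ∃ t : ℝ, 0 < t ∧ w = t := by
  have him : w.im = 0 := by
    by_contra him
    -- The segment t ↦ t w joins 0, where the series is nonzero, to the zero w. Along it (t^(ν+1)
    -- y')' = -w t^ν y.
    set y : ℝ → ℂ := fun t => besselSeries ν ((t : ℂ) * w)
    set y₁ : ℝ → ℂ := fun t => -w * besselSeries (ν + 1) ((t : ℂ) * w)
    have hlin : ∀ t : ℝ, HasDerivAt (fun t : ℝ => (t : ℂ) * w) w t := fun t => by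
      simpa using (Complex.ofRealCLM.hasDerivAt (x := t)).mul_const w
    have hy : ∀ t : ℝ, HasDerivAt y (y₁ t) t := fun t =>
      ((hasDerivAt_besselSeries hν _).comp t (hlin t)).congr_deriv (by simp only [y₁]; ring)
    have hyc : Continuous y := continuous_iff_continuousAt.2 fun t => (hy t).continuousAt
    have hy1c : Continuous y₁ :=
      continuous_const.mul ((continuous_besselSeries (by positivity)).comp (by fun_prop))
    set M : ℝ → ℂ := fun t => ((t ^ (ν + 1) : ℝ) : ℂ) * y₁ t
    have hM : ∀ t : ℝ, 0 < t → HasDerivAt M (-w * ((t ^ ν : ℝ) : ℂ) * y t) t := fun t ht => by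
      have h1 := (Real.hasDerivAt_rpow_const (p := ν + 1) (Or.inl ht.ne')).ofReal_comp
      have h2 := (((hasDerivAt_besselSeries (ν := ν + 1) (by positivity) _).comp t
        (hlin t)).const_mul (-w))
      refine (h1.mul h2).congr_deriv ?_
      have hrec := besselSeries_recurrence hν ((t : ℂ) * w)
      simp only [RCLike.ofReal_eq_complex_ofReal] at hrec
      rw [show ν + 1 + 1 = ν + 2 by ring, Real.rpow_add ht, Real.rpow_one]
      simp only [y, add_sub_cancel_right, Function.comp_apply]
      push_cast at hrec ⊢
      linear_combination w * ((t ^ ν : ℝ) : ℂ) * hrec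
    have hMc : Continuous M := by
      have : Continuous fun t : ℝ => t ^ (ν + 1) :=
        Real.continuous_rpow_const (by positivity)
      exact (Complex.continuous_ofReal.comp this).mul hy1c
    -- Lagrange's identity: in the derivative of t^(ν+1) y' ȳ the term t^(ν+1) |y'|² is real, so Λ'
    -- = -Im w · t^ν |y|², which for t > 0 vanishes only at zeros of y.
    set Λ : ℝ → ℝ := fun t => (M t * star (y t)).im
    have hΛc : Continuous Λ := Complex.continuous_im.comp (hMc.mul hyc.star)
    have hΛ : ∀ t : ℝ, 0 < t → HasDerivAt Λ (-w.im * t ^ ν * ‖y t‖ ^ 2) t := fun t ht => by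
      have h := Complex.imCLM.hasFDerivAt.comp_hasDerivAt t ((hM t ht).mul (hy t).star)
      refine h.congr_deriv ?_
      have e : -w * ((t ^ ν : ℝ) : ℂ) * y t * star (y t) + M t * star (y₁ t) =
          ((t ^ ν * ‖y t‖ ^ 2 : ℝ) : ℂ) * -w + ((t ^ (ν + 1) * ‖y₁ t‖ ^ 2 : ℝ) : ℂ) := by
        have e1 := Complex.mul_conj' (y t)
        have e2 := Complex.mul_conj' (y₁ t)
        rw [starRingEnd_apply] at e1 e2
        push_cast
        rw [← e1, ← e2]
        simp only [M]
        ring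
      rw [e, Complex.imCLM_apply, Complex.add_im, Complex.im_ofReal_mul, Complex.ofReal_im,
        Complex.neg_im]
      ring
    have hc : IsCompact {t ∈ Icc (0 : ℝ) 1 | y t = 0} :=
      isCompact_Icc.inter_right (isClosed_eq hyc continuous_const)
    -- At the first zero t of y, as at 0, Λ vanishes; Rolle's theorem then yields an earlier zero of
    -- y.
    obtain ⟨t, ⟨ht, hyt⟩, hmin⟩ := hc.exists_isLeast ⟨1, by simp, by simpa [y] using hw⟩
    have hy0 : y 0 ≠ 0 := by
      simp only [y, Complex.ofReal_zero, zero_mul, besselSeries_zero]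
      have hG : 0 < (Real.Gamma (ν + 1))⁻¹ := inv_pos.2 (Real.Gamma_pos_of_pos (by positivity))
      exact fun h => hG.ne' (by simpa using h)
    have ht0 : 0 < t := ht.1.lt_of_ne (fun h => hy0 (h ▸ hyt))
    obtain ⟨s, hs, hs'⟩ := exists_hasDerivAt_eq_zero ht0 hΛc.continuousOn
      (by
        have : (0 : ℝ) ^ (ν + 1) = 0 := Real.zero_rpow (by positivity)
        simp [Λ, M, hyt, this])
      (fun s hs => hΛ s hs.1)
    have hsν := (Real.rpow_pos_of_pos hs.1 ν).ne'
    have hys : y s = 0 := by simpa [him, hsν] using hs'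
    exact absurd (hmin ⟨⟨hs.1.le, hs.2.le.trans ht.2⟩, hys⟩) (not_le.2 hs.2)
  have hwr : w = (w.re : ℂ) := Complex.ext (by simp) (by simp [him])
  refine ⟨w.re, ?_, hwr⟩
  by_contra h
  have := besselSeries_pos_of_nonpos hν (not_lt.1 h)
  rw [hwr, besselSeries_ofReal] at hw
  exact this.ne' (by exact_mod_cast hw)

/-- If both series vanished at t, the regular solution with w = 1 would have zero data at x = 2√t
and would vanish identically, yet it is nonzero near the origin. -/
theorem besselSeries_add_one_ne_zero {ν t : ℝ} (hν : 0 ≤ ν) (ht : 0 < t)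
    (h : besselSeries ν t = 0) : besselSeries (ν + 1) t ≠ 0 := by
  intro h1
  have hx : 0 < 2 * √t := by positivity
  have e : ((1 : ℂ) * (((2 * √t) / 2) ^ 2 : ℝ)) = (t : ℂ) := by
    rw [one_mul, mul_div_cancel_left₀ _ two_ne_zero, Real.sq_sqrt ht.le]
  have hmem : 2 * √t ∈ Ioo 0 (2 * √t + 1) := ⟨hx, by linarith⟩
  have hF : regularSol ν 1 (2 * √t) = 0 := by
    rw [regularSol, e, besselSeries_ofReal, h]; simp
  have hG : regularSolDeriv ν 1 (2 * √t) = 0 := by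
    rw [regularSolDeriv, hF, e, besselSeries_ofReal, h1]; simp
  obtain ⟨x, hx, hne⟩ := exists_regularSol_ne_zero hν 1 (a := 2 * √t + 1) (by positivity)
  exact hne ((isSol_regularSol hν 1 _).eq_zero (continuous_besselCoeff ν 1).continuousOn hmem hF hG
    x hx).1

/-- At a zero the product rule leaves only the derivative of the series factor, a nonzero multiple
of the series of order ν + 1. -/
theorem deriv_besselJ_ne_zero {ν x : ℝ} (hν : 0 ≤ ν) (hx : 0 < x) (h : besselJ ν (x : ℂ) = 0) :
    deriv (besselJ ν) (x : ℂ) ≠ 0 := by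
  rw [besselJ_ofReal_eq_zero_iff ν hx] at h
  have h1 := besselSeries_add_one_ne_zero hν (by positivity) h
  have hz : (x : ℂ) / 2 = ((x / 2 : ℝ) : ℂ) := by push_cast; ring
  have hz0 : (x : ℂ) / 2 ≠ 0 := by
    rw [hz]; exact_mod_cast (half_pos hx).ne'
  have hlin : HasDerivAt (fun z : ℂ => z / 2) (1 / 2) (x : ℂ) := (hasDerivAt_id _).div_const 2
  have hp : DifferentiableAt ℂ (fun z : ℂ => (z / 2) ^ (ν : ℂ)) (x : ℂ) :=
    hlin.differentiableAt.cpow (differentiableAt_const _)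
      (by rw [hz]; exact Or.inl (by simpa using hx))
  have hs := (hasDerivAt_besselSeries hν (((x : ℂ) / 2) ^ 2)).comp (x : ℂ) (hlin.pow 2)
  have hd := hp.hasDerivAt.mul hs
  have e : besselJ ν = (fun z : ℂ => (z / 2) ^ (ν : ℂ)) *
      (besselSeries ν ∘ ((fun z : ℂ => z / 2) ^ 2)) := funext fun z => besselJ_eq ν z
  rw [e, hd.deriv]
  have e0 : besselSeries ν (((x : ℂ) / 2) ^ 2) = 0 := by
    rw [hz, ← Complex.ofReal_pow, besselSeries_ofReal, h, Complex.ofReal_zero]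
  have e1 : besselSeries (ν + 1) (((x : ℂ) / 2) ^ 2) ≠ 0 := by
    rw [hz, ← Complex.ofReal_pow, besselSeries_ofReal]
    exact_mod_cast h1
  have hc : ((x : ℂ) / 2) ^ (ν : ℂ) ≠ 0 := by simp [Complex.cpow_eq_zero_iff, hx.ne']
  simp [e0, e1, hc, hx.ne']

/-- For z ≠ 0 the power factor does not vanish, so (z a / 2)² is a positive real zero of the series;
a purely imaginary z would make this square negative. -/
theorem im_eq_zero_of_besselJ_eq_zero {ν a : ℝ} (hν : 0 ≤ ν) (ha : 0 < a) {z : ℂ}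
    (h : besselJ ν (z * (a : ℂ)) = 0) : z.im = 0 := by
  by_cases hz : z = 0
  · simp [hz]
  have hac : (a : ℂ) ≠ 0 := by exact_mod_cast ha.ne'
  rw [besselJ_eq] at h
  rcases mul_eq_zero.1 h with h | h
  · simp [Complex.cpow_eq_zero_iff, hz, hac] at h
  · obtain ⟨t, ht, hzt⟩ := exists_pos_of_besselSeries_eq_zero hν h
    have h0 := congrArg Complex.im hzt
    have h1 := congrArg Complex.re hzt
    simp [pow_two] at h0 h1
    by_contra him
    have hre : z.re = 0 := by
      have : z.re * z.im * (a * a) = 0 := by linarith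
      simpa [him, ha.ne'] using this
    rw [hre] at h1
    have := mul_self_nonneg (z.im * a / 2)
    nlinarith

/-- `(x/2)^(-ν) J_ν(x)` as a real function. -/
noncomputable def besselG (ν x : ℝ) : ℝ := besselSeries ν ((x / 2) ^ 2)

theorem hasDerivAt_besselG {ν : ℝ} (hν : 0 ≤ ν) (x : ℝ) :
    HasDerivAt (besselG ν) (-(x / 2) * besselG (ν + 1) x) x := by
  refine ((hasDerivAt_besselSeries hν ((x / 2) ^ 2)).comp x
    (((hasDerivAt_id x).div_const 2).pow 2)).congr_deriv ?_
  simp [besselG]; ring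

theorem continuous_besselG {ν : ℝ} (hν : 0 ≤ ν) : Continuous (besselG ν) :=
  continuous_iff_continuousAt.2 fun x => (hasDerivAt_besselG hν x).continuousAt

theorem besselG_zero_pos {ν : ℝ} (hν : 0 ≤ ν) : 0 < besselG ν 0 :=
  besselSeries_pos_of_nonpos hν (by simp)

theorem besselG_recurrence {ν : ℝ} (hν : 0 ≤ ν) (x : ℝ) :
    x ^ 2 / 4 * besselG (ν + 2) x = (ν + 1) * besselG (ν + 1) x - besselG ν x := by
  have := besselSeries_recurrence hν ((x / 2) ^ 2)
  simp only [RCLike.ofReal_real_eq_id, id] at this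
  rw [besselG, besselG, besselG, ← this]; ring

theorem besselG_add_one_ne_zero {ν x : ℝ} (hν : 0 ≤ ν) (hx : 0 < x) (h : besselG ν x = 0) :
    besselG (ν + 1) x ≠ 0 := besselSeries_add_one_ne_zero hν (by positivity) h

theorem besselJ_eq_zero_iff_besselG {ν x : ℝ} (hx : 0 < x) :
    besselJ ν (x : ℂ) = 0 ↔ besselG ν x = 0 := besselJ_ofReal_eq_zero_iff ν hx

theorem regularSol_one (ν x : ℝ) : regularSol ν 1 x = ((x ^ ν * besselG ν x : ℝ) : ℂ) := by
  rw [regularSol, one_mul, besselSeries_ofReal, besselG, Complex.ofReal_mul]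

end WedgeDislocation

namespace WedgeDislocation

open MeasureTheory

/-! ### Laplace integrals and the Hankel weight. -/

section Laplace

/-- The Laplace transform `∫₀^∞ e^{-xy} q(y) dy`. -/
noncomputable def laplaceInt (q : ℝ → ℂ) (x : ℝ) : ℂ :=
  ∫ y in Ioi (0 : ℝ), ((rexp (-(x * y)) : ℝ) : ℂ) * q y

/-- The Laplace integral of `q` converges absolutely for every positive argument. -/
def LaplaceIntegrable (q : ℝ → ℂ) : Prop :=
  ∀ x : ℝ, 0 < x → IntegrableOn (fun y => ((rexp (-(x * y)) : ℝ) : ℂ) * q y) (Ioi 0)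

/-- Half of the exponential absorbs the new factor, since y ≤ (2/x) e^{xy/2}. -/
theorem LaplaceIntegrable.neg_mul {q : ℝ → ℂ} (hq : LaplaceIntegrable q) :
    LaplaceIntegrable fun y => -(y : ℂ) * q y := by
  intro x hx
  have h := (hq (x / 2) (half_pos hx)).bdd_mul (c := 2 / x)
    (f := fun y : ℝ => ((rexp (-(x / 2 * y)) : ℝ) : ℂ) * -(y : ℂ))
    (by fun_prop) ?_
  · refine h.congr (Eventually.of_forall fun y => ?_)
    have : rexp (-(x * y)) = rexp (-(x / 2 * y)) * rexp (-(x / 2 * y)) := by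
      rw [← Real.exp_add]; ring_nf
    simp only [this]
    push_cast
    ring
  · refine (ae_restrict_iff' measurableSet_Ioi).2 (Eventually.of_forall fun y hy => ?_)
    have hy : 0 < y := hy
    rw [norm_mul, norm_neg, Complex.norm_real, Complex.norm_real, Real.norm_of_nonneg hy.le,
      Real.norm_of_nonneg (Real.exp_pos _).le, Real.exp_neg, inv_mul_le_iff₀ (Real.exp_pos _)]
    have h1 := Real.add_one_le_exp (x / 2 * y)
    have h2 : y = x / 2 * y * (2 / x) := by field_simp
    calc y = x / 2 * y * (2 / x) := h2
      _ ≤ rexp (x / 2 * y) * (2 / x) := by gcongr; linarith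

theorem LaplaceIntegrable.hasDerivAt {q : ℝ → ℂ} (hq : LaplaceIntegrable q) {x : ℝ} (hx : 0 < x) :
    HasDerivAt (laplaceInt q) (laplaceInt (fun y => -(y : ℂ) * q y) x) x := by
  have hq' := hq.neg_mul
  refine (hasDerivAt_integral_of_dominated_loc_of_deriv_le (μ := volume.restrict (Ioi 0))
    (F := fun (x : ℝ) (y : ℝ) => ((rexp (-(x * y)) : ℝ) : ℂ) * q y)
    (F' := fun (x : ℝ) (y : ℝ) => ((rexp (-(x * y)) : ℝ) : ℂ) * (-(y : ℂ) * q y))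
    (s := Ioi (x / 2)) (Ioi_mem_nhds (half_lt_self hx)) ?_ (hq x hx) (hq' x hx).aestronglyMeasurable
    (bound := fun y => ‖((rexp (-(x / 2 * y)) : ℝ) : ℂ) * (-(y : ℂ) * q y)‖) ?_
    (hq' (x / 2) (half_pos hx)).norm ?_).2
  · filter_upwards [Ioi_mem_nhds hx] with z hz using (hq z hz).aestronglyMeasurable
  · refine (ae_restrict_iff' measurableSet_Ioi).2 (Eventually.of_forall fun y hy z hz => ?_)
    have hy : 0 < y := hy
    have hz : x / 2 < z := hz
    rw [norm_mul, norm_mul _ (-(y : ℂ) * q y), Complex.norm_real, Complex.norm_real,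
      Real.norm_of_nonneg (Real.exp_pos _).le, Real.norm_of_nonneg (Real.exp_pos _).le]
    gcongr
  · refine Eventually.of_forall fun y z _ => ?_
    have h1 : HasDerivAt (fun z : ℝ => rexp (-(z * y))) (rexp (-(z * y)) * (-y)) z := by
      simpa using (((hasDerivAt_id z).mul_const y).neg).exp
    refine (h1.ofReal_comp.mul_const (q y)).congr_deriv ?_
    push_cast; ring

theorem laplaceInt_eq_comp_div (q : ℝ → ℂ) {x : ℝ} (hx : 0 < x) :
    laplaceInt q x = ((x⁻¹ : ℝ) : ℂ) * ∫ s in Ioi (0 : ℝ), ((rexp (-s) : ℝ) : ℂ) * q (s / x) := by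
  have := integral_comp_mul_left_Ioi (fun s : ℝ => ((rexp (-s) : ℝ) : ℂ) * q (s / x)) 0 hx
  rw [mul_zero, Complex.real_smul] at this
  rw [← this, laplaceInt]
  simp only [mul_div_cancel_left₀ _ hx.ne']

end Laplace

/-- A positive real factor does not change the argument, so the principal branch is respected. -/
theorem ofReal_mul_cpow {r : ℝ} (hr : 0 < r) {z : ℂ} (hz : z ≠ 0) (s : ℝ) :
    ((r : ℂ) * z) ^ (s : ℂ) = ((r ^ s : ℝ) : ℂ) * z ^ (s : ℂ) := by
  have hrc : (r : ℂ) ≠ 0 := by exact_mod_cast hr.ne'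
  rw [Complex.ofReal_cpow hr.le, Complex.cpow_def_of_ne_zero (mul_ne_zero hrc hz),
    Complex.cpow_def_of_ne_zero hrc, Complex.cpow_def_of_ne_zero hz, Complex.log_ofReal_mul hr hz,
    ← Complex.exp_add, Complex.ofReal_log hr.le, add_mul]

/-- The weight `(y² - 2iy)^μ` of the integral representation of the Hankel functions. -/
noncomputable def hankelWeight (μ y : ℝ) : ℂ := ((y : ℂ) ^ 2 - 2 * Complex.I * y) ^ (μ : ℂ)

/-- The real part is y² > 0. The value t = 2 is the Hankel weight, and t = 0 is its limiting form at
the origin. -/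
theorem sq_sub_mem_slitPlane {y : ℝ} (hy : 0 < y) (t : ℝ) :
    (y : ℂ) ^ 2 - t * Complex.I * y ∈ Complex.slitPlane := by
  refine Or.inl ?_
  simp [pow_two]
  positivity

theorem norm_hankelWeight_aux {μ s t : ℝ} (hμ : 0 ≤ μ) (hs : 0 ≤ s) {z : ℂ}
    (hz : ‖z‖ ≤ s * (s + t)) (ht : 0 ≤ t) : ‖z ^ (μ : ℂ)‖ ≤ (s + t) ^ (2 * μ) := by
  rw [Complex.norm_cpow_real, Real.rpow_mul (by positivity), Real.rpow_two]
  refine Real.rpow_le_rpow (norm_nonneg _) (hz.trans ?_) hμ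
  nlinarith

theorem norm_hankelWeight_le {μ y : ℝ} (hμ : 0 ≤ μ) (hy : 0 ≤ y) :
    ‖hankelWeight μ y‖ ≤ (y + 2) ^ (2 * μ) := by
  refine norm_hankelWeight_aux hμ hy ?_ zero_le_two
  calc ‖(y : ℂ) ^ 2 - 2 * Complex.I * y‖ ≤ ‖(y : ℂ) ^ 2‖ + ‖2 * Complex.I * (y : ℂ)‖ := norm_sub_le _ _
    _ = y * (y + 2) := by simp [abs_of_nonneg hy]; ring

theorem integrableOn_rpow_mul_exp_neg (s : ℝ) {b : ℝ} (hb : 0 < b) :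
    IntegrableOn (fun y : ℝ => (y + 2) ^ s * rexp (-(b * y))) (Ioi 0) := by
  refine integrable_of_isBigO_exp_neg (b := b / 2) (half_pos hb) ?_ ?_
  · refine ContinuousOn.mul (ContinuousOn.rpow_const (by fun_prop) fun y hy => Or.inl ?_)
      (by fun_prop)
    have : 0 ≤ y := hy
    positivity
  · have h := ((tendsto_rpow_mul_exp_neg_mul_atTop_nhds_zero s (b / 2) (half_pos hb)).comp
      (tendsto_atTop_add_const_right _ (2 : ℝ) tendsto_id)).mul_const (rexp b)
    have h1 := h.isBigO_one ℝ
    have h2 := h1.mul (Asymptotics.isBigO_refl (fun y : ℝ => rexp (-(b / 2) * y)) atTop)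
    refine (h2.congr_left fun y => ?_).congr_right fun y => one_mul _
    simp only [Function.comp_apply, id]
    rw [mul_assoc, mul_assoc, ← Real.exp_add, ← Real.exp_add]
    congr 2; ring

theorem continuousOn_hankelWeight (μ : ℝ) : ContinuousOn (hankelWeight μ) (Ioi 0) := by
  intro y hy
  refine ContinuousAt.continuousWithinAt (ContinuousAt.cpow (by fun_prop) continuousAt_const ?_)
  simpa using sq_sub_mem_slitPlane hy 2

theorem laplaceIntegrable_hankelWeight {μ : ℝ} (hμ : 0 ≤ μ) :
    LaplaceIntegrable (hankelWeight μ) := by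
  intro x hx
  refine (integrableOn_rpow_mul_exp_neg (2 * μ) hx).mono' ?_ ?_
  · exact (ContinuousOn.mul (by fun_prop)
      (continuousOn_hankelWeight μ)).aestronglyMeasurable measurableSet_Ioi
  · refine (ae_restrict_iff' measurableSet_Ioi).2 (Eventually.of_forall fun y hy => ?_)
    rw [norm_mul, Complex.norm_real, Real.norm_of_nonneg (Real.exp_pos _).le, mul_comm]
    exact mul_le_mul_of_nonneg_right (norm_hankelWeight_le hμ (le_of_lt hy)) (Real.exp_pos _).le

theorem tendsto_rpow_mul_exp_neg_atTop (s : ℝ) {b : ℝ} (hb : 0 < b) :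
    Tendsto (fun y : ℝ => (y + 2) ^ s * rexp (-(b * y))) atTop (𝓝 0) := by
  have h := ((tendsto_rpow_mul_exp_neg_mul_atTop_nhds_zero s b hb).comp
    (tendsto_atTop_add_const_right _ (2 : ℝ) tendsto_id)).mul_const (rexp (2 * b))
  rw [zero_mul] at h
  refine h.congr fun y => ?_
  simp only [Function.comp_apply, id]
  rw [mul_assoc, ← Real.exp_add]
  congr 2; ring

/-- The second order equation for the Laplace transform of the weight. -/
theorem laplaceInt_hankelWeight_ode {μ : ℝ} (hμ : 0 ≤ μ) {x : ℝ} (hx : 0 < x) :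
    x * laplaceInt (fun y => -(y : ℂ) * (-(y : ℂ) * hankelWeight μ y)) x +
      (2 * Complex.I * x + 2 * (μ + 1)) * laplaceInt (fun y => -(y : ℂ) * hankelWeight μ y) x +
      Complex.I * (2 * (μ + 1)) * laplaceInt (hankelWeight μ) x = 0 := by
  have hq := laplaceIntegrable_hankelWeight hμ
  have h0 := hq x hx
  have h1 := hq.neg_mul x hx
  have h2 := hq.neg_mul.neg_mul x hx
  have hint := ((h2.const_mul (x : ℂ)).add (h1.const_mul (2 * Complex.I * x + 2 * (μ + 1)))).add
    (h0.const_mul (Complex.I * (2 * (μ + 1))))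
  simp only [laplaceInt]
  rw [← integral_const_mul, ← integral_const_mul, ← integral_const_mul]
  refine ((integral_add' ((h2.const_mul _).add (h1.const_mul _)) (h0.const_mul _)).trans
    (congrArg (· + _) (integral_add' (h2.const_mul _) (h1.const_mul _)))).symm.trans ?_
  have hμ1 : 0 ≤ μ + 1 := by positivity
  have hw0 : hankelWeight (μ + 1) 0 = 0 := by
    have : (μ : ℂ) + 1 ≠ 0 := by exact_mod_cast (by positivity : μ + 1 ≠ 0)
    simp [hankelWeight, Complex.zero_cpow this]
  -- The combined integrand is the y-derivative of -e^{-xy} (y² - 2iy)^(μ+1), which vanishes at both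
  -- ends.
  have key := integral_Ioi_of_hasDerivAt_of_tendsto (a := 0) (m := 0)
    (f := fun y => -(((rexp (-(x * y)) : ℝ) : ℂ) * hankelWeight (μ + 1) y)) ?_ ?_ hint ?_
  · rw [hw0] at key
    simpa using key
  · refine (ContinuousWithinAt.mul (by fun_prop) ?_).neg
    rw [ContinuousWithinAt, hw0]
    have hn : Continuous fun y : ℝ => ‖(y : ℂ) ^ 2 - 2 * Complex.I * y‖ ^ (μ + 1) :=
      (Real.continuous_rpow_const hμ1).comp (by fun_prop)
    have ht := hn.tendsto 0
    simp only [Complex.ofReal_zero, mul_zero, ne_eq, OfNat.ofNat_ne_zero, not_false_eq_true,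
      zero_pow, sub_zero, norm_zero, Real.zero_rpow (by positivity : μ + 1 ≠ 0)] at ht
    rw [tendsto_zero_iff_norm_tendsto_zero]
    refine (ht.mono_left nhdsWithin_le_nhds).congr fun y => ?_
    rw [hankelWeight, Complex.norm_cpow_real]
  · intro y hy
    have hy : 0 < y := hy
    have hs := sq_sub_mem_slitPlane hy 2
    simp only [Complex.ofReal_ofNat] at hs
    have hp : HasDerivAt (fun y : ℝ => (y : ℂ) ^ 2 - 2 * Complex.I * y) (2 * y - 2 * Complex.I) y := by
      have h := (Complex.ofRealCLM.hasDerivAt (x := y))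
      refine ((h.pow 2).sub (h.const_mul (2 * Complex.I))).congr_deriv ?_
      simp
    have hw : HasDerivAt (hankelWeight (μ + 1))
        ((μ + 1) * hankelWeight μ y * (2 * y - 2 * Complex.I)) y := by
      refine (((hasDerivAt_id _).cpow_const (c := ((μ + 1 : ℝ) : ℂ)) hs).comp y hp).congr_deriv ?_
      rw [hankelWeight]
      push_cast
      rw [add_sub_cancel_right, mul_one, id]
    have he : HasDerivAt (fun y : ℝ => ((rexp (-(x * y)) : ℝ) : ℂ))
        ((rexp (-(x * y)) * -x : ℝ) : ℂ) y := by
      have : HasDerivAt (fun y : ℝ => rexp (-(x * y))) (rexp (-(x * y)) * -x) y := by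
        simpa using (((hasDerivAt_id y).const_mul x).neg).exp
      exact this.ofReal_comp
    refine ((he.mul hw).neg).congr_deriv ?_
    have hw1 : hankelWeight (μ + 1) y = ((y : ℂ) ^ 2 - 2 * Complex.I * y) * hankelWeight μ y := by
      rw [hankelWeight, hankelWeight, Complex.ofReal_add, Complex.ofReal_one,
        Complex.cpow_add _ _ (Complex.slitPlane_ne_zero hs), Complex.cpow_one, mul_comm]
    rw [hw1]
    simp only [Pi.add_apply]
    push_cast
    ring
  · rw [← neg_zero]
    refine Tendsto.neg (squeeze_zero_norm' ?_ (tendsto_rpow_mul_exp_neg_atTop (2 * (μ + 1)) hx))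
    filter_upwards [eventually_ge_atTop 0] with y hy
    rw [norm_mul, Complex.norm_real, Real.norm_of_nonneg (Real.exp_pos _).le, mul_comm]
    exact mul_le_mul_of_nonneg_right (norm_hankelWeight_le hμ1 hy) (Real.exp_pos _).le

end WedgeDislocation

/-! ### The Hankel-type solution and the asymptotics of J_ν at infinity. -/

namespace WedgeDislocation

open MeasureTheory

/-- The coefficient is real, so taking imaginary parts commutes with the equation. -/
theorem IsSol.im {r : ℝ → ℝ} {a : ℝ} {f g : ℝ → ℂ} (h : IsSol (fun x => (r x : ℂ)) a f g) :
    IsSol (fun x => (r x : ℂ)) a (fun x => ((f x).im : ℂ)) (fun x => ((g x).im : ℂ)) := by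
  intro x hx
  have h1 := (Complex.imCLM.hasFDerivAt.comp_hasDerivAt x (h x hx).1).ofReal_comp
  have h2 := (Complex.imCLM.hasFDerivAt.comp_hasDerivAt x (h x hx).2).ofReal_comp
  refine ⟨h1.congr_deriv ?_, h2.congr_deriv ?_⟩
  · rw [Complex.imCLM_apply, Complex.div_ofReal_im, Complex.ofReal_div]
  · rw [Complex.imCLM_apply, Complex.div_ofReal_im, Complex.im_ofReal_mul]
    push_cast; rfl

/-- The solution `x^ν e^{ix} ∫₀^∞ e^{-xy} (y² - 2iy)^(ν-1/2) dy` of the Bessel equation, a multiple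
of a Hankel function. -/
noncomputable def hankelSol (ν x : ℝ) : ℂ :=
  ((x ^ ν : ℝ) : ℂ) * Complex.exp (Complex.I * x) * laplaceInt (hankelWeight (ν - 1 / 2)) x

/-- With μ = ν - 1/2, inserting x^ν e^{ix} N(x) into the Bessel equation leaves exactly the equation
of `laplaceInt_hankelWeight_ode` for N. The condition ν ≥ 1/2 makes μ nonnegative. -/
theorem exists_isSol_hankelSol {ν : ℝ} (hν : 1 / 2 ≤ ν) (a : ℝ) :
    ∃ g, IsSol (besselCoeff ν 1) a (hankelSol ν) g := by
  set μ := ν - 1 / 2 with hμ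
  have hμ0 : 0 ≤ μ := by linarith
  have hq := laplaceIntegrable_hankelWeight hμ0
  set N := laplaceInt (hankelWeight μ)
  set N₁ := laplaceInt (fun y => -(y : ℂ) * hankelWeight μ y)
  set N₂ := laplaceInt (fun y => -(y : ℂ) * (-(y : ℂ) * hankelWeight μ y))
  refine ⟨fun x => ((x ^ ν : ℝ) : ℂ) * Complex.exp (Complex.I * x) *
    ((ν + Complex.I * x) * N x + x * N₁ x), fun x hx => ?_⟩
  have hx0 := hx.1
  have hxc : (x : ℂ) ≠ 0 := by exact_mod_cast hx0.ne'
  have hinv : (x : ℂ) * (x : ℂ)⁻¹ = 1 := mul_inv_cancel₀ hxc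
  have hid : HasDerivAt (fun x : ℝ => (x : ℂ)) 1 x := Complex.ofRealCLM.hasDerivAt
  have hp : HasDerivAt (fun x : ℝ => ((x ^ ν : ℝ) : ℂ)) (ν * ((x ^ ν : ℝ) : ℂ) / x) x := by
    refine (Real.hasDerivAt_rpow_const (p := ν) (Or.inl hx0.ne')).ofReal_comp.congr_deriv ?_
    rw [Real.rpow_sub_one hx0.ne']
    push_cast; ring
  have he : HasDerivAt (fun x : ℝ => Complex.exp (Complex.I * x))
      (Complex.exp (Complex.I * x) * Complex.I) x := by
    simpa using (hid.const_mul Complex.I).cexp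
  have hN : HasDerivAt N (N₁ x) x := hq.hasDerivAt hx0
  have hN₁ : HasDerivAt N₁ (N₂ x) x := hq.neg_mul.hasDerivAt hx0
  have hode := laplaceInt_hankelWeight_ode hμ0 hx0
  change x * N₂ x + (2 * Complex.I * x + 2 * (μ + 1)) * N₁ x + Complex.I * (2 * (μ + 1)) * N x = 0
    at hode
  have hμν : (2 : ℂ) * (μ + 1) = 2 * ν + 1 := by rw [hμ]; push_cast; ring
  rw [hμν] at hode
  have hpe := hp.mul he
  refine ⟨(hpe.mul hN).congr_deriv ?_, (hpe.mul (((hid.const_mul Complex.I).const_add (ν : ℂ)).mul hN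
    |>.add (hid.mul hN₁))).congr_deriv ?_⟩
  · rw [eq_div_iff hxc]
    simp only [Pi.mul_apply]
    linear_combination (ν * ((x ^ ν : ℝ) : ℂ) * Complex.exp (Complex.I * x) * N x) * hinv
  · rw [eq_div_iff hxc, hankelSol, besselCoeff]
    simp only [Pi.mul_apply, Pi.add_apply]
    change _ = _ * (_ * N x)
    set P := ((x ^ ν : ℝ) : ℂ)
    set E := Complex.exp (Complex.I * x)
    linear_combination (P * E * x) * hode +
      (ν * P * E * ((ν + Complex.I * x) * N x + x * N₁ x)) * hinv +
      (P * E * N x * x ^ 2) * Complex.I_sq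

theorem rpow_mul_hankelWeight_div {μ r s x : ℝ} (hr : 0 < r) (hs : 0 < s) (hx : 0 < x) :
    ((r ^ μ : ℝ) : ℂ) * hankelWeight μ (s / x) =
      ((r * (s / x) ^ 2 : ℝ) - (2 * r / x : ℝ) * Complex.I * (s : ℂ)) ^ (μ : ℂ) := by
  have := Complex.slitPlane_ne_zero (sq_sub_mem_slitPlane (div_pos hs hx) 2)
  rw [Complex.ofReal_ofNat] at this
  rw [hankelWeight, ← ofReal_mul_cpow hr this]
  congr 1
  push_cast; ring

/-- Convergence of the rescaled Laplace integrals of the weight. -/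
theorem tendsto_integral_weight {μ : ℝ} (hμ : 0 ≤ μ) {l : Filter ℝ} [l.IsCountablyGenerated]
    {c d : ℝ → ℝ} {c₀ d₀ : ℝ} (hc : Tendsto c l (𝓝 c₀)) (hd : Tendsto d l (𝓝 d₀))
    (hc1 : ∀ᶠ x in l, 0 ≤ c x ∧ c x ≤ 1) (hd1 : ∀ᶠ x in l, 0 ≤ d x ∧ d x ≤ 2)
    (hcpos : ∀ᶠ x in l, 0 < c x)
    (h0 : ∀ s : ℝ, 0 < s → (c₀ : ℂ) * (s : ℂ) ^ 2 - d₀ * Complex.I * s ∈ Complex.slitPlane) :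
    Tendsto (fun x => ∫ s in Ioi (0 : ℝ), ((rexp (-s) : ℝ) : ℂ) *
        ((c x : ℂ) * (s : ℂ) ^ 2 - d x * Complex.I * s) ^ (μ : ℂ)) l
      (𝓝 (∫ s in Ioi (0 : ℝ), ((rexp (-s) : ℝ) : ℂ) *
        ((c₀ : ℂ) * (s : ℂ) ^ 2 - d₀ * Complex.I * s) ^ (μ : ℂ))) := by
  -- The bounds c ≤ 1 and d ≤ 2 give the common majorant (s+2)^(2μ) e^{-s}. The same lemma serves
  -- the origin (c = 1, d = 2x) and infinity (c = 1/x, d = 2).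
  have hb := integrableOn_rpow_mul_exp_neg (2 * μ) one_pos
  simp only [one_mul] at hb
  refine tendsto_integral_filter_of_dominated_convergence _ ?_ ?_ hb ?_
  · filter_upwards [hcpos] with x hx
    refine ContinuousOn.aestronglyMeasurable ?_ measurableSet_Ioi
    refine ContinuousOn.mul (by fun_prop) fun s hs => ContinuousAt.continuousWithinAt
      (ContinuousAt.cpow (by fun_prop) continuousAt_const (Or.inl ?_))
    have hs : 0 < s := hs
    simp [pow_two]
    positivity
  · filter_upwards [hc1, hd1] with x hx hx'
    refine (ae_restrict_iff' measurableSet_Ioi).2 (Eventually.of_forall fun s hs => ?_)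
    have hs : 0 < s := hs
    rw [norm_mul, Complex.norm_real, Real.norm_of_nonneg (Real.exp_pos _).le, mul_comm]
    refine mul_le_mul_of_nonneg_right (norm_hankelWeight_aux hμ hs.le ?_ zero_le_two)
      (Real.exp_pos _).le
    calc ‖(c x : ℂ) * (s : ℂ) ^ 2 - d x * Complex.I * s‖
        ≤ ‖(c x : ℂ) * (s : ℂ) ^ 2‖ + ‖d x * Complex.I * (s : ℂ)‖ := norm_sub_le _ _
      _ = c x * s ^ 2 + d x * s := by
        simp [abs_of_nonneg hs.le, abs_of_nonneg hx.1, abs_of_nonneg hx'.1]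
      _ ≤ 1 * s ^ 2 + 2 * s := by
        have := hx.2
        have := hx'.2
        gcongr
      _ = s * (s + 2) := by ring
  · refine (ae_restrict_iff' measurableSet_Ioi).2 (Eventually.of_forall fun s hs => ?_)
    refine Tendsto.const_mul _ (Tendsto.cpow ?_ tendsto_const_nhds (h0 s hs))
    exact (((Complex.continuous_ofReal.tendsto _).comp hc).mul_const _).sub
      ((((Complex.continuous_ofReal.tendsto _).comp hd).mul_const _).mul_const _)

/-- After s = xy, x^ν times the solution is e^{ix} ∫ e^{-s} (s² - 2ixs)^μ ds, whose limit ∫ e^{-s}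
s^(2μ) ds is real. So the singular part of the solution, of size x^(-ν), does not enter the
imaginary part. -/
theorem tendsto_rpow_mul_im_hankelSol {ν : ℝ} (hν : 1 / 2 ≤ ν) :
    Tendsto (fun x : ℝ => ((x ^ ν : ℝ) : ℂ) * ((hankelSol ν x).im : ℂ)) (𝓝[>] 0) (𝓝 0) := by
  set μ := ν - 1 / 2 with hμ
  have hμ0 : 0 ≤ μ := by linarith
  have hid : Tendsto (fun x : ℝ => x) (𝓝[>] 0) (𝓝 0) := tendsto_nhdsWithin_of_tendsto_nhds tendsto_id
  have h1 := tendsto_integral_weight hμ0 (l := 𝓝[>] (0 : ℝ)) (c := fun _ => 1) (d := fun x => 2 * x)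
    tendsto_const_nhds (by simpa using hid.const_mul 2) (by simp)
    (by
      filter_upwards [Ioo_mem_nhdsGT one_pos] with x hx
      exact ⟨by linarith [hx.1], by linarith [hx.2]⟩) (by simp)
    (d₀ := 0) (c₀ := 1) (fun s hs => by simpa using sq_sub_mem_slitPlane hs 0)
  have h2 : Tendsto (fun x : ℝ => Complex.exp (Complex.I * x)) (𝓝[>] 0) (𝓝 1) := by
    have : Continuous (fun x : ℝ => Complex.exp (Complex.I * x)) := by fun_prop
    simpa using (this.tendsto 0).mono_left nhdsWithin_le_nhds
  have h3 := (Complex.continuous_im.tendsto _).comp (h2.mul h1)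
  have h0 : ((1 : ℂ) * ∫ s in Ioi (0 : ℝ), ((rexp (-s) : ℝ) : ℂ) *
      (((1 : ℝ) : ℂ) * (s : ℂ) ^ 2 - ((0 : ℝ) : ℂ) * Complex.I * s) ^ (μ : ℂ)).im = 0 := by
    have : ∀ s : ℝ, ((rexp (-s) : ℝ) : ℂ) *
        (((1 : ℝ) : ℂ) * (s : ℂ) ^ 2 - ((0 : ℝ) : ℂ) * Complex.I * s) ^ (μ : ℂ) =
        ((rexp (-s) * (s ^ 2) ^ μ : ℝ) : ℂ) := fun s => by
      rw [Complex.ofReal_mul, Complex.ofReal_cpow (sq_nonneg s)]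
      simp
    simp only [this]
    rw [integral_complex_ofReal, one_mul, Complex.ofReal_im]
  rw [h0] at h3
  rw [← Complex.ofReal_zero]
  refine ((Complex.continuous_ofReal.tendsto _).comp h3).congr' ?_
  filter_upwards [self_mem_nhdsWithin] with x hx
  have hx : 0 < x := hx
  simp only [Function.comp_apply]
  rw [hankelSol, ← Complex.ofReal_mul, ← Complex.im_ofReal_mul, laplaceInt_eq_comp_div _ hx]
  congr 2
  have e : ∀ s ∈ Ioi (0 : ℝ), ((rexp (-s) : ℝ) : ℂ) *
      (((1 : ℝ) : ℂ) * (s : ℂ) ^ 2 - ((2 * x : ℝ) : ℂ) * Complex.I * s) ^ (μ : ℂ) =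
      (((x ^ 2) ^ μ : ℝ) : ℂ) * (((rexp (-s) : ℝ) : ℂ) * hankelWeight μ (s / x)) := fun s hs => by
    rw [mul_left_comm, rpow_mul_hankelWeight_div (pow_pos hx 2) hs hx]
    congr 2
    have hxc : (x : ℂ) ≠ 0 := by exact_mod_cast hx.ne'
    push_cast
    field_simp
  rw [setIntegral_congr_fun measurableSet_Ioi e, integral_const_mul]
  have e2 : (x ^ 2) ^ μ = x ^ ν * x ^ ν * x⁻¹ := by
    rw [← Real.rpow_natCast, ← Real.rpow_mul hx.le, ← Real.rpow_neg_one, ← Real.rpow_add hx,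
      ← Real.rpow_add hx, hμ]
    congr 1; push_cast; ring
  rw [e2]
  push_cast
  ring

/-- The imaginary part is o(x^(-ν)) at 0, hence a multiple of the regular solution on every (0, a).
Evaluation at a fixed x₀ < 1 shows that the constant does not depend on a. -/
theorem exists_im_hankelSol_eq {ν : ℝ} (hν : 1 / 2 ≤ ν) :
    ∃ c : ℝ, ∀ x, 0 < x → (hankelSol ν x).im = c * (x ^ ν * besselG ν x) := by
  have hν0 : 0 < ν := by linarith
  have key : ∀ a : ℝ, 0 < a → ∃ c : ℂ, ∀ x ∈ Ioo 0 a,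
      ((hankelSol ν x).im : ℂ) = c * ((x ^ ν * besselG ν x : ℝ) : ℂ) := fun a ha => by
    obtain ⟨g, hg⟩ := exists_isSol_hankelSol hν a
    have hq : besselCoeff ν 1 = fun x => ((ν ^ 2 - x ^ 2 : ℝ) : ℂ) := by
      ext x; simp [besselCoeff]
    have hs := (hq ▸ hg).im
    rw [← hq] at hs
    obtain ⟨c, hc⟩ := hs.eq_const_mul_regularSol hν0.le ha
      (Or.inr ⟨hν0, tendsto_rpow_mul_im_hankelSol hν⟩)
    exact ⟨c, fun x hx => by rw [hc x hx, regularSol_one]⟩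
  obtain ⟨x₀, hx₀, hne⟩ := exists_regularSol_ne_zero hν0.le 1 one_pos
  rw [regularSol_one] at hne
  have hne' : x₀ ^ ν * besselG ν x₀ ≠ 0 := by exact_mod_cast hne
  refine ⟨(hankelSol ν x₀).im / (x₀ ^ ν * besselG ν x₀), fun x hx => ?_⟩
  obtain ⟨c, hc⟩ := key (x + 1) (by positivity)
  obtain ⟨d, hd⟩ := key (max (x + 1) 1) (by positivity)
  have h1 := hd x ⟨hx, lt_max_of_lt_left (by linarith)⟩
  have h2 := hd x₀ ⟨hx₀.1, lt_max_of_lt_right hx₀.2⟩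
  have h3 : d = (((hankelSol ν x₀).im / (x₀ ^ ν * besselG ν x₀) : ℝ) : ℂ) := by
    rw [Complex.ofReal_div, h2, mul_div_cancel_right₀ _ hne]
  rw [h3] at h1
  exact_mod_cast h1

/-- After s = xy, √x times the solution is e^{ix} ∫ e^{-s} (s²/x - 2is)^μ ds, and (-2is)^μ = (2s)^μ
e^{-iμπ/2} supplies both the phase and the positive constant C. -/
theorem tendsto_rpow_mul_im_hankelSol_atTop {ν : ℝ} (hν : 1 / 2 ≤ ν) :
    ∃ C : ℝ, C ≠ 0 ∧ Tendsto (fun x : ℝ => x ^ (1 / 2 : ℝ) * (hankelSol ν x).im -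
      C * Real.sin (x - (ν - 1 / 2) * (π / 2))) atTop (𝓝 0) := by
  set μ := ν - 1 / 2 with hμ
  have hμ0 : 0 ≤ μ := by linarith
  have h1 := tendsto_integral_weight hμ0 (l := atTop) (c := fun x => x⁻¹) (d := fun _ => 2)
    tendsto_inv_atTop_zero tendsto_const_nhds
    (by
      filter_upwards [eventually_ge_atTop 1] with x hx
      exact ⟨by positivity, inv_le_one_of_one_le₀ hx⟩) (by simp)
    (by filter_upwards [eventually_gt_atTop 0] with x hx using inv_pos.2 hx)
    (fun s hs => Or.inr (by simpa using ne_of_gt hs))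
  set C := ∫ s in Ioi (0 : ℝ), rexp (-s) * (2 * s) ^ μ
  have hC : 0 < C := by
    have hint : IntegrableOn (fun s => rexp (-s) * (2 * s) ^ μ) (Ioi 0) := by
      have h := (Real.GammaIntegral_convergent (s := μ + 1) (by positivity)).const_mul (2 ^ μ)
      refine h.congr ((ae_restrict_iff' measurableSet_Ioi).2 (Eventually.of_forall fun s hs => ?_))
      have hs : 0 < s := hs
      simp only [add_sub_cancel_right]
      rw [Real.mul_rpow zero_le_two hs.le]; ring
    have hpos : ∀ s ∈ Ioi (0 : ℝ), 0 < rexp (-s) * (2 * s) ^ μ := fun s hs => by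
      have hs : 0 < s := hs
      positivity
    rw [setIntegral_pos_iff_support_of_nonneg_ae]
    · rw [show Function.support (fun s => rexp (-s) * (2 * s) ^ μ) ∩ Ioi 0 = Ioi 0 from
        inter_eq_right.2 fun s hs => (hpos s hs).ne']
      simp
    · exact (ae_restrict_iff' measurableSet_Ioi).2 (Eventually.of_forall fun s hs => (hpos s hs).le)
    · exact hint
  have hA : (∫ s in Ioi (0 : ℝ), ((rexp (-s) : ℝ) : ℂ) *
      (((0 : ℝ) : ℂ) * (s : ℂ) ^ 2 - ((2 : ℝ) : ℂ) * Complex.I * s) ^ (μ : ℂ)) =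
      C * Complex.exp (-(Complex.I * (μ * (π / 2) : ℝ))) := by
    have e : ∀ s ∈ Ioi (0 : ℝ), ((rexp (-s) : ℝ) : ℂ) *
        (((0 : ℝ) : ℂ) * (s : ℂ) ^ 2 - ((2 : ℝ) : ℂ) * Complex.I * s) ^ (μ : ℂ) =
        ((rexp (-s) * (2 * s) ^ μ : ℝ) : ℂ) * Complex.exp (-(Complex.I * (μ * (π / 2) : ℝ))) := by
      intro s hs
      have hs : 0 < s := hs
      have e1 : ((0 : ℝ) : ℂ) * (s : ℂ) ^ 2 - ((2 : ℝ) : ℂ) * Complex.I * s =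
          ((2 * s : ℝ) : ℂ) * (-Complex.I) := by push_cast; ring
      rw [e1, ofReal_mul_cpow (by positivity) (by simp), Complex.cpow_def_of_ne_zero
        (x := -Complex.I) (by simp), Complex.log_neg_I, Complex.ofReal_mul (rexp (-s)),
        ← mul_assoc]
      congr 2
      push_cast; ring
    rw [setIntegral_congr_fun measurableSet_Ioi e, integral_mul_const, integral_complex_ofReal]
  rw [hA] at h1
  refine ⟨C, hC.ne', ?_⟩
  have h2 := h1.sub_const (C * Complex.exp (-(Complex.I * (μ * (π / 2) : ℝ))))
  rw [sub_self, tendsto_zero_iff_norm_tendsto_zero] at h2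
  refine squeeze_zero_norm' ?_ h2
  filter_upwards [eventually_gt_atTop 0] with x hx
  have e : ∀ s ∈ Ioi (0 : ℝ), ((rexp (-s) : ℝ) : ℂ) *
      (((x⁻¹ : ℝ) : ℂ) * (s : ℂ) ^ 2 - ((2 : ℝ) : ℂ) * Complex.I * s) ^ (μ : ℂ) =
      ((x ^ μ : ℝ) : ℂ) * (((rexp (-s) : ℝ) : ℂ) * hankelWeight μ (s / x)) := fun s hs => by
    rw [mul_left_comm, rpow_mul_hankelWeight_div hx hs hx]
    congr 2
    have hxc : (x : ℂ) ≠ 0 := by exact_mod_cast hx.ne'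
    push_cast
    field_simp
  rw [setIntegral_congr_fun measurableSet_Ioi e, integral_const_mul]
  have e2 : x ^ μ = x ^ (1 / 2 : ℝ) * x ^ ν * x⁻¹ := by
    rw [← Real.rpow_neg_one, ← Real.rpow_add hx, ← Real.rpow_add hx, hμ]
    congr 1; ring
  have e3 : x ^ (1 / 2 : ℝ) * (hankelSol ν x).im - C * Real.sin (x - μ * (π / 2)) =
      (Complex.exp (Complex.I * x) * (((x ^ μ : ℝ) : ℂ) * (∫ s in Ioi (0 : ℝ), ((rexp (-s) : ℝ) : ℂ) *
        hankelWeight μ (s / x)) - C * Complex.exp (-(Complex.I * (μ * (π / 2) : ℝ))))).im := by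
    rw [mul_sub, Complex.sub_im]
    congr 1
    · rw [← Complex.im_ofReal_mul, hankelSol, laplaceInt_eq_comp_div _ hx, e2]
      congr 1
      push_cast
      ring
    · rw [mul_left_comm, ← Complex.exp_add, Complex.im_ofReal_mul,
        show Complex.I * x + -(Complex.I * (μ * (π / 2) : ℝ)) =
          ((x - μ * (π / 2) : ℝ) : ℂ) * Complex.I by push_cast; ring, Complex.exp_ofReal_mul_I_im]
  rw [e3, Real.norm_eq_abs]
  refine (Complex.abs_im_le_norm _).trans (le_of_eq ?_)
  rw [norm_mul, mul_comm Complex.I, Complex.norm_exp_ofReal_mul_I, one_mul]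

theorem besselG_asymptotic_of_half_le {ν : ℝ} (hν : 1 / 2 ≤ ν) :
    ∃ C : ℝ, C ≠ 0 ∧ Tendsto (fun x : ℝ => x ^ (ν + 1 / 2) * besselG ν x -
      C * Real.sin (x - (ν - 1 / 2) * (π / 2))) atTop (𝓝 0) := by
  obtain ⟨c, hc⟩ := exists_im_hankelSol_eq hν
  obtain ⟨C, hC, h⟩ := tendsto_rpow_mul_im_hankelSol_atTop hν
  -- Otherwise C sin would tend to 0, which fails along the points where the sine equals 1.
  have hc0 : c ≠ 0 := by
    rintro rfl
    have h1 : Tendsto (fun n : ℕ => π / 2 + (ν - 1 / 2) * (π / 2) + n * (2 * π)) atTop atTop :=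
      tendsto_atTop_add_const_left _ _
        (tendsto_natCast_atTop_atTop.atTop_mul_const (by positivity))
    have h2 := h.comp h1
    have h3 : Tendsto (fun _ : ℕ => -C) atTop (𝓝 0) := by
      refine h2.congr fun n => ?_
      have : 0 < π / 2 + (ν - 1 / 2) * (π / 2) + n * (2 * π) := by
        have : 0 ≤ ν - 1 / 2 := by linarith
        have := Real.pi_pos
        positivity
      simp only [Function.comp_apply]
      rw [hc _ this, show π / 2 + (ν - 1 / 2) * (π / 2) + n * (2 * π) - (ν - 1 / 2) * (π / 2) =
        π / 2 + n * (2 * π) by ring, Real.sin_add_nat_mul_two_pi, Real.sin_pi_div_two]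
      ring
    exact hC (by simpa using tendsto_nhds_unique h3 tendsto_const_nhds)
  refine ⟨C / c, div_ne_zero hC hc0, ?_⟩
  have := h.div_const c
  rw [zero_div] at this
  refine this.congr' ?_
  filter_upwards [eventually_gt_atTop 0] with x hx
  rw [hc x hx, Real.rpow_add hx]
  field_simp

/-- The integral representation needs ν ≥ 1/2, so orders below it are reached through the recurrence
from ν + 1 and ν + 2: the former contributes O(1/x), the latter has its phase shifted by π, which
gives the constant C₂/4. -/
theorem besselG_asymptotic {ν : ℝ} (hν : 0 ≤ ν) :
    ∃ C : ℝ, C ≠ 0 ∧ Tendsto (fun x : ℝ => x ^ (ν + 1 / 2) * besselG ν x -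
      C * Real.sin (x - (ν - 1 / 2) * (π / 2))) atTop (𝓝 0) := by
  obtain ⟨C₁, -, h1⟩ := besselG_asymptotic_of_half_le (ν := ν + 1) (by linarith)
  obtain ⟨C₂, hC₂, h2⟩ := besselG_asymptotic_of_half_le (ν := ν + 2) (by linarith)
  refine ⟨C₂ / 4, by positivity, ?_⟩
  have hinv : Tendsto (fun x : ℝ => (ν + 1) * x⁻¹) atTop (𝓝 0) := by
    simpa using tendsto_inv_atTop_zero.const_mul (ν + 1)
  have hbd : Tendsto (fun x : ℝ => (ν + 1) * x⁻¹ *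
      (C₁ * Real.sin (x - (ν + 1 - 1 / 2) * (π / 2)))) atTop (𝓝 0) := by
    refine squeeze_zero_norm (a := fun x => ‖(ν + 1) * x⁻¹‖ * |C₁|) (fun x => ?_)
      (by simpa using hinv.norm.mul_const |C₁|)
    rw [norm_mul, norm_mul C₁, Real.norm_eq_abs C₁]
    gcongr
    exact mul_le_of_le_one_right (abs_nonneg _) (Real.abs_sin_le_one _)
  have h := ((hinv.mul h1).add hbd).sub (h2.mul_const (1 / 4))
  simp only [mul_zero, zero_mul, add_zero, sub_zero] at h
  refine h.congr' ?_
  filter_upwards [eventually_gt_atTop 0] with x hx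
  have e1 : x ^ (ν + 1 + 1 / 2) = x ^ (ν + 1 / 2) * x := by
    rw [← Real.rpow_add_one hx.ne']; ring_nf
  have e2 : x ^ (ν + 2 + 1 / 2) = x ^ (ν + 1 / 2) * x ^ 2 := by
    rw [← Real.rpow_two, ← Real.rpow_add hx]; ring_nf
  have e3 : Real.sin (x - (ν + 2 - 1 / 2) * (π / 2)) = -Real.sin (x - (ν - 1 / 2) * (π / 2)) := by
    rw [← Real.sin_sub_pi]; ring_nf
  have hrec := besselG_recurrence hν x
  have hinv : x⁻¹ * x = 1 := inv_mul_cancel₀ hx.ne'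
  rw [e1, e2, e3]
  linear_combination (-x ^ (ν + 1 / 2)) * hrec +
    (ν + 1) * x ^ (ν + 1 / 2) * besselG (ν + 1) x * hinv

/-- The function x^(-1/2) sin x solves the Bessel equation of order 1/2, and x^(1/2) times it tends
to 0 at the origin, so it is a multiple of the regular solution. -/
theorem exists_sin_eq_mul_besselG_half :
    ∃ c : ℝ, c ≠ 0 ∧ ∀ x, 0 < x → Real.sin x = c * (x * besselG (1 / 2) x) := by
  set P : ℝ → ℝ := fun x => x ^ (-(1 / 2) : ℝ)
  have hs : ∀ a, IsSol (besselCoeff (1 / 2 : ℝ) 1) a (fun x => ((P x * Real.sin x : ℝ) : ℂ))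
      (fun x => ((P x * (x * Real.cos x - Real.sin x / 2) : ℝ) : ℂ)) := by
    intro a x hx
    have hx0 := hx.1
    have hP : HasDerivAt P (-(1 / 2) * P x * x⁻¹) x := by
      refine (Real.hasDerivAt_rpow_const (Or.inl hx0.ne')).congr_deriv ?_
      rw [Real.rpow_sub_one hx0.ne']; ring
    have hinv : (x : ℂ) * (x : ℂ)⁻¹ = 1 := mul_inv_cancel₀ (by exact_mod_cast hx0.ne')
    refine ⟨((hP.mul (Real.hasDerivAt_sin x)).ofReal_comp).congr_deriv ?_,
      ((hP.mul (((hasDerivAt_id x).mul (Real.hasDerivAt_cos x)).sub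
        ((Real.hasDerivAt_sin x).div_const 2))).ofReal_comp).congr_deriv ?_⟩
    · push_cast
      linear_combination (-P x * Complex.cos x : ℂ) * hinv
    · simp only [besselCoeff, Pi.sub_apply, Pi.mul_apply, id]
      push_cast
      linear_combination (P x * Complex.sin x * x - P x * Complex.cos x / 2 : ℂ) * hinv
  have hlim : Tendsto (fun x : ℝ => ((x ^ (1 / 2 : ℝ) : ℝ) : ℂ) * ((P x * Real.sin x : ℝ) : ℂ))
      (𝓝[>] 0) (𝓝 0) := by
    have : Tendsto (fun x : ℝ => ((Real.sin x : ℝ) : ℂ)) (𝓝[>] 0) (𝓝 0) := by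
      have h := (Complex.continuous_ofReal.comp Real.continuous_sin).tendsto 0
      simp only [Function.comp_apply, Real.sin_zero, Complex.ofReal_zero] at h
      exact h.mono_left nhdsWithin_le_nhds
    refine this.congr' ?_
    filter_upwards [self_mem_nhdsWithin] with x hx
    have hx : 0 < x := hx
    rw [← Complex.ofReal_mul, ← mul_assoc, ← Real.rpow_add hx]
    norm_num
  have hπ := Real.pi_gt_three
  have key : ∀ x, 0 < x → Real.sin x * (1 * besselG (1 / 2) 1) =
      Real.sin 1 * (x * besselG (1 / 2) x) := by
    intro x hx
    -- The interval (0, x + 2) contains both x and the reference point 1, so the constant can be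
    -- eliminated.
    obtain ⟨c, hc⟩ := (hs (x + 2)).eq_const_mul_regularSol (by norm_num) (by positivity)
      (Or.inr ⟨by norm_num, hlim⟩)
    have e : ∀ y, 0 < y → y < x + 2 →
        ((Real.sin y : ℝ) : ℂ) = c * ((y * besselG (1 / 2) y : ℝ) : ℂ) := by
      intro y hy hyx
      have h := congrArg (((y ^ (1 / 2 : ℝ) : ℝ) : ℂ) * ·) (hc y ⟨hy, hyx⟩)
      simp only [regularSol_one] at h
      rw [mul_left_comm, ← Complex.ofReal_mul, ← Complex.ofReal_mul, ← mul_assoc, ← mul_assoc,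
        ← Real.rpow_add hy, ← Real.rpow_add hy] at h
      norm_num at h
      simpa using h
    have h1 := e x hx (by linarith)
    have h2 := e 1 one_pos (by linarith)
    have : ((Real.sin x * (1 * besselG (1 / 2) 1) : ℝ) : ℂ) =
        ((Real.sin 1 * (x * besselG (1 / 2) x) : ℝ) : ℂ) := by
      rw [Complex.ofReal_mul, Complex.ofReal_mul (Real.sin 1), h1, h2]; ring
    exact_mod_cast this
  have hsin1 : Real.sin 1 ≠ 0 := (Real.sin_pos_of_pos_of_lt_pi one_pos (by linarith)).ne'
  have hG : besselG (1 / 2) 1 ≠ 0 := by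
    intro h0
    have hall : ∀ x, 0 < x → besselG (1 / 2) x = 0 := fun x hx => by
      have h := key x hx
      rw [h0, one_mul, mul_zero] at h
      simpa [hsin1, hx.ne'] using h.symm
    have h2 : Tendsto (besselG (1 / 2)) (𝓝[>] 0) (𝓝 (besselG (1 / 2) 0)) :=
      ((continuous_besselG (by norm_num)).tendsto 0).mono_left nhdsWithin_le_nhds
    have h3 : Tendsto (besselG (1 / 2)) (𝓝[>] 0) (𝓝 0) :=
      tendsto_const_nhds.congr' (by
        filter_upwards [self_mem_nhdsWithin] with x hx using (hall x hx).symm)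
    exact (besselG_zero_pos (ν := 1 / 2) (by norm_num)).ne' (tendsto_nhds_unique h2 h3)
  refine ⟨Real.sin 1 / besselG (1 / 2) 1, div_ne_zero hsin1 hG, fun x hx => ?_⟩
  have := key x hx
  field_simp
  linarith

end WedgeDislocation

/-! ### Enumeration of the positive zeros and interlacing by Rolle's theorem. -/

namespace WedgeDislocation

/-- `z 0 < z 1 < …` are the positive zeros of `J_ν`. -/
def IsZeroSeq (ν : ℝ) (z : ℕ → ℝ) : Prop :=
  StrictMono z ∧ range z = {x | 0 < x ∧ besselG ν x = 0}

/-- The set is a locally finite linear order with a least and no greatest element, hence order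
isomorphic to ℕ. -/
theorem exists_strictMono_range_eq {Z : Set ℝ} (hfin : ∀ x, (Z ∩ Icc 0 x).Finite)
    (hpos : ∀ x ∈ Z, 0 < x) (hunb : ∀ x, ∃ z ∈ Z, x < z) :
    ∃ z : ℕ → ℝ, StrictMono z ∧ range z = Z := by
  have hIcc : ∀ a b : Z, (Icc a b).Finite := fun a b => by
    refine Finite.of_finite_image ((hfin b).subset ?_) Subtype.val_injective.injOn
    rintro _ ⟨c, hc, rfl⟩
    exact ⟨c.2, (hpos _ c.2).le, hc.2⟩
  let _ : LocallyFiniteOrder Z := LocallyFiniteOrder.ofFiniteIcc hIcc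
  have _ : NoMaxOrder Z := ⟨fun a => by
    obtain ⟨z, hz, haz⟩ := hunb a
    exact ⟨⟨z, hz⟩, haz⟩⟩
  obtain ⟨z₀, hz₀, -⟩ := hunb 0
  obtain ⟨b, hb, hmin⟩ := (hfin z₀).exists_minimal ⟨z₀, hz₀, (hpos _ hz₀).le, le_rfl⟩
  let _ : OrderBot Z :=
    { bot := ⟨b, hb.1⟩
      bot_le := fun a => by
        change b ≤ a.1
        rcases le_total (a : ℝ) z₀ with h | h
        · rcases le_total b a.1 with h' | h'
          · exact h'
          · exact hmin ⟨a.2, (hpos _ a.2).le, h⟩ h'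
        · exact hb.2.2.trans h }
  let _ : SuccOrder Z := LinearLocallyFiniteOrder.succOrder Z
  let _ : PredOrder Z := LinearLocallyFiniteOrder.predOrder Z
  let e := (orderIsoNatOfLinearSuccPredArch (ι := Z)).symm
  refine ⟨fun n => (e n : ℝ), fun m n h => e.strictMono h, ?_⟩
  ext x
  constructor
  · rintro ⟨n, rfl⟩
    exact (e n).2
  · intro hx
    exact ⟨e.symm ⟨x, hx⟩, by simp⟩

/-- An accumulation point of zeros would be a zero, positive because the function is positive at 0;
but positive zeros are simple and therefore isolated. -/
theorem finite_zeros_besselG {ν : ℝ} (hν : 0 ≤ ν) (x : ℝ) :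
    ({x | 0 < x ∧ besselG ν x = 0} ∩ Icc 0 x).Finite := by
  by_contra hinf
  obtain ⟨y, hy, hacc⟩ := Set.Infinite.exists_accPt_of_subset_isCompact hinf isCompact_Icc
    inter_subset_right
  have hfreq := accPt_iff_frequently_nhdsNE.1 hacc
  have hyz : besselG ν y = 0 := by
    by_contra h
    refine hfreq ?_
    filter_upwards [nhdsWithin_le_nhds ((continuous_besselG hν).continuousAt.eventually_ne h)]
      with z hz hz' using hz hz'.1.2
  have hy0 : 0 < y := hy.1.lt_of_ne fun h => (besselG_zero_pos hν).ne' (h ▸ hyz)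
  have hd := (hasDerivAt_besselG hν y).eventually_ne (c := 0)
    (mul_ne_zero (by linarith : -(y / 2) < 0).ne (besselG_add_one_ne_zero hν hy0 hyz))
  exact hfreq (by filter_upwards [hd] with z hz hz' using hz hz'.1.2)

/-- Far out the error is smaller than |C|, so the sign is that of C sin, which flips between a
maximum a of the sine and a + π. -/
theorem exists_zero_besselG_gt {ν : ℝ} (hν : 0 ≤ ν) (x : ℝ) :
    ∃ z ∈ {x | 0 < x ∧ besselG ν x = 0}, x < z := by
  obtain ⟨C, hC, h⟩ := besselG_asymptotic hν
  set μ := (ν - 1 / 2) * (π / 2)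
  have hev := (h.abs.eventually_lt_const (u := |C|) (by simpa using hC)).and
    (eventually_gt_atTop (max x 0))
  rw [eventually_atTop] at hev
  obtain ⟨X, hX⟩ := hev
  obtain ⟨n, hn⟩ := exists_nat_gt (X - μ)
  have hn0 : (0 : ℝ) ≤ n := n.cast_nonneg
  have hπ := Real.pi_gt_three
  have hge : X ≤ π / 2 + n * (2 * π) + μ := by nlinarith
  have h1 := hX _ hge
  have h2 := hX (π / 2 + n * (2 * π) + μ + π) (by linarith)
  set a := π / 2 + n * (2 * π) + μ
  have hs1 : Real.sin (a - μ) = 1 := by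
    rw [show a - μ = π / 2 + n * (2 * π) by ring, Real.sin_add_nat_mul_two_pi, Real.sin_pi_div_two]
  have hs2 : Real.sin (a + π - μ) = -1 := by
    rw [show a + π - μ = a - μ + π by ring, Real.sin_add_pi, hs1]
  rw [hs1] at h1
  rw [hs2] at h2
  have ha0 : 0 < a := (le_max_right x 0).trans_lt h1.2
  have hxa : x < a := (le_max_left x 0).trans_lt h1.2
  have p1 : 0 < a ^ (ν + 1 / 2) := Real.rpow_pos_of_pos ha0 _
  have p2 : 0 < (a + π) ^ (ν + 1 / 2) := Real.rpow_pos_of_pos (by linarith) _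
  have hab : a ≤ a + π := by linarith
  have hcont := (continuous_besselG hν).continuousOn (s := Icc a (a + π))
  have hmem : (0 : ℝ) ∈ uIcc (besselG ν a) (besselG ν (a + π)) := by
    rw [mem_uIcc]
    have q1 := abs_lt.1 h1.1
    have q2 := abs_lt.1 h2.1
    rcases lt_or_gt_of_ne hC with hneg | hpos
    · rw [abs_of_neg hneg] at q1 q2
      left
      constructor
      · by_contra hh
        have := mul_pos p1 (not_le.1 hh)
        linarith
      · by_contra hh
        have := mul_pos p2 (neg_pos.2 (not_le.1 hh))
        linarith
    · rw [abs_of_pos hpos] at q1 q2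
      right
      constructor
      · by_contra hh
        have := mul_pos p2 (not_le.1 hh)
        linarith
      · by_contra hh
        have := mul_pos p1 (neg_pos.2 (not_le.1 hh))
        linarith
  obtain ⟨z, hz, hz0⟩ := intermediate_value_uIcc (by rwa [uIcc_of_le hab]) hmem
  rw [uIcc_of_le hab] at hz
  exact ⟨z, ⟨ha0.trans_le hz.1, hz0⟩, hxa.trans_le hz.1⟩

theorem exists_isZeroSeq {ν : ℝ} (hν : 0 ≤ ν) : ∃ z, IsZeroSeq ν z :=
  exists_strictMono_range_eq (finite_zeros_besselG hν) (fun _ hx => hx.1) (exists_zero_besselG_gt hν)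

namespace IsZeroSeq

variable {ν ν' : ℝ} {z z' : ℕ → ℝ}

theorem pos (h : IsZeroSeq ν z) (n : ℕ) : 0 < z n :=
  (h.2.subset (mem_range_self n)).1

theorem zero (h : IsZeroSeq ν z) (n : ℕ) : besselG ν (z n) = 0 :=
  (h.2.subset (mem_range_self n)).2

theorem exists_eq (h : IsZeroSeq ν z) {x : ℝ} (hx : 0 < x) (h0 : besselG ν x = 0) :
    ∃ n, z n = x := h.2.symm.subset ⟨hx, h0⟩

/-- An increasing sequence of zeros is a subsequence z (k n) with k strictly increasing, and n ≤ k
n. This turns every construction of zeros below into an upper bound for z n. -/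
theorem le_of_strictMono (h : IsZeroSeq ν z) {c : ℕ → ℝ} (hc : StrictMono c) (hc0 : ∀ n, 0 < c n)
    (hcz : ∀ n, besselG ν (c n) = 0) (n : ℕ) : z n ≤ c n := by
  choose k hk using fun n => h.exists_eq (hc0 n) (hcz n)
  have hkm : StrictMono k := fun a b hab => h.1.lt_iff_lt.1 (by rw [hk, hk]; exact hc hab)
  rw [← hk n]
  exact h.1.monotone hkm.le_apply

theorem unique (h : IsZeroSeq ν z) (h' : IsZeroSeq ν z') (n : ℕ) : z n = z' n :=
  le_antisymm (h.le_of_strictMono h'.1 h'.pos h'.zero n) (h'.le_of_strictMono h.1 h.pos h.zero n)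

theorem tendsto_atTop (hν : 0 ≤ ν) (h : IsZeroSeq ν z) : Tendsto z atTop atTop := by
  refine tendsto_atTop_atTop_of_monotone h.1.monotone fun b => ?_
  obtain ⟨x, hx, hbx⟩ := exists_zero_besselG_gt hν b
  obtain ⟨n, hn⟩ := h.exists_eq hx.1 hx.2
  exact ⟨n, hn ▸ hbx.le⟩

/-- The derivative of `besselG ν` is -(x/2) `besselG (ν + 1)`, so Rolle's theorem puts a zero of
order ν + 1 strictly between consecutive zeros of order ν. -/
theorem lt_succ_of_add_one (hν : 0 ≤ ν) (h : IsZeroSeq ν z) (h' : IsZeroSeq (ν + 1) z') (n : ℕ) :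
    z' n < z (n + 1) := by
  have key : ∀ n, ∃ c ∈ Ioo (z n) (z (n + 1)), besselG (ν + 1) c = 0 := fun n => by
    obtain ⟨c, hc, hc0⟩ := exists_hasDerivAt_eq_zero (h.1 n.lt_succ_self)
      (continuous_besselG hν).continuousOn ((h.zero n).trans (h.zero (n + 1)).symm)
      (fun x _ => hasDerivAt_besselG hν x)
    have : 0 < c := (h.pos n).trans hc.1
    exact ⟨c, hc, (mul_eq_zero.1 hc0).resolve_left (by linarith : -(c / 2) < 0).ne⟩
  choose c hc hc0 using key
  exact (h'.le_of_strictMono (strictMono_nat_of_lt_succ fun n => (hc n).2.trans (hc (n + 1)).1)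
    (fun n => (h.pos n).trans (hc n).1) hc0 n).trans_lt (hc n).2

end IsZeroSeq

/-! ### Sturm comparison between orders. -/

theorem hasDerivAt_nonpos_of_pos_left {f : ℝ → ℝ} {f' p q : ℝ} (h : HasDerivAt f f' q) (hpq : p < q)
    (h0 : f q = 0) (hf : ∀ x ∈ Ioo p q, 0 < f x) : f' ≤ 0 := by
  have ht := (hasDerivWithinAt_iff_tendsto_slope' (s := Iio q) (by simp)).1 h.hasDerivWithinAt
  refine le_of_tendsto ht ?_
  filter_upwards [Ioo_mem_nhdsLT hpq] with x hx
  rw [slope_def_field, h0]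
  exact div_nonpos_of_nonneg_of_nonpos (by simpa using (hf x hx).le) (by linarith [hx.2])

theorem hasDerivAt_nonneg_of_pos_right {f : ℝ → ℝ} {f' p q : ℝ} (h : HasDerivAt f f' p) (hpq : p < q)
    (h0 : f p = 0) (hf : ∀ x ∈ Ioo p q, 0 < f x) : 0 ≤ f' := by
  have ht := (hasDerivWithinAt_iff_tendsto_slope' (s := Ioi p) (by simp)).1 h.hasDerivWithinAt
  refine ge_of_tendsto ht ?_
  filter_upwards [Ioo_mem_nhdsGT hpq] with x hx
  rw [slope_def_field, h0]
  exact div_nonneg (by simpa using (hf x hx).le) (by linarith [hx.1])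

theorem exists_sign_mul_pos {f : ℝ → ℝ} (hf : Continuous f) {p q : ℝ} (hpq : p < q)
    (h : ∀ x ∈ Ioo p q, f x ≠ 0) : ∃ ε : ℝ, ∀ x ∈ Ioo p q, 0 < ε * f x := by
  set m := (p + q) / 2
  have hm : m ∈ Ioo p q := ⟨by simp only [m]; linarith, by simp only [m]; linarith⟩
  -- The midpoint value itself serves as the sign; only its sign matters, not its size.
  refine ⟨f m, fun x hx => ?_⟩
  by_contra hle
  have hmem : (0 : ℝ) ∈ uIcc (f m) (f x) := by
    rw [mem_uIcc]
    rcases lt_or_gt_of_ne (h m hm) with h1 | h1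
    · left; exact ⟨h1.le, by nlinarith⟩
    · right; exact ⟨by nlinarith, h1.le⟩
  obtain ⟨y, hy, hy0⟩ := intermediate_value_uIcc hf.continuousOn hmem
  exact h y (ordConnected_Ioo.uIcc_subset hm hx hy) hy0

/-- Sturm comparison: `J_ν` has a zero between consecutive zeros of `J_ν'` if `ν < ν'`. -/
theorem exists_zero_besselG_of_lt {ν ν' p q : ℝ} (hν : 0 ≤ ν) (hνν' : ν < ν') (hp : 0 ≤ p)
    (hpq : p < q) (hp0 : p = 0 ∨ besselG ν' p = 0) (hq0 : besselG ν' q = 0)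
    (hne : ∀ x ∈ Ioo p q, besselG ν' x ≠ 0) : ∃ x ∈ Ioo p q, besselG ν x = 0 := by
  by_contra! hcon
  have hν' : 0 ≤ ν' := hν.trans hνν'.le
  have hs : 0 < ν + ν' := by linarith
  obtain ⟨ε, hε⟩ := exists_sign_mul_pos (continuous_besselG hν) hpq hcon
  obtain ⟨ε', hε'⟩ := exists_sign_mul_pos (continuous_besselG hν') hpq hne
  have hd : ∀ x, HasDerivAt (fun x => ε' * besselG ν' x) (ε' * (-(x / 2) * besselG (ν' + 1) x)) x :=
    fun x => (hasDerivAt_besselG hν' x).const_mul ε'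
  have hge : ∀ y ∈ Icc p q, 0 ≤ ε * besselG ν y := fun y hy => by
    have hc : Continuous fun y => ε * besselG ν y := continuous_const.mul (continuous_besselG hν)
    rw [← closure_Ioo hpq.ne] at hy
    exact closure_minimal (fun x hx => (hε x hx).le) (isClosed_le continuous_const hc) hy
  -- Up to the factor ε ε', this is x (u' v - u v') for u = x^ν `besselG ν` and v = x^ν' `besselG
  -- ν'`. Its derivative is (ν² - ν'²) u v / x, negative once the signs are fixed. In this form S
  -- extends continuously to x = 0.
  set S : ℝ → ℝ := fun x => ε * ε' * (x ^ (ν + ν') * ((ν - ν') * (besselG ν x * besselG ν' x) -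
    x ^ 2 / 2 * (besselG (ν + 1) x * besselG ν' x - besselG ν x * besselG (ν' + 1) x)))
  have hSc : Continuous S := by
    have h1 : Continuous fun x : ℝ => x ^ (ν + ν') := Real.continuous_rpow_const hs.le
    have h2 := continuous_besselG hν
    have h3 := continuous_besselG hν'
    have h4 := continuous_besselG (ν := ν + 1) (by positivity)
    have h5 := continuous_besselG (ν := ν' + 1) (by positivity)
    fun_prop
  have hSd : ∀ x, 0 < x → HasDerivAt S ((ν ^ 2 - ν' ^ 2) * x ^ (ν + ν') * x⁻¹ *
      ((ε * besselG ν x) * (ε' * besselG ν' x))) x := fun x hx => by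
    have h1 : HasDerivAt (fun x : ℝ => x ^ (ν + ν')) ((ν + ν') * x ^ (ν + ν') * x⁻¹) x := by
      refine (Real.hasDerivAt_rpow_const (Or.inl hx.ne')).congr_deriv ?_
      rw [Real.rpow_sub_one hx.ne']; ring
    have h2 := hasDerivAt_besselG hν x
    have h3 := hasDerivAt_besselG hν' x
    have h4 := hasDerivAt_besselG (ν := ν + 1) (by positivity) x
    have h5 := hasDerivAt_besselG (ν := ν' + 1) (by positivity) x
    have h6 : HasDerivAt (fun x : ℝ => x ^ 2 / 2) x x := by
      simpa using (hasDerivAt_pow 2 x).div_const 2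
    have r1 := besselG_recurrence hν x
    have r2 := besselG_recurrence hν' x
    rw [show ν + 1 + 1 = ν + 2 by ring] at h4
    rw [show ν' + 1 + 1 = ν' + 2 by ring] at h5
    refine ((h1.mul (((h2.mul h3).const_mul (ν - ν')).sub
      (h6.mul ((h4.mul h3).sub (h2.mul h5))))).const_mul (ε * ε')).congr_deriv ?_
    have hinv : x⁻¹ * x = 1 := inv_mul_cancel₀ hx.ne'
    simp only [Pi.mul_apply, Pi.sub_apply]
    linear_combination (ε * ε' * x ^ (ν + ν') * x * besselG ν' x) * r1 -
      (ε * ε' * x ^ (ν + ν') * x * besselG ν x) * r2 -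
      (ε * ε' * (ν + ν') * x ^ (ν + ν') * (x / 2) *
        (besselG (ν + 1) x * besselG ν' x - besselG ν x * besselG (ν' + 1) x)) * hinv
  have hanti : StrictAntiOn S (Icc p q) := by
    refine strictAntiOn_of_deriv_neg (convex_Icc p q) hSc.continuousOn fun x hx => ?_
    rw [interior_Icc] at hx
    have hx0 : 0 < x := hp.trans_lt hx.1
    rw [(hSd x hx0).deriv]
    have h1 : 0 < x ^ (ν + ν') * x⁻¹ * ((ε * besselG ν x) * (ε' * besselG ν' x)) :=
      mul_pos (mul_pos (Real.rpow_pos_of_pos hx0 _) (inv_pos.2 hx0)) (mul_pos (hε x hx) (hε' x hx))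
    have h2 : ν ^ 2 - ν' ^ 2 < 0 := by nlinarith
    have := mul_neg_of_neg_of_pos h2 h1
    linarith
  have hlt := hanti (left_mem_Icc.2 hpq.le) (right_mem_Icc.2 hpq.le) hpq
  have hq : 0 < q := hp.trans_lt hpq
  -- At q only the term with v' survives, and v' has a forced sign because ε' v is positive to the
  -- left of q. At p the sign is reversed, or S 0 = 0 because ν + ν' > 0. Both contradict strict
  -- decrease.
  have hSq : 0 ≤ S q := by
    have h1 := hasDerivAt_nonpos_of_pos_left (hd q) hpq (by rw [hq0, mul_zero]) hε'
    have h2 := hge q (right_mem_Icc.2 hpq.le)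
    have h3 : 0 ≤ ε' * besselG (ν' + 1) q := by nlinarith
    have h4 : S q = q ^ (ν + ν') * (q ^ 2 / 2 * ((ε * besselG ν q) * (ε' * besselG (ν' + 1) q))) := by
      simp only [S, hq0]; ring
    rw [h4]
    positivity
  have hSp : S p ≤ 0 := by
    rcases hp.eq_or_lt with hp' | hp'
    · simp [S, ← hp', Real.zero_rpow hs.ne']
    have hp0 := hp0.resolve_left hp'.ne'
    have h1 := hasDerivAt_nonneg_of_pos_right (hd p) hpq (by rw [hp0, mul_zero]) hε'
    have h2 := hge p (left_mem_Icc.2 hpq.le)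
    have h3 : 0 ≤ -(ε' * besselG (ν' + 1) p) := by nlinarith
    have h4 : S p =
        -(p ^ (ν + ν') * (p ^ 2 / 2 * ((ε * besselG ν p) * -(ε' * besselG (ν' + 1) p)))) := by
      simp only [S, hp0]; ring
    rw [h4, neg_nonpos]
    positivity
  linarith

/-- Sturm comparison gives a zero of order ν in (0, z' 0) and in each gap of z'. These increase with
n, so the n-th of them, which lies below z' n, bounds z n. -/
theorem IsZeroSeq.lt_of_lt {ν ν' : ℝ} {z z' : ℕ → ℝ} (hν : 0 ≤ ν) (hνν' : ν < ν')
    (h : IsZeroSeq ν z) (h' : IsZeroSeq ν' z') (n : ℕ) : z n < z' n := by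
  have hno : ∀ n x, z' n < x → x < z' (n + 1) → besselG ν' x ≠ 0 := fun n x h1 h2 h0 => by
    obtain ⟨k, rfl⟩ := h'.exists_eq ((h'.pos n).trans h1) h0
    have := h'.1.lt_iff_lt.1 h1
    have := h'.1.lt_iff_lt.1 h2
    omega
  have key : ∀ n, ∃ c, c < z' n ∧ 0 < c ∧ (∀ k, k < n → z' k < c) ∧ besselG ν c = 0 := by
    intro n
    rcases n with _ | n
    · obtain ⟨c, hc, hc0⟩ := exists_zero_besselG_of_lt hν hνν' le_rfl (h'.pos 0) (Or.inl rfl)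
        (h'.zero 0) fun x hx h0 => by
          obtain ⟨k, rfl⟩ := h'.exists_eq hx.1 h0
          exact absurd (h'.1.lt_iff_lt.1 hx.2) (Nat.not_lt_zero _)
      exact ⟨c, hc.2, hc.1, by simp, hc0⟩
    · obtain ⟨c, hc, hc0⟩ := exists_zero_besselG_of_lt hν hνν' (h'.pos n).le (h'.1 n.lt_succ_self)
        (Or.inr (h'.zero n)) (h'.zero (n + 1)) fun x hx => hno n x hx.1 hx.2
      exact ⟨c, hc.2, (h'.pos n).trans hc.1, fun k hk =>
        (h'.1.monotone (Nat.lt_succ_iff.1 hk)).trans_lt hc.1, hc0⟩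
  choose c h1 h2 h3 h4 using key
  exact (h.le_of_strictMono (strictMono_nat_of_lt_succ fun n =>
    (h1 n).trans (h3 (n + 1) n n.lt_succ_self)) h2 h4 n).trans_lt (h1 n)

/-! ### The numbering of the zeros and their limit behaviour. -/

theorem isZeroSeq_half : IsZeroSeq (1 / 2) fun n : ℕ => ((n : ℝ) + 1) * π := by
  refine ⟨fun m n h => ?_, ?_⟩
  · have : (m : ℝ) < n := by exact_mod_cast h
    have := Real.pi_pos
    simp only
    gcongr
  · obtain ⟨c, hc, h⟩ := exists_sin_eq_mul_besselG_half
    ext x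
    constructor
    · rintro ⟨n, rfl⟩
      have hx : 0 < ((n : ℝ) + 1) * π := by positivity
      have h1 := h _ hx
      have h2 : Real.sin (((n : ℝ) + 1) * π) = 0 := by exact_mod_cast Real.sin_nat_mul_pi (n + 1)
      rw [h2] at h1
      exact ⟨hx, by simpa [hc, hx.ne', Real.pi_ne_zero, (by positivity : (n : ℝ) + 1 ≠ 0)] using h1.symm⟩
    · rintro ⟨hx, h0⟩
      have h1 := h x hx
      rw [h0, mul_zero, mul_zero, Real.sin_eq_zero_iff] at h1
      obtain ⟨n, hn⟩ := h1
      have hn0 : 0 < n := by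
        have : (0 : ℝ) < n := by
          by_contra hh
          have := mul_nonneg (neg_nonneg.2 (not_lt.1 hh)) Real.pi_pos.le
          linarith
        exact_mod_cast this
      obtain ⟨k, rfl⟩ := Int.eq_succ_of_zero_lt hn0
      exact ⟨k, by rw [← hn]; push_cast; ring⟩

/-- Away from ±π a small sine forces a small argument, quantitatively by Jordan's inequality sin t ≥
2t/π. The margin η excludes convergence to other multiples of π. -/
theorem tendsto_zero_of_tendsto_sin {e : ℕ → ℝ} {η : ℝ} (hη : 0 < η)
    (hs : Tendsto (fun n => Real.sin (e n)) atTop (𝓝 0)) (he : ∀ᶠ n in atTop, |e n| ≤ π - η) :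
    Tendsto e atTop (𝓝 0) := by
  have hπ := Real.pi_pos
  have key : ∀ t, 0 ≤ t → t ≤ π - η → Real.sin t < 2 / π * η → t ≤ π / 2 * Real.sin t := by
    intro t h0 h1 h2
    rcases le_total t (π / 2) with h | h
    · have := Real.mul_le_sin h0 h
      calc t = π / 2 * (2 / π * t) := by field_simp
        _ ≤ _ := by gcongr
    · exfalso
      have h3 := Real.mul_le_sin (x := π - t) (by linarith) (by linarith)
      rw [Real.sin_pi_sub] at h3
      have : 2 / π * η ≤ 2 / π * (π - t) := by gcongr; linarith
      linarith
  have habs : ∀ n, |e n| ≤ π - η → Real.sin |e n| = |Real.sin (e n)| := fun n hn => by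
    rw [Real.abs_sin_eq_sin_abs_of_abs_le_pi (by linarith)]
  rw [tendsto_zero_iff_norm_tendsto_zero]
  have hs' := hs.abs
  rw [abs_zero] at hs'
  refine squeeze_zero' (Eventually.of_forall fun n => norm_nonneg _) ?_
    (by simpa using hs'.const_mul (π / 2))
  filter_upwards [he, hs'.eventually_lt_const (u := 2 / π * η) (by positivity)] with n hn hn'
  rw [← habs n hn] at hn' ⊢
  exact key _ (abs_nonneg _) hn hn'

/-- At a zero the asymptotic formula leaves only its sine term; the shift by (n+1)π changes at most
the sign. -/
theorem IsZeroSeq.tendsto_sin {ν : ℝ} {z : ℕ → ℝ} (hν : 0 ≤ ν) (h : IsZeroSeq ν z) :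
    Tendsto (fun n : ℕ => Real.sin (z n - (n + 1) * π - (ν - 1 / 2) * (π / 2))) atTop (𝓝 0) := by
  obtain ⟨C, hC, hlim⟩ := besselG_asymptotic hν
  have h1 := ((hlim.comp (h.tendsto_atTop hν)).div_const (-C)).norm
  simp only [zero_div, norm_zero] at h1
  rw [tendsto_zero_iff_norm_tendsto_zero]
  refine h1.congr fun n => ?_
  have e : z n - (n + 1) * π - (ν - 1 / 2) * (π / 2) =
      z n - (ν - 1 / 2) * (π / 2) - ((n + 1 : ℕ) : ℝ) * π := by push_cast; ring
  rw [e, Real.sin_sub_nat_mul_pi, norm_mul, norm_pow, norm_neg, norm_one, one_pow, one_mul]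
  simp [h.zero n, hC]

/-- McMahon's leading asymptotics of the zeros of `J_ν`, with the right numbering. -/
theorem IsZeroSeq.tendsto_sub {ν : ℝ} (hν : 0 ≤ ν) {z : ℕ → ℝ} (h : IsZeroSeq ν z) :
    Tendsto (fun n : ℕ => z n - (n + 1) * π - (ν - 1 / 2) * (π / 2)) atTop (𝓝 0) := by
  have hπ := Real.pi_pos
  -- Induction on an integer bound for ν: orders below 1 are compared with 1/2, the others with ν -
  -- 1.
  obtain ⟨k, hk⟩ : ∃ k : ℕ, ν < k + 1 := (exists_nat_gt ν).imp fun k hk => by linarith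
  induction k generalizing ν z with
  | zero =>
    have hν1 : ν < 1 := by simpa using hk
    have hsin := h.tendsto_sin hν
    rcases lt_trichotomy ν (1 / 2) with hlt | heq | hgt
    -- For n ≥ 1, comparison with order 1/2 from both sides, through ν + 1 below, gives nπ < z n <
    -- (n+1)π. After subtracting the phase this leaves the margin (1/2 - ν)π/2.
    · obtain ⟨z₁, hz₁⟩ := exists_isZeroSeq (ν := ν + 1) (by positivity)
      refine tendsto_zero_of_tendsto_sin (η := (1 / 2 - ν) * (π / 2))
        (mul_pos (by linarith) (by positivity)) hsin ?_
      filter_upwards [eventually_ge_atTop 1] with n hn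
      obtain ⟨n, rfl⟩ := Nat.exists_eq_add_of_le' hn
      have h1 := h.lt_of_lt hν hlt isZeroSeq_half (n + 1)
      have h2 := isZeroSeq_half.lt_of_lt (by norm_num) (by linarith : 1 / 2 < ν + 1) hz₁ n
      have h3 := h.lt_succ_of_add_one hν hz₁ n
      push_cast at h1 h2 h3 ⊢
      rw [abs_le]
      constructor <;> nlinarith
    · subst heq
      refine tendsto_const_nhds.congr fun n => ?_
      rw [h.unique isZeroSeq_half n]; ring
    -- Here (n+1)π < z n < (n+2)π, the upper bound passing through order 3/2.
    · obtain ⟨z₁, hz₁⟩ := exists_isZeroSeq (ν := 1 / 2 + 1) (by norm_num)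
      refine tendsto_zero_of_tendsto_sin (η := (ν - 1 / 2) * (π / 2))
        (mul_pos (by linarith) (by positivity)) hsin ?_
      filter_upwards with n
      have h1 := isZeroSeq_half.lt_of_lt (by norm_num) hgt h n
      have h2 := h.lt_of_lt hν (by linarith) hz₁ n
      have h3 := isZeroSeq_half.lt_succ_of_add_one (by norm_num) hz₁ n
      push_cast at h1 h2 h3 ⊢
      rw [abs_le]
      constructor <;> nlinarith
  | succ k ih =>
    rcases lt_or_ge ν 1 with hν1 | hν1
    · exact ih hν h (by have : (0 : ℝ) ≤ k := k.cast_nonneg; linarith)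
    · obtain ⟨z₀, hz₀⟩ := exists_isZeroSeq (ν := ν - 1) (by linarith)
      have h0 := ih (by linarith) hz₀ (by push_cast at hk; linarith)
      -- The zero z n lies between z₀ n and z₀ (n+1). The unit change of order moves the phase by
      -- π/2, and the error for z₀ is eventually below π/4, so the deviation is at most 3π/4.
      refine tendsto_zero_of_tendsto_sin (η := π / 4) (by positivity) (h.tendsto_sin hν) ?_
      have hev := h0.abs.eventually_lt_const (u := π / 4) (by simpa using by positivity)
      filter_upwards [hev, (tendsto_add_atTop_nat 1).eventually hev] with n h1 h2
      have h3 := hz₀.lt_of_lt (by linarith) (by linarith) h n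
      have h4 := hz₀.lt_succ_of_add_one (by linarith) (by simpa using h) n
      rw [abs_lt] at h1 h2
      push_cast at h2
      rw [abs_le]
      constructor <;> nlinarith

/-! ### The change of radial coordinate ρ. -/

namespace IsSol

variable {q q' : ℝ → ℂ} {a b κ : ℝ} {f f' g : ℝ → ℂ}

theorem congr (h : IsSol q a f g) (hq : EqOn q q' (Ioo 0 a)) (hf : EqOn f f' (Ioo 0 a)) :
    IsSol q' a f' g := by
  intro x hx
  refine ⟨(h x hx).1.congr_of_eventuallyEq ?_, ?_⟩
  · filter_upwards [isOpen_Ioo.mem_nhds hx] with y hy using (hf hy).symm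
  · rw [← hq hx, ← hf hx]
    exact (h x hx).2

/-- The condition x φ' = κ φ makes x d/dx act on f ∘ φ as κ times the same operator on f, so q is
merely multiplied by κ². It holds for ρ with κ = γ and for the inverse with κ = γ⁻¹. -/
theorem comp (h : IsSol q a f g) {φ : ℝ → ℝ} (hφ : MapsTo φ (Ioo 0 b) (Ioo 0 a))
    (hφ' : ∀ x ∈ Ioo 0 b, HasDerivAt φ (κ * φ x / x) x) :
    IsSol (fun x => (κ : ℂ) ^ 2 * q (φ x)) b (fun x => f (φ x)) (fun x => κ * g (φ x)) := by
  intro x hx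
  have hx0 : (x : ℂ) ≠ 0 := by exact_mod_cast hx.1.ne'
  have hφ0 : (φ x : ℂ) ≠ 0 := by exact_mod_cast (hφ hx).1.ne'
  have h1 := HasDerivAt.scomp x (h _ (hφ hx)).1 (hφ' x hx)
  have h2 := (HasDerivAt.scomp x (h _ (hφ hx)).2 (hφ' x hx)).const_mul (κ : ℂ)
  refine ⟨h1.congr_deriv ?_, h2.congr_deriv ?_⟩ <;>
  · rw [Complex.real_smul]
    push_cast
    field_simp

end IsSol

/-- The inverse of the coordinate change `rho`. -/
noncomputable def rhoInv (γ R x : ℝ) : ℝ := (x * (γ * R ^ (γ - 1))) ^ γ⁻¹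

theorem rho_rhoInv {γ R x : ℝ} (hγ : 0 < γ) (hR : 0 < R) (hx : 0 ≤ x) :
    rho γ R (rhoInv γ R x) = x := by
  have h : 0 < γ * R ^ (γ - 1) := mul_pos hγ (Real.rpow_pos_of_pos hR _)
  rw [rho, rhoInv, Real.rpow_inv_rpow (by positivity) hγ.ne', mul_div_cancel_right₀ _ h.ne']

theorem rhoInv_rho {γ R r : ℝ} (hγ : 0 < γ) (hR : 0 < R) (hr : 0 ≤ r) :
    rhoInv γ R (rho γ R r) = r := by
  have h : 0 < γ * R ^ (γ - 1) := mul_pos hγ (Real.rpow_pos_of_pos hR _)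
  rw [rho, rhoInv, div_mul_cancel₀ _ h.ne', Real.rpow_rpow_inv hr hγ.ne']

theorem rho_self {γ R : ℝ} (hγ : 0 < γ) (hR : 0 < R) : rho γ R R = R / γ := by
  have h : 0 < R ^ (γ - 1) := Real.rpow_pos_of_pos hR _
  rw [rho, show R ^ γ = R ^ (γ - 1) * R by rw [← Real.rpow_add_one hR.ne']; ring_nf]
  field_simp

theorem rho_nonneg {γ R r : ℝ} (hγ : 0 < γ) (hR : 0 < R) (hr : 0 ≤ r) : 0 ≤ rho γ R r := by
  have h : 0 < γ * R ^ (γ - 1) := mul_pos hγ (Real.rpow_pos_of_pos hR _)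
  exact div_nonneg (Real.rpow_nonneg hr _) h.le

theorem rho_lt_rho {γ R r s : ℝ} (hγ : 0 < γ) (hR : 0 < R) (hr : 0 ≤ r) (hrs : r < s) :
    rho γ R r < rho γ R s := by
  have h : 0 < γ * R ^ (γ - 1) := mul_pos hγ (Real.rpow_pos_of_pos hR _)
  exact div_lt_div_of_pos_right (Real.rpow_lt_rpow hr hrs hγ) h

theorem continuous_rho {γ : ℝ} (hγ : 0 < γ) (R : ℝ) : Continuous (rho γ R) :=
  (Real.continuous_rpow_const hγ.le).div_const _

theorem mapsTo_rho {γ R : ℝ} (hγ : 0 < γ) (hR : 0 < R) :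
    MapsTo (rho γ R) (Ioo 0 R) (Ioo 0 (R / γ)) := fun r hr => by
  refine ⟨(rho_nonneg hγ hR le_rfl).trans_lt (rho_lt_rho hγ hR le_rfl hr.1), ?_⟩
  rw [← rho_self hγ hR]
  exact rho_lt_rho hγ hR hr.1.le hr.2

theorem mapsTo_rhoInv {γ R : ℝ} (hγ : 0 < γ) (hR : 0 < R) :
    MapsTo (rhoInv γ R) (Ioo 0 (R / γ)) (Ioo 0 R) := fun x hx => by
  have h : 0 < γ * R ^ (γ - 1) := mul_pos hγ (Real.rpow_pos_of_pos hR _)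
  refine ⟨Real.rpow_pos_of_pos (mul_pos hx.1 h) _, ?_⟩
  by_contra hle
  rcases (not_lt.1 hle).eq_or_lt with heq | hlt
  · have := rho_rhoInv hγ hR hx.1.le
    rw [← heq, rho_self hγ hR] at this
    exact hx.2.ne' this
  · have := rho_lt_rho hγ hR hR.le hlt
    rw [rho_rhoInv hγ hR hx.1.le, rho_self hγ hR] at this
    exact lt_asymm this hx.2

theorem bijOn_rho {γ R : ℝ} (hγ : 0 < γ) (hR : 0 < R) :
    BijOn (rho γ R) (Ioo 0 R) (Ioo 0 (R / γ)) :=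
  InvOn.bijOn (f' := rhoInv γ R) ⟨fun _ hr => rhoInv_rho hγ hR hr.1.le,
    fun _ hx => rho_rhoInv hγ hR hx.1.le⟩ (mapsTo_rho hγ hR) (mapsTo_rhoInv hγ hR)

theorem hasDerivAt_rho (γ R : ℝ) {r : ℝ} (hr : 0 < r) :
    HasDerivAt (rho γ R) (γ * rho γ R r / r) r := by
  refine ((Real.hasDerivAt_rpow_const (Or.inl hr.ne')).div_const _).congr_deriv ?_
  rw [Real.rpow_sub_one hr.ne', rho]; ring

theorem hasDerivAt_rhoInv {γ R x : ℝ} (hγ : 0 < γ) (hR : 0 < R) (hx : 0 < x) :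
    HasDerivAt (rhoInv γ R) (γ⁻¹ * rhoInv γ R x / x) x := by
  have h : 0 < γ * R ^ (γ - 1) := mul_pos hγ (Real.rpow_pos_of_pos hR _)
  have h0 := mul_pos hx h
  refine ((Real.hasDerivAt_rpow_const (p := γ⁻¹) (Or.inl h0.ne')).comp x
    ((hasDerivAt_id x).mul_const _)).congr_deriv ?_
  rw [Real.rpow_sub_one h0.ne', rhoInv]
  field_simp

theorem solvesBessel_iff (ν a : ℝ) (w : ℂ) (f : ℝ → ℂ) :
    SolvesBessel ν a w f ↔ ∃ g, IsSol (besselCoeff ν w) a f g := by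
  rw [← exists_isSol_iff (continuous_besselCoeff ν w).continuousOn, SolvesBessel]
  refine and_congr_right fun _ => forall₂_congr fun x hx => ?_
  have hx0 : (x : ℂ) ≠ 0 := by exact_mod_cast hx.1.ne'
  rw [eq_div_iff hx0, besselCoeff]
  set D := deriv (fun s : ℝ => (s : ℂ) * deriv f s) x
  have e : ((1 / x : ℝ) : ℂ) * D + (w - ((ν ^ 2 / x ^ 2 : ℝ) : ℂ)) * f x =
      (D * x - ((ν : ℂ) ^ 2 - w * (x : ℂ) ^ 2) * f x) / (x : ℂ) ^ 2 := by
    push_cast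
    field_simp
    ring
  rw [e, div_eq_zero_iff, or_iff_left (pow_ne_zero 2 hx0), sub_eq_zero]

/-- The coefficient of the radial equation in the form `r (r ψ')' = q ψ`. -/
noncomputable def radialCoeff (γ R ν : ℝ) (w : ℂ) (r : ℝ) : ℂ :=
  (γ : ℂ) ^ 2 * besselCoeff ν w (rho γ R r)

theorem radialCoeff_eq {γ R ν : ℝ} (hγ : 0 < γ) (hR : 0 < R) (w : ℂ) {r : ℝ} (hr : 0 < r) :
    radialCoeff γ R ν w r = ((γ ^ 2 * ν ^ 2 : ℝ) : ℂ) -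
      w * ((r ^ (2 * γ) / R ^ (2 * γ - 2) : ℝ) : ℂ) := by
  have e1 : r ^ (2 * γ) = (r ^ γ) ^ 2 := by rw [mul_comm, Real.rpow_mul hr.le, Real.rpow_two]
  have e2 : R ^ (2 * γ - 2) = (R ^ (γ - 1)) ^ 2 := by
    rw [← Real.rpow_two, ← Real.rpow_mul hR.le]; ring_nf
  have h1 : ((R ^ (γ - 1) : ℝ) : ℂ) ≠ 0 := by exact_mod_cast (Real.rpow_pos_of_pos hR _).ne'
  have h2 : (γ : ℂ) ≠ 0 := by exact_mod_cast hγ.ne'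
  rw [radialCoeff, besselCoeff, rho, e1, e2]
  push_cast
  field_simp

/-- Multiplication by r^(2γ) / R^(2γ-2) brings the radial equation to the form r (r ψ')' = q ψ. -/
theorem solvesRadial_iff {α γ R : ℝ} (hα : 0 < α) (hγ : 0 < γ) (hR : 0 < R) (ħ M k : ℝ) (m : ℤ)
    (E : ℂ) (ψ : ℝ → ℂ) : SolvesRadial α γ R ħ M k m E ψ ↔
      ∃ g, IsSol (radialCoeff γ R (|(m : ℝ)| / α)
        (((2 * M / ħ ^ 2 : ℝ) : ℂ) * E - ((k ^ 2 : ℝ) : ℂ))) R ψ g := by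
  set w := ((2 * M / ħ ^ 2 : ℝ) : ℂ) * E - ((k ^ 2 : ℝ) : ℂ) with hw
  have hq : Continuous (radialCoeff γ R (|(m : ℝ)| / α) w) :=
    continuous_const.mul ((continuous_besselCoeff _ w).comp (continuous_rho hγ R))
  rw [← exists_isSol_iff hq.continuousOn, SolvesRadial]
  refine and_congr_right fun _ => forall₂_congr fun r hr => ?_
  have hr0 : (r : ℂ) ≠ 0 := by exact_mod_cast hr.1.ne'
  have hB : ((r ^ (2 * γ) : ℝ) : ℂ) ≠ 0 := by exact_mod_cast (Real.rpow_pos_of_pos hr.1 _).ne'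
  have hA : ((R ^ (2 * γ - 2) : ℝ) : ℂ) ≠ 0 := by exact_mod_cast (Real.rpow_pos_of_pos hR _).ne'
  have hαc : (α : ℂ) ≠ 0 := by exact_mod_cast hα.ne'
  rw [eq_div_iff hr0, radialCoeff_eq hγ hR w hr.1, div_pow, sq_abs, Real.rpow_sub_one hr.1.ne']
  set A := R ^ (2 * γ - 2)
  set B := r ^ (2 * γ)
  set D := deriv (fun s : ℝ => (s : ℂ) * deriv ψ s) r
  have hE : ((2 * M / ħ ^ 2 : ℝ) : ℂ) * E = w + ((k ^ 2 : ℝ) : ℂ) := by rw [hw]; ring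
  have e : ((A / (B / r) : ℝ) : ℂ) * D +
      (((2 * M / ħ ^ 2 : ℝ) : ℂ) * E - ((γ ^ 2 / α ^ 2 * (A / B) *
        (m : ℝ) ^ 2 + k ^ 2 : ℝ) : ℂ)) * ψ r =
      (((A : ℝ) : ℂ) / ((B : ℝ) : ℂ)) * (D * r -
        (((γ ^ 2 * ((m : ℝ) ^ 2 / α ^ 2) : ℝ) : ℂ) -
          w * ((B / A : ℝ) : ℂ)) * ψ r) := by
    rw [hE]
    push_cast
    field_simp
    ring
  rw [e, mul_eq_zero, or_iff_right (div_ne_zero hA hB), sub_eq_zero]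

theorem IsSol.comp_rho {γ R ν : ℝ} (hγ : 0 < γ) (hR : 0 < R) {w : ℂ} {f g : ℝ → ℂ}
    (h : IsSol (besselCoeff ν w) (R / γ) f g) :
    IsSol (radialCoeff γ R ν w) R (fun r => f (rho γ R r)) (fun r => γ * g (rho γ R r)) :=
  h.comp (mapsTo_rho hγ hR) fun _ hr => hasDerivAt_rho γ R hr.1

theorem IsSol.comp_rhoInv {γ R ν : ℝ} (hγ : 0 < γ) (hR : 0 < R) {w : ℂ} {f g : ℝ → ℂ}
    (h : IsSol (radialCoeff γ R ν w) R f g) :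
    IsSol (besselCoeff ν w) (R / γ) (fun x => f (rhoInv γ R x))
      (fun x => (γ⁻¹ : ℝ) * g (rhoInv γ R x)) := by
  refine (h.comp (mapsTo_rhoInv hγ hR) fun _ hx => hasDerivAt_rhoInv hγ hR hx.1).congr
    (fun x hx => ?_) fun _ _ => rfl
  have hγc : (γ : ℂ) ≠ 0 := by exact_mod_cast hγ.ne'
  simp only [radialCoeff]
  rw [rho_rhoInv hγ hR hx.1.le]
  push_cast
  field_simp

theorem solvesRadial_comp_rho_iff {α γ R : ℝ} (hα : 0 < α) (hγ : 0 < γ) (hR : 0 < R)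
    (ħ M k : ℝ) (m : ℤ) (E : ℂ) (f : ℝ → ℂ) :
    SolvesRadial α γ R ħ M k m E (fun r => f (rho γ R r)) ↔
      SolvesBessel (|(m : ℝ)| / α) (R / γ)
        (((2 * M / ħ ^ 2 : ℝ) : ℂ) * E - ((k ^ 2 : ℝ) : ℂ)) f := by
  rw [solvesRadial_iff hα hγ hR, solvesBessel_iff]
  constructor
  · rintro ⟨g, hg⟩
    refine ⟨_, (hg.comp_rhoInv hγ hR).congr (fun _ _ => rfl) fun x hx => ?_⟩
    simp only [rho_rhoInv hγ hR hx.1.le]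
  · rintro ⟨g, hg⟩
    exact ⟨_, hg.comp_rho hγ hR⟩

/-! ### Bounded radial solutions vanishing at the wall. -/

theorem continuous_regularSol {ν : ℝ} (hν : 0 ≤ ν) (w : ℂ) : Continuous (regularSol ν w) := by
  have h1 : Continuous fun x : ℝ => x ^ ν := Real.continuous_rpow_const hν
  exact (Complex.continuous_ofReal.comp h1).mul
    ((continuous_besselSeries hν).comp (by fun_prop))

/-- In the coordinate ρ boundedness forces ψ to be a multiple of the regular solution with an a
priori complex parameter w. The wall condition makes w (R/2γ)² a zero of the series, hence positive,
so that w = b². -/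
theorem exists_eq_besselJ_of_solvesRadial {α γ R : ℝ} (hα : 0 < α) (hγ : 0 < γ) (hR : 0 < R)
    {ħ M k : ℝ} {m : ℤ} {E : ℂ} {ψ : ℝ → ℂ} (h : SolvesRadial α γ R ħ M k m E ψ)
    (hc : ContinuousOn ψ (Ioc 0 R)) (h0 : ψ R = 0) (hb : ∃ C : ℝ, ∀ r ∈ Ioo 0 R, ‖ψ r‖ ≤ C)
    (hne : ∃ r ∈ Ioc 0 R, ψ r ≠ 0) :
    ∃ b : ℝ, 0 < b ∧ besselJ (|(m : ℝ)| / α) ((b * (R / γ) : ℝ) : ℂ) = 0 ∧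
      ((2 * M / ħ ^ 2 : ℝ) : ℂ) * E - ((k ^ 2 : ℝ) : ℂ) = ((b ^ 2 : ℝ) : ℂ) ∧
      ∃ c : ℂ, ∀ r ∈ Ioc 0 R,
        ψ r = c * besselJ (|(m : ℝ)| / α) ((b * rho γ R r : ℝ) : ℂ) := by
  set ν := |(m : ℝ)| / α
  set w := ((2 * M / ħ ^ 2 : ℝ) : ℂ) * E - ((k ^ 2 : ℝ) : ℂ)
  have hν : 0 ≤ ν := by positivity
  have ha : 0 < R / γ := by positivity
  obtain ⟨g, hg⟩ := (solvesRadial_iff hα hγ hR ħ M k m E ψ).1 h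
  obtain ⟨C, hC⟩ := hb
  obtain ⟨c, hcF⟩ := (hg.comp_rhoInv hγ hR).eq_const_mul_regularSol hν ha (Or.inl ⟨C, by
    filter_upwards [Ioo_mem_nhdsGT ha] with x hx using hC _ (mapsTo_rhoInv hγ hR hx)⟩)
  have hψ : ∀ r ∈ Ioo 0 R, ψ r = c * regularSol ν w (rho γ R r) := fun r hr => by
    have := hcF _ (mapsTo_rho hγ hR hr)
    rwa [rhoInv_rho hγ hR hr.1.le] at this
  have hcont : Continuous fun r => c * regularSol ν w (rho γ R r) :=
    continuous_const.mul ((continuous_regularSol hν w).comp (continuous_rho hγ R))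
  -- The formula reaches the wall by continuity of both sides, so the boundary condition applies to
  -- the regular solution.
  have hψ' : ∀ r ∈ Ioc 0 R, ψ r = c * regularSol ν w (rho γ R r) := fun r hr => by
    rcases hr.2.eq_or_lt with rfl | hlt
    · have h1 : Tendsto ψ (𝓝[Ioo 0 r] r) (𝓝 (ψ r)) := (hc r hr).mono Ioo_subset_Ioc_self
      have h2 : Tendsto ψ (𝓝[Ioo 0 r] r) (𝓝 (c * regularSol ν w (rho γ r r))) := by
        refine (hcont.continuousWithinAt (s := Ioo 0 r) (x := r)).congr' ?_
        filter_upwards [self_mem_nhdsWithin] with s hs using (hψ s hs).symm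
      have _ : (𝓝[Ioo 0 r] r).NeBot := right_nhdsWithin_Ioo_neBot hr.1
      exact tendsto_nhds_unique h1 h2
    · exact hψ r ⟨hr.1, hlt⟩
  have hc0 : c ≠ 0 := by
    rintro rfl
    obtain ⟨r, hr, hr0⟩ := hne
    exact hr0 (by rw [hψ' r hr, zero_mul])
  have hF : besselSeries ν (w * ((R / γ / 2) ^ 2 : ℝ)) = 0 := by
    have := hψ' R ⟨hR, le_rfl⟩
    rw [h0, rho_self hγ hR, eq_comm, mul_eq_zero, or_iff_right hc0, regularSol, mul_eq_zero] at this
    exact this.resolve_left (by exact_mod_cast (Real.rpow_pos_of_pos ha _).ne')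
  obtain ⟨t, ht, hwt⟩ := exists_pos_of_besselSeries_eq_zero hν hF
  set b := √t / (R / γ / 2)
  have hb0 : 0 < b := by positivity
  have hwb : w = ((b ^ 2 : ℝ) : ℂ) := by
    have hac : (((R / γ / 2) ^ 2 : ℝ) : ℂ) ≠ 0 := by exact_mod_cast (by positivity)
    rw [div_pow, Real.sq_sqrt ht.le, Complex.ofReal_div, ← hwt, mul_div_cancel_right₀ _ hac]
  have hbc : (((b / 2) ^ ν : ℝ) : ℂ) ≠ 0 := by
    exact_mod_cast (Real.rpow_pos_of_pos (half_pos hb0) _).ne'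
  refine ⟨b, hb0, ?_, hwb, c / (((b / 2) ^ ν : ℝ) : ℂ), fun r hr => ?_⟩
  · rw [besselJ_ofReal_eq_regularSol ν hb0 ha.le, ← hwb, regularSol, hF, mul_zero, mul_zero]
  · rw [besselJ_ofReal_eq_regularSol ν hb0 (rho_nonneg hγ hR hr.1.le), ← hwb, hψ' r hr]
    field_simp

theorem solvesRadial_of_eq_besselJ {α γ R : ℝ} (hα : 0 < α) (hγ : 0 < γ) (hR : 0 < R)
    {ħ M k : ℝ} {m : ℤ} {E : ℂ} {ψ : ℝ → ℂ} {b : ℝ} (hb : 0 < b)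
    (hE : ((2 * M / ħ ^ 2 : ℝ) : ℂ) * E - ((k ^ 2 : ℝ) : ℂ) = ((b ^ 2 : ℝ) : ℂ)) {c : ℂ}
    (h : ∀ r ∈ Ioo 0 R, ψ r = c * besselJ (|(m : ℝ)| / α) ((b * rho γ R r : ℝ) : ℂ)) :
    SolvesRadial α γ R ħ M k m E ψ := by
  rw [solvesRadial_iff hα hγ hR, hE]
  set ν := |(m : ℝ)| / α
  have hs := (isSol_regularSol (by positivity : 0 ≤ ν) ((b ^ 2 : ℝ) : ℂ) (R / γ)).comp_rho hγ hR
  -- A scalar multiple is obtained as the zero solution minus a multiple of the regular one.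
  have hz : IsSol (radialCoeff γ R ν ((b ^ 2 : ℝ) : ℂ)) R (fun _ => 0) (fun _ => 0) := fun x _ => by
    simpa using hasDerivAt_const x (0 : ℂ)
  refine ⟨_, (hz.sub_const_mul hs (-c * (((b / 2) ^ ν : ℝ) : ℂ))).congr (fun _ _ => rfl)
    fun r hr => ?_⟩
  rw [h r hr, besselJ_ofReal_eq_regularSol ν hb (rho_nonneg hγ hR hr.1.le)]
  ring

theorem continuousOn_besselJ_rho {ν γ R b : ℝ} (hν : 0 ≤ ν) (hγ : 0 < γ) (hR : 0 < R)
    (hb : 0 < b) : ContinuousOn (fun r => besselJ ν ((b * rho γ R r : ℝ) : ℂ)) (Ici 0) := by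
  have h : Continuous fun r => (((b / 2) ^ ν : ℝ) : ℂ) *
      regularSol ν ((b ^ 2 : ℝ) : ℂ) (rho γ R r) :=
    continuous_const.mul ((continuous_regularSol hν _).comp (continuous_rho hγ R))
  exact h.continuousOn.congr fun r hr =>
    besselJ_ofReal_eq_regularSol ν hb (rho_nonneg hγ hR hr)

theorem exists_besselJ_rho_ne_zero {ν γ R b : ℝ} (hν : 0 ≤ ν) (hγ : 0 < γ) (hR : 0 < R)
    (hb : 0 < b) : ∃ r ∈ Ioo 0 R, besselJ ν ((b * rho γ R r : ℝ) : ℂ) ≠ 0 := by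
  obtain ⟨x, hx, hne⟩ := exists_regularSol_ne_zero hν ((b ^ 2 : ℝ) : ℂ) (div_pos hR hγ)
  refine ⟨rhoInv γ R x, mapsTo_rhoInv hγ hR hx, ?_⟩
  rw [rho_rhoInv hγ hR hx.1.le, besselJ_ofReal_eq_regularSol ν hb hx.1.le]
  exact mul_ne_zero (by exact_mod_cast (Real.rpow_pos_of_pos (half_pos hb) _).ne') hne

theorem isRadialBoundState_of_eq_besselJ {α γ R : ℝ} (hα : 0 < α) (hγ : 0 < γ) (hR : 0 < R)
    {ħ M k : ℝ} {m : ℤ} {E : ℂ} {ψ : ℝ → ℂ} {b : ℝ} (hb : 0 < b)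
    (hE : ((2 * M / ħ ^ 2 : ℝ) : ℂ) * E - ((k ^ 2 : ℝ) : ℂ) = ((b ^ 2 : ℝ) : ℂ))
    (hJ : besselJ (|(m : ℝ)| / α) ((b * (R / γ) : ℝ) : ℂ) = 0) {c : ℂ}
    (h : ∀ r ∈ Ioc 0 R, ψ r = c * besselJ (|(m : ℝ)| / α) ((b * rho γ R r : ℝ) : ℂ))
    (hn : ∫ r in (0 : ℝ)..R, r * ‖ψ r‖ ^ 2 = 1) : IsRadialBoundState α γ R ħ M k m E ψ := by
  have hν : 0 ≤ |(m : ℝ)| / α := by positivity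
  have hcont : ContinuousOn (fun r => c * besselJ (|(m : ℝ)| / α) ((b * rho γ R r : ℝ) : ℂ))
      (Ici 0) := continuousOn_const.mul (continuousOn_besselJ_rho hν hγ hR hb)
  refine ⟨solvesRadial_of_eq_besselJ hα hγ hR hb hE fun r hr => h r (Ioo_subset_Ioc_self hr),
    (hcont.mono fun r hr => hr.1.le).congr h, ?_, ?_, hn⟩
  · rw [h R ⟨hR, le_rfl⟩, rho_self hγ hR, hJ, mul_zero]
  · obtain ⟨C, hC⟩ := (isCompact_Icc (a := (0 : ℝ)) (b := R)).exists_bound_of_continuousOn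
      (hcont.mono fun r hr => hr.1)
    exact ⟨C, fun r hr => by rw [h r (Ioo_subset_Ioc_self hr)]; exact hC r (Ioo_subset_Icc_self hr)⟩

theorem exists_normalized_besselJ_rho {ν γ R b : ℝ} (hν : 0 ≤ ν) (hγ : 0 < γ) (hR : 0 < R)
    (hb : 0 < b) :
    ∃ c : ℂ, ∫ r in (0 : ℝ)..R, r * ‖c * besselJ ν ((b * rho γ R r : ℝ) : ℂ)‖ ^ 2 = 1 := by
  set J : ℝ → ℂ := fun r => besselJ ν ((b * rho γ R r : ℝ) : ℂ)
  have hJ : ContinuousOn J (Ici 0) := continuousOn_besselJ_rho hν hγ hR hb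
  have hpos : 0 < ∫ r in (0 : ℝ)..R, r * ‖J r‖ ^ 2 := by
    obtain ⟨r, hr, hne⟩ := exists_besselJ_rho_ne_zero hν hγ hR hb
    refine intervalIntegral.integral_pos hR
      (continuousOn_id.mul ((hJ.mono fun r hr => hr.1).norm.pow 2)) (fun r hr => ?_)
      ⟨r, Ioo_subset_Icc_self hr, ?_⟩
    · exact mul_nonneg hr.1.le (by positivity)
    · exact mul_pos hr.1 (pow_pos (norm_pos_iff.2 hne) 2)
  set N := ∫ r in (0 : ℝ)..R, r * ‖J r‖ ^ 2
  refine ⟨(((√N)⁻¹ : ℝ) : ℂ), ?_⟩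
  have e : ∀ r : ℝ, r * ‖(((√N)⁻¹ : ℝ) : ℂ) * J r‖ ^ 2 = N⁻¹ * (r * ‖J r‖ ^ 2) := fun r => by
    rw [norm_mul, mul_pow, Complex.norm_real, Real.norm_of_nonneg (by positivity), inv_pow,
      Real.sq_sqrt hpos.le]
    ring
  change ∫ r in (0 : ℝ)..R, r * ‖(((√N)⁻¹ : ℝ) : ℂ) * J r‖ ^ 2 = 1
  simp only [e]
  rw [intervalIntegral.integral_const_mul, inv_mul_cancel₀ hpos.ne']

theorem IsRadialBoundState.exists_ne_zero {α γ R ħ M k : ℝ} {m : ℤ} {E : ℂ} {ψ : ℝ → ℂ}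
    (hR : 0 < R) (h : IsRadialBoundState α γ R ħ M k m E ψ) : ∃ r ∈ Ioc 0 R, ψ r ≠ 0 := by
  by_contra! hz
  have : ∫ r in (0 : ℝ)..R, r * ‖ψ r‖ ^ 2 = 0 := by
    refine intervalIntegral.integral_zero_ae (MeasureTheory.ae_of_all _ fun r hr => ?_)
    rw [uIoc_of_le hR.le] at hr
    simp [hz r hr]
  rw [h.2.2.2.2] at this
  exact one_ne_zero this

theorem eq_energy_iff {ħ M k b : ℝ} (hħ : 0 < ħ) (hM : M ≠ 0) {E : ℂ} :
    E = energy ħ M k b ↔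
      ((2 * M / ħ ^ 2 : ℝ) : ℂ) * E - ((k ^ 2 : ℝ) : ℂ) = ((b ^ 2 : ℝ) : ℂ) := by
  have h1 : (ħ : ℂ) ≠ 0 := by exact_mod_cast hħ.ne'
  have h2 : (M : ℂ) ≠ 0 := by exact_mod_cast hM
  rw [energy, sub_eq_iff_eq_add]
  push_cast
  constructor
  · rintro rfl
    field_simp
    ring
  · intro h
    have : E = (ħ : ℂ) ^ 2 / (2 * M) * (2 * M / (ħ : ℂ) ^ 2 * E) := by field_simp
    rw [this, h]
    ring

/-! ### Fourier series on the circle. -/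

/-- The Fourier coefficient of a `2π`-periodic function. -/
noncomputable def circleCoeff (u : ℝ → ℂ) (m : ℤ) : ℂ :=
  ((1 / (2 * π) : ℝ) : ℂ) * ∫ φ in (0 : ℝ)..(2 * π), u φ * Complex.exp (-(Complex.I * m * φ))

theorem angularComponent_eq_circleCoeff (χ : ℝ × ℝ → ℂ) (m : ℤ) (r : ℝ) :
    angularComponent χ m r = circleCoeff (fun φ => χ (r, φ)) m := rfl

theorem circleCoeff_add {u v : ℝ → ℂ} (hu : Continuous u) (hv : Continuous v) (m : ℤ) :
    circleCoeff (fun φ => u φ + v φ) m = circleCoeff u m + circleCoeff v m := by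
  simp only [circleCoeff, add_mul]
  rw [intervalIntegral.integral_add, mul_add] <;>
    exact Continuous.intervalIntegrable (by fun_prop) _ _

theorem circleCoeff_const_mul (c : ℂ) (u : ℝ → ℂ) (m : ℤ) :
    circleCoeff (fun φ => c * u φ) m = c * circleCoeff u m := by
  simp only [circleCoeff, mul_assoc c]
  rw [intervalIntegral.integral_const_mul, mul_left_comm]

theorem exp_neg_int_mul_two_pi (m : ℤ) :
    Complex.exp (-(Complex.I * m * ((2 * π : ℝ) : ℂ))) = 1 := by
  rw [Complex.exp_eq_one_iff]
  exact ⟨-m, by push_cast; ring⟩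

/-- Integration by parts; the boundary terms cancel by periodicity. -/
theorem circleCoeff_deriv {u u' : ℝ → ℂ} (hu : ∀ φ, HasDerivAt u (u' φ) φ) (hu' : Continuous u')
    (hper : u (2 * π) = u 0) (m : ℤ) : circleCoeff u' m = Complex.I * m * circleCoeff u m := by
  have hc : Continuous u := continuous_iff_continuousAt.2 fun φ => (hu φ).continuousAt
  have he : ∀ φ : ℝ, HasDerivAt (fun φ : ℝ => Complex.exp (-(Complex.I * m * φ)))
      (Complex.exp (-(Complex.I * m * φ)) * -(Complex.I * m)) φ := fun φ => by
    have h : HasDerivAt (fun φ : ℝ => (φ : ℂ)) 1 φ := Complex.ofRealCLM.hasDerivAt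
    simpa using (h.const_mul (Complex.I * m)).neg.cexp
  have key := intervalIntegral.integral_eq_sub_of_hasDerivAt (a := 0) (b := 2 * π)
    (f := fun φ => u φ * Complex.exp (-(Complex.I * m * φ)))
    (f' := fun φ => u' φ * Complex.exp (-(Complex.I * m * φ)) +
      -(Complex.I * m) * (u φ * Complex.exp (-(Complex.I * m * φ))))
    (fun φ _ => ((hu φ).mul (he φ)).congr_deriv (by ring))
    (Continuous.intervalIntegrable (by fun_prop) _ _)
  rw [exp_neg_int_mul_two_pi, hper, intervalIntegral.integral_add
    (Continuous.intervalIntegrable (by fun_prop) _ _)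
    (Continuous.intervalIntegrable (by fun_prop) _ _),
    intervalIntegral.integral_const_mul] at key
  simp only [Complex.ofReal_zero, mul_zero, neg_zero, Complex.exp_zero, sub_self] at key
  rw [circleCoeff, circleCoeff]
  linear_combination ((1 / (2 * π) : ℝ) : ℂ) * key

/-- The function is lifted to `AddCircle (2 * π)`, where absolutely summable coefficients give
pointwise convergence. -/
theorem hasSum_circleCoeff {u : ℝ → ℂ} (hu : Continuous u) (hper : Function.Periodic u (2 * π))
    (hs : Summable (circleCoeff u)) (φ : ℝ) :
    HasSum (fun m : ℤ => circleCoeff u m * Complex.exp (Complex.I * m * φ)) (u φ) := by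
  have _ : Fact (0 < 2 * π) := ⟨Real.two_pi_pos⟩
  have hπ : (π : ℂ) ≠ 0 := by exact_mod_cast Real.pi_ne_zero
  let U : C(AddCircle (2 * π), ℂ) := ⟨hper.lift, hu.quotient_liftOn' _⟩
  have hU : ∀ x : ℝ, U (x : AddCircle (2 * π)) = u x := fun x => hper.lift_coe x
  have hcoef : ∀ m, fourierCoeff U m = circleCoeff u m := fun m => by
    rw [fourierCoeff_eq_intervalIntegral U m 0, circleCoeff, zero_add, Complex.real_smul]
    congr 1
    refine intervalIntegral.integral_congr fun x _ => ?_
    simp only [hU, smul_eq_mul, fourier_coe_apply]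
    rw [mul_comm]
    congr 2
    push_cast
    field_simp
  have h := has_pointwise_sum_fourier_series_of_summable (f := U)
    (hs.congr fun m => (hcoef m).symm) (φ : AddCircle (2 * π))
  rw [hU] at h
  refine h.congr_fun fun m => ?_
  simp only [hcoef, smul_eq_mul, fourier_coe_apply]
  congr 2
  push_cast
  field_simp

theorem eq_zero_of_circleCoeff_eq_zero {u : ℝ → ℂ} (hu : Continuous u)
    (hper : Function.Periodic u (2 * π)) (h : ∀ m, circleCoeff u m = 0) (φ : ℝ) : u φ = 0 := by
  have h0 : circleCoeff u = fun _ => 0 := funext h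
  have := hasSum_circleCoeff hu hper (by rw [h0]; exact summable_zero) φ
  simp only [h, zero_mul] at this
  exact this.unique hasSum_zero

theorem norm_circleCoeff_le {u : ℝ → ℂ} {C : ℝ} (hC : ∀ φ ∈ Icc 0 (2 * π), ‖u φ‖ ≤ C) (m : ℤ) :
    ‖circleCoeff u m‖ ≤ C := by
  have hπ := Real.two_pi_pos
  have h := intervalIntegral.norm_integral_le_of_norm_le_const (a := 0) (b := 2 * π) (C := C)
    (f := fun φ => u φ * Complex.exp (-(Complex.I * m * φ))) fun φ hφ => by
      rw [uIoc_of_le hπ.le] at hφ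
      rw [norm_mul, show -(Complex.I * m * φ) = ((-(m * φ) : ℝ) : ℂ) * Complex.I by push_cast; ring,
        Complex.norm_exp_ofReal_mul_I, mul_one]
      exact hC φ (Ioc_subset_Icc_self hφ)
  rw [circleCoeff, norm_mul, Complex.norm_real, Real.norm_of_nonneg (by positivity)]
  rw [sub_zero, abs_of_pos hπ] at h
  calc _ ≤ 1 / (2 * π) * (C * (2 * π)) := by gcongr
    _ = C := by field_simp

theorem circleCoeff_deriv_deriv {u u' u'' : ℝ → ℂ} (hu : ∀ φ, HasDerivAt u (u' φ) φ)
    (hu' : ∀ φ, HasDerivAt u' (u'' φ) φ) (hu'' : Continuous u'') (hper : u (2 * π) = u 0)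
    (hper' : u' (2 * π) = u' 0) (m : ℤ) :
    circleCoeff u'' m = -(m : ℂ) ^ 2 * circleCoeff u m := by
  have hc' : Continuous u' := continuous_iff_continuousAt.2 fun φ => (hu' φ).continuousAt
  rw [circleCoeff_deriv hu' hu'' hper', circleCoeff_deriv hu hc' hper]
  linear_combination (m : ℂ) ^ 2 * circleCoeff u m * Complex.I_sq

/-- Two integrations by parts bound the m-th coefficient by C/m² for m ≠ 0. -/
theorem summable_circleCoeff {u u' u'' : ℝ → ℂ} (hu : ∀ φ, HasDerivAt u (u' φ) φ)
    (hu' : ∀ φ, HasDerivAt u' (u'' φ) φ) (hu'' : Continuous u'') (hper : u (2 * π) = u 0)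
    (hper' : u' (2 * π) = u' 0) : Summable (circleCoeff u) := by
  obtain ⟨C, hC⟩ := (isCompact_Icc (a := (0 : ℝ)) (b := 2 * π)).exists_bound_of_continuousOn
    hu''.continuousOn
  have hs : Summable fun m : ℤ => C * (1 / (m : ℝ) ^ 2) :=
    (Real.summable_one_div_int_pow.2 one_lt_two).mul_left C
  refine hs.of_norm_bounded_eventually ?_
  filter_upwards [(Set.finite_singleton (0 : ℤ)).compl_mem_cofinite] with m hm
  have hm0 : (0 : ℝ) < (m : ℝ) ^ 2 := by
    have : (m : ℝ) ≠ 0 := by exact_mod_cast hm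
    positivity
  have h1 := norm_circleCoeff_le hC m
  rw [circleCoeff_deriv_deriv hu hu' hu'' hper hper', norm_mul, norm_neg, norm_pow,
    Complex.norm_intCast, sq_abs] at h1
  rw [mul_one_div, le_div_iff₀ hm0, mul_comm]
  exact h1

/-! ### Angular components of a planar factor. -/

/-- The partial derivative in the first variable. -/
noncomputable def dfst (χ : ℝ × ℝ → ℂ) (p : ℝ × ℝ) : ℂ := fderiv ℝ χ p (1, 0)

/-- The partial derivative in the second variable. -/
noncomputable def dsnd (χ : ℝ × ℝ → ℂ) (p : ℝ × ℝ) : ℂ := fderiv ℝ χ p (0, 1)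

section Planar

variable {R : ℝ} {χ : ℝ × ℝ → ℂ}

theorem isOpen_Ioo_prod_univ (R : ℝ) : IsOpen (Ioo 0 R ×ˢ (univ : Set ℝ)) := isOpen_Ioo.prod isOpen_univ

theorem contDiffOn_dfst {n : WithTop ℕ∞} (h : ContDiffOn ℝ (n + 1) χ (Ioo 0 R ×ˢ univ)) :
    ContDiffOn ℝ n (dfst χ) (Ioo 0 R ×ˢ univ) :=
  (h.fderiv_of_isOpen (isOpen_Ioo_prod_univ R) le_rfl).clm_apply contDiffOn_const

theorem contDiffOn_dsnd {n : WithTop ℕ∞} (h : ContDiffOn ℝ (n + 1) χ (Ioo 0 R ×ˢ univ)) :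
    ContDiffOn ℝ n (dsnd χ) (Ioo 0 R ×ˢ univ) :=
  (h.fderiv_of_isOpen (isOpen_Ioo_prod_univ R) le_rfl).clm_apply contDiffOn_const

theorem hasDerivAt_dfst (h : ContDiffOn ℝ 1 χ (Ioo 0 R ×ˢ univ)) {r : ℝ} (hr : r ∈ Ioo 0 R)
    (φ : ℝ) : HasDerivAt (fun s => χ (s, φ)) (dfst χ (r, φ)) r := by
  have hd := ((h.differentiableOn one_ne_zero).differentiableAt
    ((isOpen_Ioo_prod_univ R).mem_nhds (x := (r, φ)) ⟨hr, mem_univ _⟩)).hasFDerivAt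
  exact hd.comp_hasDerivAt r ((hasDerivAt_id r).prodMk (hasDerivAt_const r φ))

theorem hasDerivAt_dsnd (h : ContDiffOn ℝ 1 χ (Ioo 0 R ×ˢ univ)) {r : ℝ} (hr : r ∈ Ioo 0 R)
    (φ : ℝ) : HasDerivAt (fun t => χ (r, t)) (dsnd χ (r, φ)) φ := by
  have hd := ((h.differentiableOn one_ne_zero).differentiableAt
    ((isOpen_Ioo_prod_univ R).mem_nhds (x := (r, φ)) ⟨hr, mem_univ _⟩)).hasFDerivAt
  exact hd.comp_hasDerivAt φ ((hasDerivAt_const φ r).prodMk (hasDerivAt_id φ))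

theorem continuous_slice {S : Set ℝ} (h : ContinuousOn χ (S ×ˢ univ)) {r : ℝ} (hr : r ∈ S) :
    Continuous fun φ => χ (r, φ) :=
  h.comp_continuous (by fun_prop) fun _ => ⟨hr, mem_univ _⟩

/-- The half-open interval is needed for continuity up to the wall; in both cases S is locally
compact, as the parametric integral requires. -/
theorem continuousOn_angularComponent {a : ℝ} {S : Set ℝ} (hS : S = Ioo 0 a ∨ S = Ioc 0 a)
    (h : ContinuousOn χ (S ×ˢ univ)) (m : ℤ) : ContinuousOn (angularComponent χ m) S := by
  have hlc : LocallyCompactSpace S := by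
    rcases hS with rfl | rfl
    · exact isOpen_Ioo.locallyCompactSpace
    · exact (isLocallyClosed_Ioc).locallyCompactSpace
  rw [continuousOn_iff_continuous_domRestrict]
  refine continuous_const.mul (intervalIntegral.continuous_parametric_intervalIntegral_of_continuous'
    (f := fun (r : S) φ => χ (r, φ) * Complex.exp (-(Complex.I * m * φ))) ?_ 0 (2 * π))
  refine Continuous.mul ?_ (by fun_prop)
  exact h.comp_continuous (f := fun p : S × ℝ => ((p.1 : ℝ), p.2)) (by fun_prop)
    fun p => ⟨p.1.2, mem_univ _⟩

/-- Differentiation under the integral, with the radial derivative bounded on a compact [c, d] × [0,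
2π] around r. -/
theorem hasDerivAt_angularComponent (h : ContDiffOn ℝ 1 χ (Ioo 0 R ×ˢ univ)) (m : ℤ) {r : ℝ}
    (hr : r ∈ Ioo 0 R) :
    HasDerivAt (angularComponent χ m) (angularComponent (dfst χ) m r) r := by
  obtain ⟨c, hc0, hcr⟩ := exists_between hr.1
  obtain ⟨d, hrd, hdR⟩ := exists_between hr.2
  have hsub : Icc c d ⊆ Ioo 0 R := fun s hs => ⟨hc0.trans_le hs.1, hs.2.trans_lt hdR⟩
  have hd : ContinuousOn (dfst χ) (Ioo 0 R ×ˢ univ) :=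
    (contDiffOn_dfst (n := 0) (by simpa using h)).continuousOn
  obtain ⟨B, hB⟩ := ((isCompact_Icc (a := c) (b := d)).prod
    (isCompact_Icc (a := (0 : ℝ)) (b := 2 * π))).exists_bound_of_continuousOn
      (hd.mono (prod_mono hsub (subset_univ _)))
  have hcont : ∀ s ∈ Ioo 0 R, Continuous fun φ : ℝ => χ (s, φ) * Complex.exp (-(Complex.I * m * φ)) :=
    fun s hs => (continuous_slice h.continuousOn hs).mul (by fun_prop)
  have hcont' : Continuous fun φ : ℝ => dfst χ (r, φ) * Complex.exp (-(Complex.I * m * φ)) :=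
    (continuous_slice hd hr).mul (by fun_prop)
  refine (intervalIntegral.hasDerivAt_integral_of_dominated_loc_of_deriv_le
    (F := fun s (φ : ℝ) => χ (s, φ) * Complex.exp (-(Complex.I * m * φ)))
    (F' := fun s (φ : ℝ) => dfst χ (s, φ) * Complex.exp (-(Complex.I * m * φ)))
    (bound := fun _ => B) (Ioo_mem_nhds hcr hrd) ?_ ((hcont r hr).intervalIntegrable _ _)
    hcont'.aestronglyMeasurable ?_ intervalIntegrable_const ?_).2.const_mul _
  · filter_upwards [isOpen_Ioo.mem_nhds hr] with s hs using (hcont s hs).aestronglyMeasurable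
  · refine MeasureTheory.ae_of_all _ fun φ hφ s hs => ?_
    rw [uIoc_of_le Real.two_pi_pos.le] at hφ
    rw [norm_mul, show -(Complex.I * m * φ) = ((-(m * φ) : ℝ) : ℂ) * Complex.I by push_cast; ring,
      Complex.norm_exp_ofReal_mul_I, mul_one]
    exact hB (s, φ) ⟨Ioo_subset_Icc_self hs, Ioc_subset_Icc_self hφ⟩
  · exact MeasureTheory.ae_of_all _ fun φ _ s hs =>
      (hasDerivAt_dfst h (hsub (Ioo_subset_Icc_self hs)) φ).mul_const _

theorem contDiffOn_angularComponent (h : ContDiffOn ℝ 2 χ (Ioo 0 R ×ˢ univ)) (m : ℤ) :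
    ContDiffOn ℝ 2 (angularComponent χ m) (Ioo 0 R) := by
  have key : ∀ {χ : ℝ × ℝ → ℂ} {n : WithTop ℕ∞}, n ≠ ⊤ → ContDiffOn ℝ 1 χ (Ioo 0 R ×ˢ univ) →
      ContDiffOn ℝ n (angularComponent (dfst χ) m) (Ioo 0 R) →
      ContDiffOn ℝ (n + 1) (angularComponent χ m) (Ioo 0 R) := by
    intro χ n hn hχ hd
    rw [contDiffOn_succ_iff_deriv_of_isOpen isOpen_Ioo]
    exact ⟨fun r hr => (hasDerivAt_angularComponent hχ m hr).differentiableAt.differentiableWithinAt,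
      fun hω => absurd hω hn, hd.congr fun r hr => (hasDerivAt_angularComponent hχ m hr).deriv⟩
  have h2 : (2 : WithTop ℕ∞) = 1 + 1 := by norm_num
  have h1 : (1 : WithTop ℕ∞) = 0 + 1 := by norm_num
  have hd := contDiffOn_dfst (n := 1) (h2 ▸ h)
  rw [h2]
  refine key (by simp) (h.of_le (by norm_num)) ?_
  rw [h1]
  refine key (by simp) hd (contDiffOn_zero.2 ?_)
  exact continuousOn_angularComponent (Or.inl rfl) (contDiffOn_dfst (n := 0) (h1 ▸ hd)).continuousOn m

theorem IsPlanarFactor.dsnd_periodic (h : IsPlanarFactor R χ) {r : ℝ} (hr : r ∈ Ioo 0 R) (φ : ℝ) :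
    dsnd χ (r, φ + 2 * π) = dsnd χ (r, φ) := by
  have h1 := h.1.of_le (m := 1) (by norm_num)
  have h2 := (hasDerivAt_dsnd h1 hr (φ + 2 * π)).comp_add_const φ (2 * π)
  simp only [h.2] at h2
  exact h2.unique (hasDerivAt_dsnd h1 hr φ)

theorem IsPlanarFactor.dsnd_dsnd_periodic (h : IsPlanarFactor R χ) {r : ℝ} (hr : r ∈ Ioo 0 R)
    (φ : ℝ) : dsnd (dsnd χ) (r, φ + 2 * π) = dsnd (dsnd χ) (r, φ) := by
  have h1 := contDiffOn_dsnd (n := 1) (χ := χ) (R := R) (by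
    rw [show (1 : WithTop ℕ∞) + 1 = 2 by norm_num]; exact h.1)
  have h2 := (hasDerivAt_dsnd h1 hr (φ + 2 * π)).comp_add_const φ (2 * π)
  simp only [h.dsnd_periodic hr] at h2
  exact h2.unique (hasDerivAt_dsnd h1 hr φ)

end Planar

/-- The operator that the Schrödinger equation induces on the planar factor `χ(r, φ)`, with
`w = 2ME/ħ²`. -/
noncomputable def planarOp (α γ R k : ℝ) (w : ℂ) (χ : ℝ × ℝ → ℂ) (r φ : ℝ) : ℂ :=
  ((R ^ (2 * γ - 2) / r ^ (2 * γ - 1) : ℝ) : ℂ) *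
      (dfst χ (r, φ) + r * dfst (dfst χ) (r, φ)) +
    (w - ((k ^ 2 : ℝ) : ℂ)) * χ (r, φ) +
    ((γ ^ 2 / α ^ 2 * (R ^ (2 * γ - 2) / r ^ (2 * γ)) : ℝ) : ℂ) * dsnd (dsnd χ) (r, φ)

namespace IsPlanarFactor

variable {α γ R : ℝ} {χ : ℝ × ℝ → ℂ}

theorem contDiffOn_two (h : IsPlanarFactor R χ) : ContDiffOn ℝ (1 + 1) χ (Ioo 0 R ×ˢ univ) := by
  rw [show (1 : WithTop ℕ∞) + 1 = 2 by norm_num]; exact h.1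

theorem contDiffOn_one (h : IsPlanarFactor R χ) : ContDiffOn ℝ 1 χ (Ioo 0 R ×ˢ univ) :=
  h.1.of_le (by norm_num)

theorem continuousOn_dfst_dfst (h : IsPlanarFactor R χ) :
    ContinuousOn (dfst (dfst χ)) (Ioo 0 R ×ˢ univ) :=
  (contDiffOn_dfst (n := 0) (by simpa using contDiffOn_dfst h.contDiffOn_two)).continuousOn

theorem continuousOn_dsnd_dsnd (h : IsPlanarFactor R χ) :
    ContinuousOn (dsnd (dsnd χ)) (Ioo 0 R ×ˢ univ) :=
  (contDiffOn_dsnd (n := 0) (by simpa using contDiffOn_dsnd h.contDiffOn_two)).continuousOn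

theorem slice_zero (h : IsPlanarFactor R χ) (r : ℝ) : χ (r, 2 * π) = χ (r, 0) := by
  simpa using h.2 r 0

theorem dsnd_slice_zero (h : IsPlanarFactor R χ) {r : ℝ} (hr : r ∈ Ioo 0 R) :
    dsnd χ (r, 2 * π) = dsnd χ (r, 0) := by
  simpa using h.dsnd_periodic hr 0

theorem hasSum_angularComponent (h : IsPlanarFactor R χ) {r : ℝ} (hr : r ∈ Ioo 0 R) (φ : ℝ) :
    HasSum (fun m : ℤ => angularComponent χ m r * Complex.exp (Complex.I * m * φ)) (χ (r, φ)) :=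
  hasSum_circleCoeff (u := fun φ => χ (r, φ)) (continuous_slice h.1.continuousOn hr) (h.2 r)
    (summable_circleCoeff (fun φ => hasDerivAt_dsnd h.contDiffOn_one hr φ)
      (fun φ => hasDerivAt_dsnd (contDiffOn_dsnd h.contDiffOn_two) hr φ)
      (continuous_slice h.continuousOn_dsnd_dsnd hr) (h.slice_zero r) (h.dsnd_slice_zero hr)) φ

theorem deriv_mul_deriv_angularComponent (h : IsPlanarFactor R χ) (m : ℤ) {r : ℝ}
    (hr : r ∈ Ioo 0 R) : deriv (fun s : ℝ => (s : ℂ) * deriv (angularComponent χ m) s) r =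
      angularComponent (dfst χ) m r + r * angularComponent (dfst (dfst χ)) m r := by
  have e : (fun s : ℝ => (s : ℂ) * deriv (angularComponent χ m) s) =ᶠ[𝓝 r]
      fun s : ℝ => (s : ℂ) * angularComponent (dfst χ) m s := by
    filter_upwards [isOpen_Ioo.mem_nhds hr] with s hs
    rw [(hasDerivAt_angularComponent h.contDiffOn_one m hs).deriv]
  have hid : HasDerivAt (fun s : ℝ => (s : ℂ)) 1 r := Complex.ofRealCLM.hasDerivAt
  have hmul := hid.mul (hasDerivAt_angularComponent (contDiffOn_dfst h.contDiffOn_two) m hr)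
  exact e.deriv_eq.trans (hmul.deriv.trans (by rw [one_mul]))

theorem circleCoeff_planarOp (h : IsPlanarFactor R χ) (k : ℝ) (w : ℂ) (m : ℤ) {r : ℝ}
    (hr : r ∈ Ioo 0 R) : circleCoeff (planarOp α γ R k w χ r) m =
      ((R ^ (2 * γ - 2) / r ^ (2 * γ - 1) : ℝ) : ℂ) *
          deriv (fun s : ℝ => (s : ℂ) * deriv (angularComponent χ m) s) r +
        (w - ((γ ^ 2 / α ^ 2 * (R ^ (2 * γ - 2) / r ^ (2 * γ)) * (m : ℝ) ^ 2 + k ^ 2 : ℝ) : ℂ)) *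
          angularComponent χ m r := by
  have c0 := continuous_slice h.1.continuousOn hr
  have c1 := continuous_slice (contDiffOn_dfst h.contDiffOn_two).continuousOn hr
  have c2 := continuous_slice h.continuousOn_dfst_dfst hr
  have c3 := continuous_slice h.continuousOn_dsnd_dsnd hr
  have hdd := circleCoeff_deriv_deriv (fun φ => hasDerivAt_dsnd h.contDiffOn_one hr φ)
    (fun φ => hasDerivAt_dsnd (contDiffOn_dsnd h.contDiffOn_two) hr φ) c3 (h.slice_zero r)
    (h.dsnd_slice_zero hr) m
  rw [h.deriv_mul_deriv_angularComponent m hr]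
  have d1 : Continuous fun φ => dfst χ (r, φ) + r * dfst (dfst χ) (r, φ) :=
    c1.add (continuous_const.mul c2)
  have d2 : Continuous fun φ => ((R ^ (2 * γ - 2) / r ^ (2 * γ - 1) : ℝ) : ℂ) *
      (dfst χ (r, φ) + r * dfst (dfst χ) (r, φ)) := continuous_const.mul d1
  have d3 : Continuous fun φ => (w - ((k ^ 2 : ℝ) : ℂ)) * χ (r, φ) := continuous_const.mul c0
  have d4 : Continuous fun φ => ((γ ^ 2 / α ^ 2 * (R ^ (2 * γ - 2) / r ^ (2 * γ)) : ℝ) : ℂ) *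
      dsnd (dsnd χ) (r, φ) := continuous_const.mul c3
  have d5 : Continuous fun φ => (r : ℂ) * dfst (dfst χ) (r, φ) := continuous_const.mul c2
  have d23 : Continuous fun φ => ((R ^ (2 * γ - 2) / r ^ (2 * γ - 1) : ℝ) : ℂ) *
      (dfst χ (r, φ) + r * dfst (dfst χ) (r, φ)) + (w - ((k ^ 2 : ℝ) : ℂ)) * χ (r, φ) := d2.add d3
  unfold planarOp
  rw [circleCoeff_add d23 d4, circleCoeff_add d2 d3,
    circleCoeff_const_mul, circleCoeff_const_mul, circleCoeff_const_mul,
    circleCoeff_add c1 d5, circleCoeff_const_mul, hdd]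
  simp only [← angularComponent_eq_circleCoeff]
  push_cast
  ring

theorem continuous_planarOp (h : IsPlanarFactor R χ) (k : ℝ) (w : ℂ) {r : ℝ} (hr : r ∈ Ioo 0 R) :
    Continuous (planarOp α γ R k w χ r) := by
  have c0 := continuous_slice h.1.continuousOn hr
  have c1 := continuous_slice (contDiffOn_dfst h.contDiffOn_two).continuousOn hr
  have c2 := continuous_slice h.continuousOn_dfst_dfst hr
  have c3 := continuous_slice h.continuousOn_dsnd_dsnd hr
  exact ((continuous_const.mul (c1.add (continuous_const.mul c2))).add
    (continuous_const.mul c0)).add (continuous_const.mul c3)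

theorem dfst_periodic (h : IsPlanarFactor R χ) {r : ℝ} (hr : r ∈ Ioo 0 R) (φ : ℝ) :
    dfst χ (r, φ + 2 * π) = dfst χ (r, φ) := by
  have h1 := hasDerivAt_dfst h.contDiffOn_one hr (φ + 2 * π)
  simp only [h.2] at h1
  exact h1.unique (hasDerivAt_dfst h.contDiffOn_one hr φ)

theorem planarOp_periodic (h : IsPlanarFactor R χ) (k : ℝ) (w : ℂ) {r : ℝ} (hr : r ∈ Ioo 0 R) :
    Function.Periodic (planarOp α γ R k w χ r) (2 * π) := fun φ => by
  have hd := contDiffOn_dfst h.contDiffOn_two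
  have h2 : dfst (dfst χ) (r, φ + 2 * π) = dfst (dfst χ) (r, φ) := by
    refine (hasDerivAt_dfst hd hr (φ + 2 * π)).unique
      ((hasDerivAt_dfst hd hr φ).congr_of_eventuallyEq ?_)
    filter_upwards [isOpen_Ioo.mem_nhds hr] with s hs using h.dfst_periodic hs φ
  rw [planarOp, planarOp, h.dfst_periodic hr, h2, h.2, h.dsnd_dsnd_periodic hr]

/-- The radial expressions are the Fourier coefficients of `planarOp`, which is continuous and
periodic in φ, so they all vanish exactly when it does. -/
theorem forall_solvesRadial_iff (h : IsPlanarFactor R χ) (ħ M k : ℝ) (E : ℂ) :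
    (∀ m : ℤ, SolvesRadial α γ R ħ M k m E (angularComponent χ m)) ↔
      ∀ r ∈ Ioo 0 R, ∀ φ, planarOp α γ R k (((2 * M / ħ ^ 2 : ℝ) : ℂ) * E) χ r φ = 0 := by
  constructor
  · intro hs r hr
    refine eq_zero_of_circleCoeff_eq_zero (h.continuous_planarOp k _ hr)
      (h.planarOp_periodic k _ hr) fun m => ?_
    rw [h.circleCoeff_planarOp k _ m hr]
    exact (hs m).2 r hr
  · intro hz m
    refine ⟨contDiffOn_angularComponent h.1 m, fun r hr => ?_⟩
    rw [← h.circleCoeff_planarOp k _ m hr, circleCoeff]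
    simp only [hz r hr]
    simp

end IsPlanarFactor

/-! ### The Laplace–Beltrami operator and separation of variables. -/

theorem sqrt_det_metric_mul_inv {α γ R : ℝ} (hα : 0 < α) (hγ : 0 < γ) (hR : 0 < R) {y : Fin 3 → ℝ}
    (hy : 0 < y 0) :
    √(metric α γ R y).det = α * y 0 / γ * (y 0 / R) ^ (2 * γ - 2) ∧
    ∀ μ ν, √(metric α γ R y).det * (metric α γ R y)⁻¹ μ ν =
      Matrix.diagonal ![α * y 0 / γ, γ / (α * y 0), α * y 0 / γ * (y 0 / R) ^ (2 * γ - 2)] μ ν := by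
  have he : 0 < (y 0 / R) ^ (2 * γ - 2) := Real.rpow_pos_of_pos (div_pos hy hR) _
  set e := (y 0 / R) ^ (2 * γ - 2) with he'
  have hdet : √(metric α γ R y).det = α * y 0 / γ * e := by
    rw [metric, Matrix.det_diagonal, Fin.prod_univ_three, ← he', Real.sqrt_eq_iff_mul_self_eq
      (by simp; positivity) (by positivity)]
    simp
    field_simp
  refine ⟨hdet, fun μ ν => ?_⟩
  have hinv : (metric α γ R y)⁻¹ = Matrix.diagonal ![e⁻¹, (e * (α ^ 2 * y 0 ^ 2 / γ ^ 2))⁻¹, 1] := by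
    refine Matrix.inv_eq_right_inv ?_
    rw [metric, Matrix.diagonal_mul_diagonal, ← he', ← Matrix.diagonal_one]
    congr 1
    ext i
    fin_cases i
    · simp [he.ne']
    · have : e * (α ^ 2 * y 0 ^ 2 / γ ^ 2) ≠ 0 := by positivity
      simpa using mul_inv_cancel₀ this
    · simp
  rw [hdet, hinv]
  fin_cases μ <;> fin_cases ν <;> simp [Matrix.diagonal] <;> field_simp

section Laplacian

variable {R : ℝ} {χ : ℝ × ℝ → ℂ} {Z Z' : ℝ → ℂ}

theorem pderiv_zero_waveFunction (h : IsPlanarFactor R χ) {y : Fin 3 → ℝ} (hy : y 0 ∈ Ioo 0 R) :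
    pderiv 0 (waveFunction Z χ) y = Z (y 2) * dfst χ (y 0, y 1) := by
  simp only [pderiv, waveFunction, Function.update_self, Function.update_of_ne, ne_eq, Fin.reduceEq,
    not_false_eq_true]
  exact ((hasDerivAt_dfst h.contDiffOn_one hy (y 1)).const_mul _).deriv

theorem pderiv_one_waveFunction (h : IsPlanarFactor R χ) {y : Fin 3 → ℝ} (hy : y 0 ∈ Ioo 0 R) :
    pderiv 1 (waveFunction Z χ) y = Z (y 2) * dsnd χ (y 0, y 1) := by
  simp only [pderiv, waveFunction, Function.update_self, Function.update_of_ne, ne_eq, Fin.reduceEq,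
    not_false_eq_true]
  exact ((hasDerivAt_dsnd h.contDiffOn_one hy (y 1)).const_mul _).deriv

theorem pderiv_two_waveFunction (hZ : ∀ z, HasDerivAt Z (Z' z) z) (χ : ℝ × ℝ → ℂ)
    (y : Fin 3 → ℝ) : pderiv 2 (waveFunction Z χ) y = Z' (y 2) * χ (y 0, y 1) := by
  simp only [pderiv, waveFunction, Function.update_self, Function.update_of_ne, ne_eq, Fin.reduceEq,
    not_false_eq_true]
  exact ((hZ (y 2)).mul_const _).deriv

/-- The conformal factor drops out of √g g^{rr} = αr/γ and √g g^{φφ} = γ/(αr), and returns only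
through 1/√g and the z-term, where Z'' = -k² Z gives -k². -/
theorem laplaceBeltrami_waveFunction {α γ k : ℝ} (hα : 0 < α) (hγ : 0 < γ) (hR : 0 < R)
    (h : IsPlanarFactor R χ) (hZ : ∀ z, HasDerivAt Z (Z' z) z)
    (hZ' : ∀ z, HasDerivAt Z' (-((k ^ 2 : ℝ) : ℂ) * Z z) z) {x : Fin 3 → ℝ} (hx : x 0 ∈ Ioo 0 R) :
    laplaceBeltrami (metric α γ R) (waveFunction Z χ) x =
      Z (x 2) * planarOp α γ R k 0 χ (x 0) (x 1) := by
  have hx0 := hx.1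
  have hsum : ∀ μ, ∀ y : Fin 3 → ℝ, 0 < y 0 →
      ∑ ν, ((√(metric α γ R y).det * (metric α γ R y)⁻¹ μ ν : ℝ) : ℂ) *
        pderiv ν (waveFunction Z χ) y =
      ((![α * y 0 / γ, γ / (α * y 0), α * y 0 / γ * (y 0 / R) ^ (2 * γ - 2)] μ : ℝ) : ℂ) *
        pderiv μ (waveFunction Z χ) y := by
    intro μ y hy
    rw [Finset.sum_eq_single μ]
    · rw [(sqrt_det_metric_mul_inv hα hγ hR hy).2, Matrix.diagonal_apply_eq]
    · intro ν _ hν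
      rw [(sqrt_det_metric_mul_inv hα hγ hR hy).2, Matrix.diagonal_apply_ne _ hν.symm]
      simp
    · simp
  have hid : HasDerivAt (fun s : ℝ => (s : ℂ)) 1 (x 0) := Complex.ofRealCLM.hasDerivAt
  have h0 : pderiv 0 (fun y => ∑ ν, ((√(metric α γ R y).det * (metric α γ R y)⁻¹ 0 ν : ℝ) : ℂ) *
      pderiv ν (waveFunction Z χ) y) x =
      (α / γ : ℝ) * Z (x 2) * (dfst χ (x 0, x 1) + x 0 * dfst (dfst χ) (x 0, x 1)) := by
    rw [pderiv]
    -- Varying r may leave (0, R), so this equality holds only near `x 0`; varying φ or z keeps r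
    -- fixed, and there the corresponding equality holds everywhere.
    have e : (fun t : ℝ => (fun y => ∑ ν, ((√(metric α γ R y).det *
        (metric α γ R y)⁻¹ 0 ν : ℝ) : ℂ) * pderiv ν (waveFunction Z χ) y)
        (Function.update x 0 t)) =ᶠ[𝓝 (x 0)]
        fun t : ℝ => ((α / γ : ℝ) * Z (x 2)) * ((t : ℂ) * dfst χ (t, x 1)) := by
      filter_upwards [isOpen_Ioo.mem_nhds hx] with t ht
      have ht' : Function.update x 0 t 0 ∈ Ioo 0 R := by simpa using ht
      rw [hsum 0 _ ht'.1, pderiv_zero_waveFunction h ht']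
      simp
      ring
    have hmul := (hid.mul (hasDerivAt_dfst (contDiffOn_dfst h.contDiffOn_two) hx
      (x 1))).const_mul ((α / γ : ℝ) * Z (x 2))
    exact e.deriv_eq.trans (hmul.deriv.trans (by rw [one_mul]))
  have h1 : pderiv 1 (fun y => ∑ ν, ((√(metric α γ R y).det * (metric α γ R y)⁻¹ 1 ν : ℝ) : ℂ) *
      pderiv ν (waveFunction Z χ) y) x =
      (γ / (α * x 0) : ℝ) * Z (x 2) * dsnd (dsnd χ) (x 0, x 1) := by
    rw [pderiv]
    have e : (fun t : ℝ => (fun y => ∑ ν, ((√(metric α γ R y).det *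
        (metric α γ R y)⁻¹ 1 ν : ℝ) : ℂ) * pderiv ν (waveFunction Z χ) y)
        (Function.update x 1 t)) =
        fun t : ℝ => ((γ / (α * x 0) : ℝ) * Z (x 2)) * dsnd χ (x 0, t) := by
      ext t
      have ht' : Function.update x 1 t 0 ∈ Ioo 0 R := by simpa using hx
      refine (hsum 1 _ ht'.1).trans ?_
      rw [pderiv_one_waveFunction h ht']
      simp
      ring
    rw [e, ((hasDerivAt_dsnd (contDiffOn_dsnd h.contDiffOn_two) hx (x 1)).const_mul _).deriv]
  have h2 : pderiv 2 (fun y => ∑ ν, ((√(metric α γ R y).det * (metric α γ R y)⁻¹ 2 ν : ℝ) : ℂ) *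
      pderiv ν (waveFunction Z χ) y) x =
      ((α * x 0 / γ * (x 0 / R) ^ (2 * γ - 2) : ℝ) : ℂ) *
        ((-((k ^ 2 : ℝ) : ℂ) * Z (x 2)) * χ (x 0, x 1)) := by
    rw [pderiv]
    have e : (fun t : ℝ => (fun y => ∑ ν, ((√(metric α γ R y).det *
        (metric α γ R y)⁻¹ 2 ν : ℝ) : ℂ) * pderiv ν (waveFunction Z χ) y)
        (Function.update x 2 t)) =
        fun t : ℝ => ((α * x 0 / γ * (x 0 / R) ^ (2 * γ - 2) : ℝ) : ℂ) *
          (Z' t * χ (x 0, x 1)) := by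
      ext t
      have ht' : 0 < Function.update x 2 t 0 := by simpa using hx0
      refine (hsum 2 _ ht').trans ?_
      rw [pderiv_two_waveFunction hZ]
      simp
    rw [e, (((hZ' (x 2)).mul_const _).const_mul _).deriv]
  rw [laplaceBeltrami, Fin.sum_univ_three, h0, h1, h2, (sqrt_det_metric_mul_inv hα hγ hR hx0).1,
    planarOp]
  have q1 : (x 0 / R) ^ (2 * γ - 2) = x 0 ^ (2 * γ) / x 0 ^ 2 / R ^ (2 * γ - 2) := by
    rw [Real.div_rpow hx0.le hR.le, Real.rpow_sub hx0, Real.rpow_two]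
  rw [q1, Real.rpow_sub_one hx0.ne']
  have hA := (Real.rpow_pos_of_pos hR (2 * γ - 2)).ne'
  have hB := (Real.rpow_pos_of_pos hx0 (2 * γ)).ne'
  set A := R ^ (2 * γ - 2)
  set B := x 0 ^ (2 * γ)
  have hAc : (A : ℂ) ≠ 0 := by exact_mod_cast hA
  have hBc : (B : ℂ) ≠ 0 := by exact_mod_cast hB
  have hαc : (α : ℂ) ≠ 0 := by exact_mod_cast hα.ne'
  have hγc : (γ : ℂ) ≠ 0 := by exact_mod_cast hγ.ne'
  have hxc : (x 0 : ℂ) ≠ 0 := by exact_mod_cast hx0.ne'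
  push_cast
  field_simp
  ring

end Laplacian

/-- Separation uses only these properties of Z: Z'' = -k² Z, and Z does not vanish identically on I.
-/
theorem IsAxialFactor.exists_deriv {k : ℝ} {I : Set ℝ} {Z : ℝ → ℂ} (h : IsAxialFactor k I Z) :
    (∃ Z' : ℝ → ℂ, (∀ z, HasDerivAt Z (Z' z) z) ∧
      ∀ z, HasDerivAt Z' (-((k ^ 2 : ℝ) : ℂ) * Z z) z) ∧ ∃ z ∈ I, Z z ≠ 0 := by
  rcases h with ⟨rfl, rfl⟩ | ⟨z₀, l, hz₀, hl, hk, rfl, rfl⟩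
  · have he : ∀ z : ℝ, HasDerivAt (fun z : ℝ => Complex.exp (Complex.I * k * z))
        (Complex.exp (Complex.I * k * z) * (Complex.I * k)) z := fun z => by
      have h : HasDerivAt (fun z : ℝ => (z : ℂ)) 1 z := Complex.ofRealCLM.hasDerivAt
      simpa using (h.const_mul (Complex.I * k)).cexp
    refine ⟨⟨fun z => ((1 / √(2 * π) : ℝ) : ℂ) * (Complex.exp (Complex.I * k * z) * (Complex.I * k)),
      fun z => (he z).const_mul _, fun z => ?_⟩, 0, mem_univ _, ?_⟩
    · refine (((he z).mul_const _).const_mul _).congr_deriv ?_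
      push_cast
      linear_combination (1 / (√(2 * π) : ℂ) * Complex.exp (Complex.I * k * z) * k ^ 2) *
        Complex.I_sq
    · have : √(2 * π) ≠ 0 := by positivity
      simpa using this
  · have hk0 : 0 < k := by
      rw [hk]
      have : (0 : ℝ) < l := by exact_mod_cast hl
      positivity
    have hlin : ∀ z : ℝ, HasDerivAt (fun z : ℝ => k * z) k z := fun z => by
      simpa using (hasDerivAt_id z).const_mul k
    refine ⟨⟨fun z => ((√(2 / z₀) * (Real.cos (k * z) * k) : ℝ) : ℂ),
      -- At this point k z = π/2 and the sine equals 1; l ≥ 1 keeps the point inside (0, z₀).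
      fun z => (((hlin z).sin).const_mul _).ofReal_comp, fun z => ?_⟩, z₀ / (2 * l), ?_, ?_⟩
    · refine (((((hlin z).cos).mul_const k).const_mul _).ofReal_comp).congr_deriv ?_
      push_cast; ring
    · have : (1 : ℝ) ≤ l := by exact_mod_cast hl
      refine ⟨by positivity, ?_⟩
      rw [div_lt_iff₀ (by positivity)]
      nlinarith
    · have hl0 : (l : ℝ) ≠ 0 := by
        have : (1 : ℝ) ≤ l := by exact_mod_cast hl
        positivity
      have : k * (z₀ / (2 * l)) = π / 2 := by
        rw [hk]; field_simp
      have hs : √(2 / z₀) ≠ 0 := by positivity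
      show ((√(2 / z₀) * Real.sin (k * (z₀ / (2 * l))) : ℝ) : ℂ) ≠ 0
      rw [this, Real.sin_pi_div_two]
      simpa using hs

theorem solvesSchrodinger_iff {α γ R ħ M k : ℝ} (hα : 0 < α) (hγ : 0 < γ) (hR : 0 < R)
    (hħ : 0 < ħ) (hM : M ≠ 0) {I : Set ℝ} {Z : ℝ → ℂ} (hZ : IsAxialFactor k I Z) (E : ℂ)
    {χ : ℝ × ℝ → ℂ} (h : IsPlanarFactor R χ) :
    SolvesSchrodinger α γ R ħ M I E (waveFunction Z χ) ↔
      ∀ m : ℤ, SolvesRadial α γ R ħ M k m E (angularComponent χ m) := by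
  obtain ⟨⟨Z', hZ1, hZ2⟩, z, hz, hz0⟩ := hZ.exists_deriv
  rw [h.forall_solvesRadial_iff]
  have hħc : (ħ : ℂ) ≠ 0 := by exact_mod_cast hħ.ne'
  have hMc : (M : ℂ) ≠ 0 := by exact_mod_cast hM
  have key : ∀ x : Fin 3 → ℝ, x 0 ∈ Ioo 0 R →
      (-((ħ ^ 2 / (2 * M) : ℝ) : ℂ) * laplaceBeltrami (metric α γ R) (waveFunction Z χ) x =
        E * waveFunction Z χ x ↔
      Z (x 2) * planarOp α γ R k (((2 * M / ħ ^ 2 : ℝ) : ℂ) * E) χ (x 0) (x 1) = 0) := by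
    intro x hx
    rw [laplaceBeltrami_waveFunction hα hγ hR h hZ1 hZ2 hx, waveFunction]
    have e : planarOp α γ R k (((2 * M / ħ ^ 2 : ℝ) : ℂ) * E) χ (x 0) (x 1) =
        planarOp α γ R k 0 χ (x 0) (x 1) + ((2 * M / ħ ^ 2 : ℝ) : ℂ) * E * χ (x 0, x 1) := by
      simp only [planarOp]; ring
    rw [e]
    set Q := planarOp α γ R k 0 χ (x 0) (x 1)
    push_cast
    constructor
    · intro h1
      have : Z (x 2) * (Q + 2 * M / (ħ : ℂ) ^ 2 * E * χ (x 0, x 1)) =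
          2 * M / (ħ : ℂ) ^ 2 * (E * (Z (x 2) * χ (x 0, x 1)) -
            -((ħ : ℂ) ^ 2 / (2 * M)) * (Z (x 2) * Q)) := by
        field_simp
        ring
      rw [this, h1, sub_self, mul_zero]
    · intro h1
      have : -((ħ : ℂ) ^ 2 / (2 * M)) * (Z (x 2) * Q) = E * (Z (x 2) * χ (x 0, x 1)) -
          (ħ : ℂ) ^ 2 / (2 * M) * (Z (x 2) * (Q + 2 * M / (ħ : ℂ) ^ 2 * E * χ (x 0, x 1))) := by
        field_simp
        ring
      rw [this, h1, mul_zero, sub_zero]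
  constructor
  · intro hs r hr φ
    have := (key ![r, φ, z] (by simpa using hr)).1 (hs _ (by simpa using hr) (by simpa using hz))
    simpa [hz0] using this
  · intro hs x hx _
    exact (key x hx).2 (by rw [hs _ hx, mul_zero])

/-! ### The roots, the spectrum and the bound states. -/

theorem gam_pos {θ : ℝ} (hθ : -1 < θ) (σ : ℝ) : 0 < gam θ σ := by
  set b := σ / (2 * (1 - σ)) with hb
  -- The radicand exceeds (θ b)² by 1 + θ > 0.
  have h : |θ * b| < √(θ ^ 2 * b ^ 2 + 1 + θ) := by
    rw [← Real.sqrt_sq_eq_abs]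
    exact Real.sqrt_lt_sqrt (sq_nonneg _) (by linarith [mul_pow θ b 2])
  have := le_abs_self (θ * b)
  rw [gam, ← hb]
  linarith

/-- The zeros are indexed from 0 and the roots from 1. The value at n = 0 repeats the first root,
which is harmless because only n ≥ 1 counts. -/
theorem IsZeroSeq.enumeratesRoots {ν a : ℝ} {z : ℕ → ℝ} (h : IsZeroSeq ν z) (ha : 0 < a) :
    EnumeratesRoots ν a fun n => z (n - 1) / a := by
  constructor
  · intro i hi j hj hij
    rw [mem_Ici] at hi hj
    exact div_lt_div_of_pos_right (h.1 (by omega)) ha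
  · ext b
    constructor
    · rintro ⟨n, -, rfl⟩
      refine ⟨div_pos (h.pos _) ha, ?_⟩
      change besselJ ν ((z (n - 1) / a * a : ℝ) : ℂ) = 0
      rw [div_mul_cancel₀ _ ha.ne', besselJ_eq_zero_iff_besselG (h.pos _)]
      exact h.zero _
    · rintro ⟨hb, h0⟩
      have hba : 0 < b * a := mul_pos hb ha
      obtain ⟨n, hn⟩ := h.exists_eq hba ((besselJ_eq_zero_iff_besselG hba).1 h0)
      exact ⟨n + 1, by simp, by simp [hn, ha.ne']⟩

/-- The positive roots of `J_ν(β R / γ) = 0` exist as an enumeration with McMahon asymptotics. -/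
theorem exists_enumeratesRoots {α γ R ν : ℝ} (hγ : 0 < γ) (hR : 0 < R) {q : ℝ} (hq : 0 ≤ q)
    (hα : 0 < α) (hν : ν = q / α) : ∃ β : ℕ → ℝ, EnumeratesRoots ν (R / γ) β ∧
      Tendsto (fun n : ℕ => β n - γ * π / R * (n + q / (2 * α) - 1 / 4)) atTop (𝓝 0) := by
  have hν0 : 0 ≤ ν := hν ▸ div_nonneg hq hα.le
  obtain ⟨z, hz⟩ := exists_isZeroSeq hν0
  refine ⟨fun n => z (n - 1) / (R / γ), hz.enumeratesRoots (div_pos hR hγ), ?_⟩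
  -- The shift by one undoes the truncated subtraction in the index.
  rw [← tendsto_add_atTop_iff_nat 1]
  have := (hz.tendsto_sub hν0).const_mul (γ / R)
  rw [mul_zero] at this
  refine this.congr fun n => ?_
  simp only [hν, Nat.add_sub_cancel]
  push_cast
  field_simp
  ring

theorem setOf_isRadialBoundState_eq {α γ R ħ M : ℝ} (hα : 0 < α) (hγ : 0 < γ) (hR : 0 < R)
    (hħ : 0 < ħ) (hM : M ≠ 0) (k : ℝ) (m : ℤ) {β : ℕ → ℝ}
    (hβ : EnumeratesRoots (|(m : ℝ)| / α) (R / γ) β) :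
    {E : ℂ | ∃ ψ, IsRadialBoundState α γ R ħ M k m E ψ} =
      {E : ℂ | ∃ n, 1 ≤ n ∧ E = energy ħ M k (β n)} := by
  ext E
  constructor
  · rintro ⟨ψ, h⟩
    obtain ⟨b, hb, hJ, hE, -⟩ := exists_eq_besselJ_of_solvesRadial hα hγ hR h.1 h.2.1 h.2.2.1
      h.2.2.2.1 (h.exists_ne_zero hR)
    obtain ⟨n, hn, rfl⟩ := hβ.2.symm.subset ⟨hb, hJ⟩
    exact ⟨n, hn, (eq_energy_iff hħ hM).2 hE⟩
  · rintro ⟨n, hn, hE⟩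
    obtain ⟨hb, hJ⟩ := hβ.2.subset ⟨n, hn, rfl⟩
    obtain ⟨c, hc⟩ := exists_normalized_besselJ_rho (ν := |(m : ℝ)| / α) (by positivity) hγ hR hb
    exact ⟨_, isRadialBoundState_of_eq_besselJ hα hγ hR hb ((eq_energy_iff hħ hM).1 hE) hJ
      (fun _ _ => rfl) hc⟩

theorem isRadialBoundState_energy_iff {α γ R ħ M : ℝ} (hα : 0 < α) (hγ : 0 < γ) (hR : 0 < R)
    (hħ : 0 < ħ) (hM : M ≠ 0) (k : ℝ) (m : ℤ) {b : ℝ} (hb : 0 < b)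
    (hJ : besselJ (|(m : ℝ)| / α) ((b * (R / γ) : ℝ) : ℂ) = 0) (ψ : ℝ → ℂ) :
    IsRadialBoundState α γ R ħ M k m (energy ħ M k b) ψ ↔
      (∃ c : ℂ, ∀ r ∈ Ioc 0 R, ψ r = c * besselJ (|(m : ℝ)| / α) ((b * rho γ R r : ℝ) : ℂ)) ∧
      ∫ r in (0 : ℝ)..R, r * ‖ψ r‖ ^ 2 = 1 := by
  have hE := (eq_energy_iff (k := k) (b := b) hħ hM).1 rfl
  constructor
  · intro h
    obtain ⟨b', hb', -, hE', hc⟩ := exists_eq_besselJ_of_solvesRadial hα hγ hR h.1 h.2.1 h.2.2.1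
      h.2.2.2.1 (h.exists_ne_zero hR)
    -- The energy determines the square of the root, hence the positive root itself.
    have hsq : b ^ 2 = b' ^ 2 := by exact_mod_cast hE.symm.trans hE'
    obtain rfl : b = b' := (pow_left_inj₀ hb.le hb'.le two_ne_zero).1 hsq
    exact ⟨hc, h.2.2.2.2⟩
  · rintro ⟨⟨c, hc⟩, hn⟩
    exact isRadialBoundState_of_eq_besselJ hα hγ hR hb hE hJ hc hn

theorem circleCoeff_exp (m n : ℤ) :
    circleCoeff (fun φ : ℝ => Complex.exp (Complex.I * m * φ)) n = if n = m then 1 else 0 := by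
  have hπ : (π : ℂ) ≠ 0 := by exact_mod_cast Real.pi_ne_zero
  split_ifs with h
  · subst h
    have e : ∀ φ : ℝ, Complex.exp (Complex.I * n * φ) * Complex.exp (-(Complex.I * n * φ)) = 1 :=
      fun φ => by rw [← Complex.exp_add, add_neg_cancel, Complex.exp_zero]
    simp only [circleCoeff, e, intervalIntegral.integral_const]
    rw [sub_zero, Complex.real_smul]
    push_cast
    field_simp
  · have he : ∀ φ : ℝ, HasDerivAt (fun φ : ℝ => Complex.exp (Complex.I * m * φ))
        (Complex.I * m * Complex.exp (Complex.I * m * φ)) φ := fun φ => by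
      have h : HasDerivAt (fun φ : ℝ => (φ : ℂ)) 1 φ := Complex.ofRealCLM.hasDerivAt
      simpa [mul_comm] using (h.const_mul (Complex.I * m)).cexp
    have hper : Complex.exp (Complex.I * m * ((2 * π : ℝ) : ℂ)) =
        Complex.exp (Complex.I * m * ((0 : ℝ) : ℂ)) := by
      rw [Complex.ofReal_zero, mul_zero, Complex.exp_zero, Complex.exp_eq_one_iff]
      exact ⟨m, by push_cast; ring⟩
    have key := circleCoeff_deriv he (by fun_prop) hper n
    rw [circleCoeff_const_mul] at key
    have hmn : Complex.I * ((n : ℂ) - m) ≠ 0 :=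
      mul_ne_zero Complex.I_ne_zero (sub_ne_zero.2 (by exact_mod_cast h))
    refine (mul_eq_zero.1 ?_).resolve_left hmn
    linear_combination -key

theorem angularComponent_mul_exp (ψ : ℝ → ℂ) (m n : ℤ) (r : ℝ) :
    angularComponent (fun p : ℝ × ℝ => ψ p.1 * Complex.exp (Complex.I * m * p.2)) n r =
      if n = m then ψ r else 0 := by
  refine (circleCoeff_const_mul (ψ r) _ n).trans ?_
  rw [circleCoeff_exp, mul_ite, mul_one, mul_zero]

theorem isPlanarFactor_mul_exp {R : ℝ} {ψ : ℝ → ℂ} (h : ContDiffOn ℝ 2 ψ (Ioo 0 R)) (m : ℤ) :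
    IsPlanarFactor R fun p : ℝ × ℝ => ψ p.1 * Complex.exp (Complex.I * m * p.2) := by
  constructor
  · have h1 : ContDiffOn ℝ 2 (fun p : ℝ × ℝ => ψ p.1) (Ioo 0 R ×ˢ univ) :=
      h.comp contDiff_fst.contDiffOn fun p hp => hp.1
    have h2 : ContDiff ℝ 2 fun p : ℝ × ℝ => Complex.exp (Complex.I * m * p.2) :=
      (contDiff_const.mul (Complex.ofRealCLM.contDiff.comp contDiff_snd)).cexp
    exact h1.mul h2.contDiffOn
  · intro r φ
    have : Complex.I * m * ((φ + 2 * π : ℝ) : ℂ) =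
        Complex.I * m * φ + m * (2 * π * Complex.I) := by push_cast; ring
    simp only [this, Complex.exp_add, Complex.exp_int_mul_two_pi_mul_I, mul_one]

/-- A nonzero χ has a nonzero angular component, which inherits the bound, the continuity up to the
wall and the boundary condition. Conversely the single mode J_ν(bρ) e^{imφ} is a bound state. -/
theorem isBoundStateEnergy_iff {α γ R ħ M k : ℝ} (hα : 0 < α) (hγ : 0 < γ) (hR : 0 < R)
    (hħ : 0 < ħ) (hM : M ≠ 0) {I : Set ℝ} {Z : ℝ → ℂ} (hZ : IsAxialFactor k I Z) (E : ℂ) :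
    IsBoundStateEnergy α γ R ħ M I Z E ↔ ∃ (m : ℤ) (b : ℝ), 0 < b ∧
      besselJ (|(m : ℝ)| / α) ((b * (R / γ) : ℝ) : ℂ) = 0 ∧ E = energy ħ M k b := by
  constructor
  · rintro ⟨χ, hχ, hs, hc, h0, ⟨C, hC⟩, r, hr, φ, hne⟩
    obtain ⟨m, hm⟩ : ∃ m : ℤ, angularComponent χ m r ≠ 0 := by
      by_contra! hz
      have := hχ.hasSum_angularComponent hr φ
      simp only [hz, zero_mul] at this
      exact hne (this.unique hasSum_zero)
    obtain ⟨b, hb, hJ, hE, -⟩ := exists_eq_besselJ_of_solvesRadial hα hγ hR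
      ((solvesSchrodinger_iff hα hγ hR hħ hM hZ E hχ).1 hs m)
      (continuousOn_angularComponent (Or.inr rfl) hc m) (by simp [angularComponent, h0])
      ⟨C, fun r hr => norm_circleCoeff_le (fun φ _ => hC r hr φ) m⟩
      ⟨r, Ioo_subset_Ioc_self hr, hm⟩
    exact ⟨m, b, hb, hJ, (eq_energy_iff hħ hM).2 hE⟩
  · rintro ⟨m, b, hb, hJ, hE⟩
    have hν : 0 ≤ |(m : ℝ)| / α := by positivity
    set ψ : ℝ → ℂ := fun r => besselJ (|(m : ℝ)| / α) ((b * rho γ R r : ℝ) : ℂ)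
    have hψ : ContinuousOn ψ (Ici 0) := continuousOn_besselJ_rho hν hγ hR hb
    have hsol : SolvesRadial α γ R ħ M k m E ψ :=
      solvesRadial_of_eq_besselJ hα hγ hR hb ((eq_energy_iff hħ hM).1 hE) (c := 1)
        fun r _ => (one_mul _).symm
    have hpf := isPlanarFactor_mul_exp hsol.1 m
    have hexp : ∀ φ : ℝ, ‖Complex.exp (Complex.I * m * φ)‖ = 1 := fun φ => by
      rw [show Complex.I * m * φ = ((m * φ : ℝ) : ℂ) * Complex.I by push_cast; ring,
        Complex.norm_exp_ofReal_mul_I]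
    refine ⟨_, hpf, (solvesSchrodinger_iff hα hγ hR hħ hM hZ E hpf).2 fun n => ?_, ?_, fun φ => ?_,
      ?_, ?_⟩
    · rw [show angularComponent _ n = _ from funext (angularComponent_mul_exp ψ m n)]
      rcases eq_or_ne n m with rfl | hn
      · simpa using hsol
      · simp only [if_neg hn]
        exact ⟨contDiffOn_const, fun r _ => by simp⟩
    · refine ContinuousOn.mul (hψ.comp continuous_fst.continuousOn fun p hp => hp.1.1.le) ?_
      exact Continuous.continuousOn (by fun_prop)
    · simp only [ψ, rho_self hγ hR, hJ, zero_mul]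
    · obtain ⟨C, hC⟩ := (isCompact_Icc (a := (0 : ℝ)) (b := R)).exists_bound_of_continuousOn
        (hψ.mono fun r hr => hr.1)
      refine ⟨C, fun r hr φ => ?_⟩
      rw [norm_mul, hexp, mul_one]
      exact hC r (Ioo_subset_Icc_self hr)
    · obtain ⟨r, hr, hne⟩ := exists_besselJ_rho_ne_zero hν hγ hR hb
      exact ⟨r, hr, 0, mul_ne_zero hne (Complex.exp_ne_zero _)⟩

end WedgeDislocation

theorem mainTheorem5 (θ σ R : ℝ) (hθ : -1 < θ) (hσ₁ : -1 ≤ σ) (hσ₂ : σ ≤ 1 / 2) (hR : 0 < R)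
    (α γ : ℝ) (hα : α = WedgeDislocation.alpha θ) (hγ : γ = WedgeDislocation.gam θ σ) :
    -- the roots `β m n`, `n = 1, 2, …`, of `J_ν(β R / γ) = 0`, `ν = |m| / α`
    ∃ β : ℤ → ℕ → ℝ,
      (∀ m : ℤ,
        WedgeDislocation.EnumeratesRoots (|(m : ℝ)| / α) (R / γ) (β m) ∧
        (∀ z : ℂ, WedgeDislocation.besselJ (|(m : ℝ)| / α) (z * ((R / γ : ℝ) : ℂ)) = 0 →
          z.im = 0) ∧
        (∀ n, 1 ≤ n → deriv (WedgeDislocation.besselJ (|(m : ℝ)| / α))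
          ((β m n * (R / γ) : ℝ) : ℂ) ≠ 0) ∧
        -- large-`n` asymptotics
        Tendsto (fun n : ℕ => β m n - γ * π / R * (n + |(m : ℝ)| / (2 * α) - 1 / 4))
          atTop (𝓝 0)) ∧
      -- `ρ` is an admissible new radial coordinate
      BijOn (WedgeDislocation.rho γ R) (Ioo 0 R) (Ioo 0 (R / γ)) ∧
      WedgeDislocation.rho γ R R = R / γ ∧
      ∀ (ħ M k : ℝ) (I : Set ℝ) (Z : ℝ → ℂ), 0 < ħ → M ≠ 0 →
        WedgeDislocation.IsAxialFactor k I Z →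
        -- separation of variables
        (∀ (E : ℂ) (χ : ℝ × ℝ → ℂ), WedgeDislocation.IsPlanarFactor R χ →
          (∀ r ∈ Ioo 0 R, ∀ φ : ℝ,
            HasSum (fun m : ℤ => WedgeDislocation.angularComponent χ m r *
              Complex.exp (Complex.I * m * φ)) (χ (r, φ))) ∧
          (WedgeDislocation.SolvesSchrodinger α γ R ħ M I E (WedgeDislocation.waveFunction Z χ) ↔
            ∀ m : ℤ, WedgeDislocation.SolvesRadial α γ R ħ M k m E
              (WedgeDislocation.angularComponent χ m))) ∧
        -- the radial equation is the Bessel equation in the coordinate `ρ`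
        (∀ (m : ℤ) (E : ℂ) (f : ℝ → ℂ),
          WedgeDislocation.SolvesRadial α γ R ħ M k m E
              (fun r => f (WedgeDislocation.rho γ R r)) ↔
            WedgeDislocation.SolvesBessel (|(m : ℝ)| / α) (R / γ)
              (((2 * M / ħ ^ 2 : ℝ) : ℂ) * E - ((k ^ 2 : ℝ) : ℂ)) f) ∧
        -- the spectrum of the radial problem, and its eigenfunctions
        (∀ m : ℤ,
          {E : ℂ | ∃ ψ, WedgeDislocation.IsRadialBoundState α γ R ħ M k m E ψ} =
            {E : ℂ | ∃ n, 1 ≤ n ∧ E = WedgeDislocation.energy ħ M k (β m n)} ∧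
          ∀ n, 1 ≤ n → ∀ ψ : ℝ → ℂ,
            WedgeDislocation.IsRadialBoundState α γ R ħ M k m
                (WedgeDislocation.energy ħ M k (β m n)) ψ ↔
              (∃ c : ℂ, ∀ r ∈ Ioc 0 R, ψ r = c * WedgeDislocation.besselJ (|(m : ℝ)| / α)
                ((β m n * WedgeDislocation.rho γ R r : ℝ) : ℂ)) ∧
              ∫ r in (0 : ℝ)..R, r * ‖ψ r‖ ^ 2 = 1) ∧
        -- the spectrum of bound states in the cylinder
        {E : ℂ | WedgeDislocation.IsBoundStateEnergy α γ R ħ M I Z E} =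
          {E : ℂ | ∃ (m : ℤ) (n : ℕ), 1 ≤ n ∧
            E = WedgeDislocation.energy ħ M k (β m n)} := by
  have hα0 : 0 < α := by rw [hα, WedgeDislocation.alpha]; linarith
  have hγ0 : 0 < γ := hγ ▸ WedgeDislocation.gam_pos hθ σ
  have ha : 0 < R / γ := div_pos hR hγ0
  have hν : ∀ m : ℤ, 0 ≤ |(m : ℝ)| / α := fun m => by positivity
  choose β hβ hlim using fun m : ℤ => WedgeDislocation.exists_enumeratesRoots (R := R) hγ0 hR
    (abs_nonneg (m : ℝ)) hα0 rfl
  have hroot : ∀ m n, 1 ≤ n → 0 < β m n ∧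
      WedgeDislocation.besselJ (|(m : ℝ)| / α) ((β m n * (R / γ) : ℝ) : ℂ) = 0 :=
    fun m n hn => (hβ m).2.subset ⟨n, hn, rfl⟩
  refine ⟨β, fun m => ⟨hβ m, fun z hz => WedgeDislocation.im_eq_zero_of_besselJ_eq_zero (hν m) ha hz,
    fun n hn => WedgeDislocation.deriv_besselJ_ne_zero (hν m) (mul_pos (hroot m n hn).1 ha)
      (hroot m n hn).2, hlim m⟩, WedgeDislocation.bijOn_rho hγ0 hR,
    WedgeDislocation.rho_self hγ0 hR, fun ħ M k I Z hħ hM hZ => ⟨fun E χ hχ =>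
      ⟨fun r hr φ => hχ.hasSum_angularComponent hr φ,
        WedgeDislocation.solvesSchrodinger_iff hα0 hγ0 hR hħ hM hZ E hχ⟩,
      fun m E f => WedgeDislocation.solvesRadial_comp_rho_iff hα0 hγ0 hR ħ M k m E f,
      fun m => ⟨WedgeDislocation.setOf_isRadialBoundState_eq hα0 hγ0 hR hħ hM k m (hβ m),
        fun n hn ψ => WedgeDislocation.isRadialBoundState_energy_iff hα0 hγ0 hR hħ hM k m
          (hroot m n hn).1 (hroot m n hn).2 ψ⟩, ?_⟩⟩
  ext E
  rw [mem_ofPred_eq, WedgeDislocation.isBoundStateEnergy_iff hα0 hγ0 hR hħ hM hZ]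
  refine exists_congr fun m => ⟨?_, ?_⟩
  · rintro ⟨b, hb, hJ, hE⟩
    obtain ⟨n, hn, rfl⟩ := (hβ m).2.symm.subset ⟨hb, hJ⟩
    exact ⟨n, hn, hE⟩
  · rintro ⟨n, hn, hE⟩
    exact ⟨β m n, (hroot m n hn).1, (hroot m n hn).2, hE⟩
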